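/- Work over the field $\mathbb{C}(t)$, $t$ an indeterminate. **Fermions.** A Maya diagram is a string $\sigma:\mathbb{Z}\to\{0,1\}$ with $\sigma_i=1$ for $i\ll 0$ and $\sigma_i=0$ for $i\gg0$. For a partition $\lambda$ and $c\in\mathbb{Z}$ let $\sigma(\lambda,c)$ be the Maya diagram with ones exactly at the positions $c+1+\lambda_j-j$, $j\ge1$; every Maya diagram is of this form for a unique pair $(\lambda,c)$. Let $\mathcal{F}(t)$ be the $\mathbb{C}(t)$-vector space with basis the Maya diagrams. Let $\psi_i^+(t)\sigma=(-t)^{\sum_{j>i}\sigma_j}(\sigma+\epsilon_i)$ if $\sigma_i=0$ and $0$ otherwise, $\psi_i^-(t)\sigma=(-t)^{-\sum_{j>i}\sigma_j}(\sigma-\epsilon_i)$ if $\sigma_i=1$ and $0$ otherwise, where $\sigma\pm\epsilon_i$ changes the letter at position $i$. Put $E_{ij}(t)=(1-t)\psi_i^-(t)\psi_j^+(t)$ and $$A(x;t)=\sum_{r\ge0}x^rA_r(t)=1+\sum_{r>0}\ \sum_{i_1<j_1<\cdots<i_r<j_r}(xt)^{j_1-i_1+\cdots+j_r-i_r}E_{i_1j_1}(t)\cdots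 E_{i_rj_r}(t)\in \operatorname{End}(\mathcal{F}(t))[[x]].$$ **Bosons.** Let $\Lambda(t)=\mathbb{C}(t)[p_1,p_2,\dots]$ be the ring of symmetric functions in $Y=y_1+y_2+\cdots$, with power sums $p_r$, Schur functions $s_\lambda$ and Hall inner product $\langle p_\lambda,p_\mu\rangle=z_\lambda\delta_{\lambda\mu}$. Put $\langle f,g\rangle_t=\langle f[Y/(1-t)],g[Y]\rangle$, where $f\mapsto f[Y/(1-t)]$ is the $\mathbb{C}(t)$-algebra map $p_r\mapsto p_r/(1-t^r)$. Let $\imath_t:\mathcal{F}(t)\to\bigoplus_{c\in\mathbb{Z}}z^c\otimes\Lambda(t)$ be the linear map with $\sigma(\lambda,c)\mapsto z^c\otimes s_\lambda$. Let $\langle\cdot,\cdot\rangle_t$ also denote the bilinear form on $\mathcal{F}(t)$ that is the pullback along $\imath_t$ of the form $\langle z^c\otimes f,z^{d}\otimes g\rangle_t=\delta_{cd}\langle f,g\rangle_t$. All adjoints, written with $*$, are taken for $\langle\cdot,\cdot\rangle_t$, with $x^*=x^{-1}$; in particular $A^*(x;t)=\sum_s x^{-s}A_s^*$. Jing's vertex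 operators on $\Lambda(t)$, which act on $\bigoplus_c z^c\otimes\Lambda(t)$ through the second factor, are the formal Laurent series with operator coefficients $$\Phi^{-}(x;t)=\exp\Big(\sum_{r>0}\tfrac{1-t^r}{r}p_rx^r\Big)\circ\exp\Big(\sum_{r>0}\tfrac{t^r-1}{r}p_r^*x^{-r}\Big),\qquad \Phi^{+}(x;t)=\exp\Big(\sum_{r>0}\tfrac{t^r-1}{r}p_rx^r\Big)\circ\exp\Big(\sum_{r>0}\tfrac{1-t^r}{r}p_r^*x^{-r}\Big).$$ **Proposition.** 1. The map $\imath_t$ is an isomorphism. The operator $A(x;t)$ is the row transfer matrix of the asymmetric six-vertex model: for Maya diagrams $\sigma,\sigma'$ the coefficient of $\sigma'$ in $A(x;t)\sigma$ is $\sum_{e}\prod_{i\in\mathbb{Z}}\Omega(e_{i-1},\sigma_i,e_i,\sigma'_i)$, the sum over all $e:\mathbb{Z}\to\{0,1\}$ with finitely many ones, where $\Omega(W,N,E,S)$ has the values $\Omega(0,0,0,0)=\Omega(0,1,0,1)=\Omega(1,0,0,1)=1$, $\Omega(1,1,1,1)=-x$, $\Omega(1,0,1,0)=tx$, $\Omega(0,1,1,0)=(t-1)x$,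 and is zero otherwise. The power series $A(x;t)$ is invertible; write $A^{-1}(x;t)=\sum_{r\ge 0}x^rA^{-1}_r$ for its inverse. The operators $A_r$ and $A^{-1}_r$ on $\mathcal{F}(t)$ and multiplication by $p_r$ on $\Lambda(t)$ have unique adjoints, and the coefficients of all Laurent series below are sums of operators that are finite on every vector. 2. One has, coefficientwise in $x$, $$\Phi^-(x;t)\circ\imath_t=\imath_t\circ A^{-1}(x;t)\circ A^*(x;t)\qquad\text{and}\qquad \Phi^+(x;t)\circ\imath_t=\imath_t\circ A(x;t)\circ(A^{-1}(x;t))^*.$$ 3. The operators $\Psi_m=\sum_{r-s=m}A_r^{-1}A_s^*$, $m\in\mathbb{Z}$, satisfy for all $r,s\in\mathbb{Z}$ $$\Psi_{r-1}\Psi_s-t\Psi_r\Psi_{s-1}=t\Psi_s\Psi_{r-1}-\Psi_{s-1}\Psi_r .$$ 4. For every partition $\lambda$ of length $\ell$ and every $c\in\mathbb{Z}$, $$\imath_t\big(\Psi_{\lambda_1}\Psi_{\lambda_2}\cdots\Psi_{\lambda_\ell}\,\sigma(\varnothing,c)\big)=z^c\otimes Q_\lambda(y;t),$$ where $Q_\lambda(y;t)\in\Lambda(t)$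 is the Hall--Littlewood function, i.e. the symmetric function whose restriction to $n$ variables is, for all $n\ge\ell$, $$Q_\lambda(y_1,\dots,y_n;t)=(1-t)^\ell\prod_{i=1}^{n-\ell}\frac{1-t}{1-t^i}\ \sum_{w\in S_n}w\Big(y_1^{\lambda_1}\cdots y_n^{\lambda_n}\prod_{1\le i<j\le n}\frac{y_i-ty_j}{y_i-y_j}\Big).$$ -/

import Mathlib

open scoped PowerSeries

namespace HallLittlewoodIce

noncomputable section

/-! ### The ground field and locally finite sums of operators -/

/-- The ground field `ℂ(t)`. -/
abbrev K : Type := RatFunc ℂ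

/-- The indeterminate `t` of `ℂ(t)`. -/
def t : K := RatFunc.X

section Operators

variable {V : Type*} [AddCommGroup V] [Module K V]

/-- A family of operators is pointwise finite if on every vector only finitely many of its members
do not vanish. -/
def PointwiseFinite {I : Type*} (T : I → Module.End K V) : Prop :=
  ∀ v : V, (Function.support fun i => T i v).Finite

open Classical in
/-- The operator `v ↦ ∑ i, T i v`, for a pointwise finite family `T`
(and the zero operator for any other family). -/
def sumOp {I : Type*} (T : I → Module.End K V) : Module.End K V :=
  if h : PointwiseFinite T then
    { toFun := fun v => ∑ᶠ i, T i v
      map_add' := fun v w => by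
        simp only [map_add]
        exact finsum_add_distrib (h v) (h w)
      map_smul' := fun a v => by
        simp only [map_smul, RingHom.id_apply]
        exact (smul_finsum' a (h v)).symm }
  else 0

/-- The terms `a_r ∘ b_s` with `r - s = m` of the coefficient of `x ^ m` in the product of
`∑ r, a_r x ^ r` with `∑ s, b_s x ^ (-s)`. -/
def laurentTerms (a b : ℕ → Module.End K V) (m : ℤ) :
    {p : ℕ × ℕ // (p.1 : ℤ) - (p.2 : ℤ) = m} → Module.End K V :=
  fun p => a p.1.1 * b p.1.2

/-- The coefficient of `x ^ m` in the product of `∑ r, a_r x ^ r` with `∑ s, b_s x ^ (-s)`. -/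
def laurentCoeff (a b : ℕ → Module.End K V) (m : ℤ) : Module.End K V :=
  sumOp (laurentTerms a b m)

open Classical in
/-- The adjoint of `f` for the bilinear form `B`: an operator `g` with `B (f v) w = B v (g w)` for
all `v`, `w` (and zero if there is none). -/
def adjointOp (B : LinearMap.BilinForm K V) (f : Module.End K V) : Module.End K V :=
  if h : ∃ g : Module.End K V, LinearMap.IsAdjointPair B B f g then h.choose else 0

end Operators

/-- The exponential `∑ k, f ^ k / k!` of a power series `f` without constant term. The coefficients
need not commute. As `f ^ k` starts in degree `k`, the sum over `k` stops at `n` in degree `n`. -/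
def expSeries {R : Type*} [Ring R] [Algebra K R] (f : R⟦X⟧) : R⟦X⟧ :=
  PowerSeries.mk fun n =>
    ∑ k ∈ Finset.range (n + 1), ((k.factorial : K)⁻¹) • PowerSeries.coeff n (f ^ k)

/-- The power series `∑ r > 0, c_r P_r x ^ r`. -/
def positiveSeries {R : Type*} [Ring R] [Algebra K R] (c : ℕ+ → K) (P : ℕ+ → R) : R⟦X⟧ :=
  PowerSeries.mk fun n => if h : 0 < n then c ⟨n, h⟩ • P ⟨n, h⟩ else 0

/-! ### The bosonic Fock space -/

/-- The ring of symmetric functions `Λ(t) = ℂ(t)[p_1, p_2, …]`, with the power sum `p_r` as the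
variable with index `r`. -/
abbrev Lam : Type := MvPolynomial ℕ+ K

/-- The number `z_λ = ∏ r ^ (m_r) * m_r!` for a partition `λ` with multiplicities `m_r`. -/
def zNumber (m : ℕ+ →₀ ℕ) : K := m.prod fun r k => ((r : ℕ) : K) ^ k * (k.factorial : K)

/-- The Hall inner product on `Λ(t)`: `⟨p_λ, p_μ⟩ = z_λ δ_{λμ}`. -/
def hallForm : LinearMap.BilinForm K Lam :=
  (MvPolynomial.basisMonomials ℕ+ K).constr K fun m => zNumber m • MvPolynomial.lcoeff K m

/-- The plethystic substitution `f[Y] ↦ f[Y / (1 - t)]`, that is `p_r ↦ p_r / (1 - t ^ r)`. -/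
def plethysm : Lam →ₐ[K] Lam :=
  MvPolynomial.aeval fun r : ℕ+ => (1 - t ^ (r : ℕ))⁻¹ • (MvPolynomial.X r : Lam)

/-- The deformed inner product `⟨f, g⟩_t = ⟨f[Y / (1 - t)], g[Y]⟩` on `Λ(t)`. -/
def tForm : LinearMap.BilinForm K Lam := LinearMap.comp hallForm plethysm.toLinearMap

/-- Multiplication by the power sum `p_r`. -/
def pMul (r : ℕ+) : Module.End K Lam := LinearMap.mulLeft K (MvPolynomial.X r)

/-- The adjoint of `pMul r` for the deformed inner product. -/
def pAdj (r : ℕ+) : Module.End K Lam := adjointOp tForm (pMul r)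

/-- The coefficient `(1 - t ^ r) / r`. -/
def gCoeff (r : ℕ+) : K := (1 - t ^ (r : ℕ)) / ((r : ℕ) : K)

/-- The operator terms of the coefficient of `x ^ m` in Jing's vertex operator
`Φ⁻(x;t) = exp (∑ r, (1 - t ^ r) / r * p_r x ^ r) ∘ exp (∑ r, (t ^ r - 1) / r * p_r^* x ^ (-r))`. -/
def phiMinusTerms (m : ℤ) : {p : ℕ × ℕ // (p.1 : ℤ) - (p.2 : ℤ) = m} → Module.End K Lam :=
  laurentTerms (fun r => PowerSeries.coeff r (expSeries (positiveSeries gCoeff pMul)))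
    (fun s => PowerSeries.coeff s (expSeries (positiveSeries (-gCoeff) pAdj))) m

/-- The coefficient of `x ^ m` in `Φ⁻(x;t)`. -/
def phiMinus (m : ℤ) : Module.End K Lam := sumOp (phiMinusTerms m)

/-- The operator terms of the coefficient of `x ^ m` in Jing's vertex operator
`Φ⁺(x;t) = exp (∑ r, (t ^ r - 1) / r * p_r x ^ r) ∘ exp (∑ r, (1 - t ^ r) / r * p_r^* x ^ (-r))`. -/
def phiPlusTerms (m : ℤ) : {p : ℕ × ℕ // (p.1 : ℤ) - (p.2 : ℤ) = m} → Module.End K Lam :=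
  laurentTerms (fun r => PowerSeries.coeff r (expSeries (positiveSeries (-gCoeff) pMul)))
    (fun s => PowerSeries.coeff s (expSeries (positiveSeries gCoeff pAdj))) m

/-- The coefficient of `x ^ m` in `Φ⁺(x;t)`. -/
def phiPlus (m : ℤ) : Module.End K Lam := sumOp (phiPlusTerms m)

/-- The complete symmetric function `h_n`, from `∑ n, h_n x ^ n = exp (∑ r, p_r x ^ r / r)`,
with `h_n = 0` for `n < 0`. -/
def complete (n : ℤ) : Lam :=
  if 0 ≤ n then
    PowerSeries.coeff n.toNat
      (expSeries (positiveSeries (fun r => ((r : ℕ) : K)⁻¹) fun r => (MvPolynomial.X r : Lam)))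
  else 0

/-- The Schur function `s_λ = det (h_{λ_i - i + j})`. Here `λ.rowLen i` is the part `λ_{i+1}`, and
`λ.colLen 0` is the length `ℓ(λ)`. -/
def schur (lam : YoungDiagram) : Lam :=
  Matrix.det (Matrix.of fun i j : Fin (lam.colLen 0) =>
    complete ((lam.rowLen i : ℤ) - ((i : ℕ) : ℤ) + ((j : ℕ) : ℤ)))

/-! ### Hall-Littlewood functions -/

/-- The restriction of a symmetric function to `n` variables `y_1, …, y_n`. -/
def restrictVars (n : ℕ) : Lam →ₐ[K] MvPolynomial (Fin n) K :=
  MvPolynomial.aeval fun r : ℕ+ => MvPolynomial.psum (Fin n) K (r : ℕ)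

/-- The polynomial `v_m(t) = ∏_{i=1}^m (1 - t ^ i) / (1 - t)`. -/
def vPoly (m : ℕ) : K := ∏ i ∈ Finset.range m, (1 - t ^ (i + 1)) / (1 - t)

/-- The variable `y_i` as a rational function. -/
def yVar (n : ℕ) (i : Fin n) : FractionRing (MvPolynomial (Fin n) K) :=
  algebraMap (MvPolynomial (Fin n) K) _ (MvPolynomial.X i)

/-- The element `a` of `ℂ(t)` as a rational function in `y_1, …, y_n`. -/
def constRat (n : ℕ) (a : K) : FractionRing (MvPolynomial (Fin n) K) :=
  algebraMap (MvPolynomial (Fin n) K) _ (MvPolynomial.C a)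

/-- The Hall-Littlewood polynomial `Q_λ(y_1, …, y_n; t)` for `n ≥ ℓ = ℓ(λ)`, namely
`(1 - t) ^ ℓ / v_{n-ℓ}(t) * ∑_{w ∈ S_n} w (y ^ λ ∏_{i<j} (y_i - t y_j) / (y_i - y_j))`.
This is `b_λ(t) P_λ(y;t)`, since `b_λ(t) = ∏_{i ≥ 1} (1 - t) ^ (m_i) v_{m_i}(t)` and `P_λ` is the
same sum over `S_n` divided by `v_{n-ℓ}(t) ∏_{i ≥ 1} v_{m_i}(t)`, with `m_i` the multiplicity
of the part `i` in `λ`. -/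
def hallLittlewoodQ (lam : YoungDiagram) (n : ℕ) : FractionRing (MvPolynomial (Fin n) K) :=
  constRat n ((1 - t) ^ lam.colLen 0 / vPoly (n - lam.colLen 0)) *
    ∑ w : Equiv.Perm (Fin n),
      (∏ i : Fin n, yVar n (w i) ^ lam.rowLen i) *
        ∏ i : Fin n, ∏ j ∈ Finset.Ioi i,
          (yVar n (w i) - constRat n t * yVar n (w j)) / (yVar n (w i) - yVar n (w j))

/-- The symmetric function `q` is the Hall-Littlewood function `Q_λ(y;t)`: its restriction to `n`
variables is the Hall-Littlewood polynomial, for all `n ≥ ℓ(λ)`. -/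
def IsHallLittlewoodQ (lam : YoungDiagram) (q : Lam) : Prop :=
  ∀ n : ℕ, lam.colLen 0 ≤ n →
    algebraMap (MvPolynomial (Fin n) K) (FractionRing (MvPolynomial (Fin n) K)) (restrictVars n q) =
      hallLittlewoodQ lam n

/-! ### Maya diagrams and the fermionic Fock space -/

/-- A Maya diagram: a binary string indexed by `ℤ` with only ones far to the left and only zeros
far to the right (`true` is the letter one). -/
@[ext]
structure Maya where
  /-- The letter at each position. -/
  val : ℤ → Bool
  left_one : ∃ a : ℤ, ∀ i ≤ a, val i = true
  right_zero : ∃ b : ℤ, ∀ i ≥ b, val i = false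

/-- Replace the letter of a Maya diagram at position `i` by `b`. -/
def Maya.set (σ : Maya) (i : ℤ) (b : Bool) : Maya where
  val := Function.update σ.val i b
  left_one := by
    obtain ⟨a, ha⟩ := σ.left_one
    refine ⟨min a (i - 1), fun k hk => ?_⟩
    rw [Function.update_of_ne (by grind)]
    exact ha k (by grind)
  right_zero := by
    obtain ⟨a, ha⟩ := σ.right_zero
    refine ⟨max a (i + 1), fun k hk => ?_⟩
    rw [Function.update_of_ne (by grind)]
    exact ha k (by grind)

/-- The number of ones to the right of position `i`. -/
def Maya.onesAbove (σ : Maya) (i : ℤ) : ℕ := {j : ℤ | i < j ∧ σ.val j = true}.ncard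

theorem maya_rowLen_zero (lam : YoungDiagram) {j : ℕ} (h : lam.colLen 0 ≤ j) :
    lam.rowLen j = 0 := by
  by_contra h0
  have h1 : (j, 0) ∈ lam := YoungDiagram.mem_iff_lt_rowLen.2 (Nat.pos_of_ne_zero h0)
  exact absurd (YoungDiagram.mem_iff_lt_colLen.1 h1) (by omega)

open Classical in
/-- The Maya diagram `σ(λ, c)` with ones exactly at the positions `c + 1 + λ_j - j`, `j ≥ 1`. -/
def Maya.ofPartition (lam : YoungDiagram) (c : ℤ) : Maya where
  val := fun i => decide (∃ j : ℕ, i = c + 1 + (lam.rowLen j : ℤ) - ((j : ℤ) + 1))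
  left_one := by
    refine ⟨c - lam.colLen 0, fun i hi => decide_eq_true ⟨(c - i).toNat, ?_⟩⟩
    rw [maya_rowLen_zero lam (by omega)]
    omega
  right_zero := by
    refine ⟨c + 1 + lam.rowLen 0, fun i hi => decide_eq_false ?_⟩
    rintro ⟨j, hj⟩
    have := lam.rowLen_anti 0 j (Nat.zero_le j)
    omega

theorem maya_val_eq_true_iff (lam : YoungDiagram) (c i : ℤ) :
    (Maya.ofPartition lam c).val i = true ↔
      ∃ j : ℕ, i = c + 1 + (lam.rowLen j : ℤ) - ((j : ℤ) + 1) := by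
  simp [Maya.ofPartition]

/-- The partition with a given weakly decreasing sequence of parts that is eventually zero. -/
def partitionOfSeq (f : ℕ → ℕ) (hf : Antitone f) (n : ℕ) : YoungDiagram where
  cells := (Finset.range n ×ˢ Finset.range (f 0)).filter fun p => p.2 < f p.1
  isLowerSet := by
    rintro ⟨a, b⟩ ⟨a', b'⟩ ⟨h1, h2⟩ h
    simp only [Finset.coe_filter, Finset.mem_product, Finset.mem_range, Set.mem_ofPred_eq] at h ⊢
    simp only at h1 h2
    have := hf h1
    omega

theorem rowLen_partitionOfSeq (f : ℕ → ℕ) (hf : Antitone f) (n : ℕ) (hn : ∀ j ≥ n, f j = 0)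
    (i : ℕ) : (partitionOfSeq f hf n).rowLen i = f i := by
  have key : ∀ j, j < (partitionOfSeq f hf n).rowLen i ↔ j < f i := by
    intro j
    rw [← YoungDiagram.mem_iff_lt_rowLen, ← YoungDiagram.mem_cells]
    simp only [partitionOfSeq, Finset.mem_filter, Finset.mem_product, Finset.mem_range]
    refine ⟨fun h => h.2, fun h => ⟨⟨?_, lt_of_lt_of_le h (hf (Nat.zero_le i))⟩, h⟩⟩
    by_contra hi
    rw [hn i (by omega)] at h
    omega
  have h1 := key (f i)
  have h2 := key ((partitionOfSeq f hf n).rowLen i)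
  omega

/-- Partitions and charges are in bijection with Maya diagrams. -/
theorem ofPartition_bijective :
    Function.Bijective fun p : YoungDiagram × ℤ => Maya.ofPartition p.1 p.2 := by
  have anti : ∀ (lam : YoungDiagram) (c : ℤ),
      StrictAnti fun j : ℕ => c + 1 + (lam.rowLen j : ℤ) - ((j : ℤ) + 1) := by
    intro lam c i j hij
    have := lam.rowLen_anti i j hij.le
    simp only
    omega
  constructor
  · rintro ⟨lam, c⟩ ⟨mu, d⟩ h
    simp only at h
    have hr : (Set.range fun j : ℕ => c + 1 + (lam.rowLen j : ℤ) - ((j : ℤ) + 1)) =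
        Set.range fun j : ℕ => d + 1 + (mu.rowLen j : ℤ) - ((j : ℤ) + 1) := by
      ext i
      have h1 := maya_val_eq_true_iff lam c i
      have h2 := maya_val_eq_true_iff mu d i
      rw [h] at h1
      simp only [Set.mem_range, eq_comm (b := i)]
      rw [← h1, ← h2]
    have hfun := (StrictMono.range_inj (γ := ℤᵒᵈ) (anti lam c).dual_right
      (anti mu d).dual_right).1 hr
    have hval : ∀ j : ℕ, c + (lam.rowLen j : ℤ) = d + (mu.rowLen j : ℤ) := by
      intro j
      have hj : c + 1 + (lam.rowLen j : ℤ) - ((j : ℤ) + 1) =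
        d + 1 + (mu.rowLen j : ℤ) - ((j : ℤ) + 1) := congrFun hfun j
      linarith
    have hcd : c = d := by
      have := hval (max (lam.colLen 0) (mu.colLen 0))
      rw [maya_rowLen_zero lam (le_max_left _ _), maya_rowLen_zero mu (le_max_right _ _)] at this
      simpa using this
    have hrow : ∀ j, lam.rowLen j = mu.rowLen j := by
      intro j
      have := hval j
      omega
    refine Prod.ext ?_ hcd
    ext ⟨i, j⟩
    change (i, j) ∈ lam.cells ↔ (i, j) ∈ mu.cells
    rw [YoungDiagram.mem_cells, YoungDiagram.mem_cells, YoungDiagram.mem_iff_lt_rowLen,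
      YoungDiagram.mem_iff_lt_rowLen, hrow]
  · intro σ
    obtain ⟨a, ha⟩ := σ.left_one
    obtain ⟨b, hb⟩ := σ.right_zero
    let q : ℕ → Prop := fun k => σ.val (b - k) = true
    have hq : ∀ k : ℕ, (b - a).toNat ≤ k → q k := fun k hk => ha _ (by omega)
    have hinf : {k | q k}.Infinite :=
      Set.infinite_of_not_bddAbove fun ⟨N, hN⟩ => by
        have := hN (show N + 1 + (b - a).toNat ∈ {k | q k} from hq _ (by omega))
        omega
    have hmono : StrictMono (Nat.nth q) := Nat.nth_strictMono hinf
    have hrange : Set.range (Nat.nth q) = {k | q k} := Nat.range_nth_of_infinite hinf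
    have hstep : ∀ j ≥ (b - a).toNat, Nat.nth q (j + 1) = Nat.nth q j + 1 := by
      intro j hj
      have h1 : j ≤ Nat.nth q j := hmono.id_le j
      obtain ⟨l, hl⟩ : Nat.nth q j + 1 ∈ Set.range (Nat.nth q) := by
        rw [hrange]
        exact hq _ (by omega)
      have h2 : j < l := hmono.lt_iff_lt.1 (by omega)
      have h3 : Nat.nth q (j + 1) ≤ Nat.nth q l := hmono.monotone h2
      have h4 := hmono (Nat.lt_succ_self j)
      simp only [Nat.succ_eq_add_one] at h4
      omega
    set J := (b - a).toNat with hJ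
    set D := Nat.nth q J - J with hD
    have hDle : J ≤ Nat.nth q J := hmono.id_le J
    have hlarge : ∀ i : ℕ, Nat.nth q (J + i) = D + (J + i) := by
      intro i
      induction i with
      | zero => simp only [Nat.add_zero]; omega
      | succ i ih => rw [← Nat.add_assoc, hstep _ (by omega), ih]; omega
    have hlow : ∀ j, Nat.nth q j ≤ D + j := by
      intro j
      have hdiff : ∀ d : ℕ, Nat.nth q j + d ≤ Nat.nth q (j + d) := by
        intro d
        induction d with
        | zero => simp
        | succ d ih =>
          have := hmono (Nat.lt_succ_self (j + d))
          simp only [Nat.succ_eq_add_one] at this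
          rw [← Nat.add_assoc j d 1]
          omega
      have h1 := hdiff J
      have h2 := hlarge j
      rw [Nat.add_comm J j] at h2
      omega
    have hf : Antitone fun j => D + j - Nat.nth q j := by
      refine antitone_nat_of_succ_le fun j => ?_
      have := hmono (Nat.lt_succ_self j)
      simp only [Nat.succ_eq_add_one] at this
      omega
    have hz : ∀ j ≥ J, D + j - Nat.nth q j = 0 := by
      intro j hj
      have := hlarge (j - J)
      rw [Nat.add_sub_cancel' hj] at this
      omega
    refine ⟨(partitionOfSeq _ hf J, b - D), ?_⟩
    ext i
    rw [Bool.eq_iff_iff]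
    change (Maya.ofPartition (partitionOfSeq _ hf J) (b - D)).val i = true ↔ _
    rw [maya_val_eq_true_iff]
    simp only [rowLen_partitionOfSeq _ hf J hz]
    have hpos : ∀ j : ℕ, b - (D : ℤ) + 1 + ((D + j - Nat.nth q j : ℕ) : ℤ) - ((j : ℤ) + 1) =
        b - (Nat.nth q j : ℤ) := by
      intro j
      have := hlow j
      omega
    constructor
    · rintro ⟨j, hj⟩
      rw [hpos] at hj
      rw [hj]
      exact Nat.nth_mem_of_infinite hinf j
    · intro hi
      have hib : i < b := by
        by_contra hcon
        rw [hb i (by omega)] at hi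
        exact absurd hi (by simp)
      have hmem : (b - i).toNat ∈ {k | q k} := by
        change σ.val (b - ((b - i).toNat : ℤ)) = true
        rw [← hi]
        congr 1
        omega
      rw [← hrange] at hmem
      obtain ⟨j, hj⟩ := hmem
      refine ⟨j, ?_⟩
      rw [hpos, hj]
      omega

/-- The bijection `(λ, c) ↦ σ(λ, c)`. -/
def mayaEquiv : YoungDiagram × ℤ ≃ Maya := Equiv.ofBijective _ ofPartition_bijective

/-- The fermionic Fock space `ℱ(t)`, the `ℂ(t)`-linear span of the Maya diagrams of all charges. -/
abbrev Fock : Type := Maya →₀ K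

/-- The deformed fermion field `ψ_i⁺(t)`. -/
def psiPlus (i : ℤ) : Module.End K Fock :=
  Finsupp.linearCombination K fun σ : Maya =>
    if σ.val i = false then Finsupp.single (σ.set i true) ((-t) ^ σ.onesAbove i) else 0

/-- The deformed fermion field `ψ_i⁻(t)`. -/
def psiMinus (i : ℤ) : Module.End K Fock :=
  Finsupp.linearCombination K fun σ : Maya =>
    if σ.val i = true then Finsupp.single (σ.set i false) (((-t) ^ σ.onesAbove i)⁻¹) else 0

/-- The operator `E_{ij}(t) = (1 - t) ψ_i⁻(t) ψ_j⁺(t)`. -/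
def hop (p : ℤ × ℤ) : Module.End K Fock := (1 - t) • (psiMinus p.1 * psiPlus p.2)

/-- The sequences `i_1 < j_1 < i_2 < j_2 < ⋯ < i_r < j_r`, for all `r ≥ 0`, with
`(j_1 - i_1) + ⋯ + (j_r - i_r) = m`. -/
def HopSeq (m : ℕ) : Type :=
  {L : List (ℤ × ℤ) // (∀ p ∈ L, p.1 < p.2) ∧ L.Pairwise (fun p q => p.2 < q.1) ∧
    (L.map fun p => p.2 - p.1).sum = (m : ℤ)}

/-- The terms `t ^ m E_{i_1 j_1}(t) ⋯ E_{i_r j_r}(t)` of the coefficient of `x ^ m` in `A(x;t)`. -/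
def transferTerms (m : ℕ) (L : HopSeq m) : Module.End K Fock :=
  t ^ m • (L.1.map hop).prod

theorem hop_single (p : ℤ × ℤ) (hp : p.1 < p.2) (σ : Maya) (a : K) :
    ∃ b : K, hop p (Finsupp.single σ a) = Finsupp.single ((σ.set p.2 true).set p.1 false) b ∧
      (b ≠ 0 → a ≠ 0 ∧ σ.val p.1 = true ∧ σ.val p.2 = false) := by
  have hne : p.1 ≠ p.2 := hp.ne
  have hval : (σ.set p.2 true).val p.1 = σ.val p.1 := Function.update_of_ne hne _ _
  have hplus : psiPlus p.2 (Finsupp.single σ a) =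
      if σ.val p.2 = false then
        Finsupp.single (σ.set p.2 true) (a * (-t) ^ σ.onesAbove p.2) else 0 := by
    rw [psiPlus, Finsupp.linearCombination_single]
    split_ifs
    · rw [Finsupp.smul_single, smul_eq_mul]
    · rw [smul_zero]
  have hminus : ∀ c : K, psiMinus p.1 (Finsupp.single (σ.set p.2 true) c) =
      if σ.val p.1 = true then
        Finsupp.single ((σ.set p.2 true).set p.1 false)
          (c * ((-t) ^ (σ.set p.2 true).onesAbove p.1)⁻¹) else 0 := by
    intro c
    rw [psiMinus, Finsupp.linearCombination_single, hval]
    split_ifs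
    · rw [Finsupp.smul_single, smul_eq_mul]
    · rw [smul_zero]
  rw [hop, LinearMap.smul_apply, Module.End.mul_apply, hplus]
  by_cases h2 : σ.val p.2 = false
  · rw [if_pos h2, hminus]
    by_cases h1 : σ.val p.1 = true
    · rw [if_pos h1, Finsupp.smul_single]
      refine ⟨_, rfl, fun hb => ⟨?_, h1, h2⟩⟩
      rintro rfl
      simp at hb
    · exact ⟨0, by rw [if_neg h1, smul_zero, Finsupp.single_zero], fun hb => absurd rfl hb⟩
  · exact ⟨0, by rw [if_neg h2, map_zero, smul_zero, Finsupp.single_zero],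
      fun hb => absurd rfl hb⟩

theorem hop_list_bound (σ : Maya) (lo hi : ℤ) (hlo : ∀ i ≤ lo, σ.val i = true)
    (hhi : ∀ i ≥ hi, σ.val i = false) (m : ℕ) (L : List (ℤ × ℤ))
    (hL : ∀ p ∈ L, p.1 < p.2 ∧ p.2 - p.1 ≤ (m : ℤ)) :
    ∃ (τ : Maya) (a : K), (L.map hop).prod (Finsupp.single σ 1) = Finsupp.single τ a ∧
      (a ≠ 0 → (∀ i ≤ lo - m * L.length, τ.val i = true) ∧
        (∀ i ≥ hi + m * L.length, τ.val i = false) ∧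
        ∀ p ∈ L, lo - m * L.length ≤ p.1 ∧ p.2 ≤ hi + m * L.length) := by
  induction L with
  | nil => exact ⟨σ, 1, by simp, fun _ => ⟨by simpa using hlo, by simpa using hhi, by simp⟩⟩
  | cons p L ih =>
    obtain ⟨τ, a, h1, h2⟩ := ih fun q hq => hL q (List.mem_cons_of_mem _ hq)
    obtain ⟨hp, hpm⟩ := hL p List.mem_cons_self
    obtain ⟨b, h3, h4⟩ := hop_single p hp τ a
    refine ⟨_, b, by rw [List.map_cons, List.prod_cons, Module.End.mul_apply, h1, h3], fun hb => ?_⟩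
    obtain ⟨ha, hp1, hp2⟩ := h4 hb
    obtain ⟨h5, h6, h7⟩ := h2 ha
    have e : (m : ℤ) * ((p :: L).length : ℤ) = m * L.length + m := by
      rw [List.length_cons]; push_cast; ring
    rw [e]
    have g1 : p.1 < hi + m * L.length := by
      by_contra hc
      rw [h6 _ (by omega)] at hp1
      simp at hp1
    have g2 : lo - m * L.length < p.2 := by
      by_contra hc
      rw [h5 _ (by omega)] at hp2
      simp at hp2
    refine ⟨fun i hi' => ?_, fun i hi' => ?_, fun q hq => ?_⟩
    · change Function.update (Function.update τ.val p.2 true) p.1 false i = true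
      by_cases hi1 : i = p.1
      · exfalso
        omega
      · rw [Function.update_of_ne hi1]
        by_cases hi2 : i = p.2
        · rw [hi2, Function.update_self]
        · rw [Function.update_of_ne hi2]
          exact h5 i (by omega)
    · change Function.update (Function.update τ.val p.2 true) p.1 false i = false
      by_cases hi1 : i = p.1
      · rw [hi1, Function.update_self]
      · rw [Function.update_of_ne hi1]
        by_cases hi2 : i = p.2
        · exfalso
          omega
        · rw [Function.update_of_ne hi2]
          exact h6 i (by omega)
    · rcases List.mem_cons.1 hq with rfl | hq
      · constructor <;> omega
      · have := h7 q hq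
        constructor <;> omega

/-- The sum that defines `A_m(t)` is finite on every vector. -/
theorem transferTerms_pointwiseFinite (m : ℕ) : PointwiseFinite (transferTerms m) := by
  have basic : ∀ σ : Maya,
      (Function.support fun L : HopSeq m => transferTerms m L (Finsupp.single σ 1)).Finite := by
    intro σ
    obtain ⟨lo, hlo⟩ := σ.left_one
    obtain ⟨hi, hhi⟩ := σ.right_zero
    let S : Set (ℤ × ℤ) :=
      Set.Icc (lo - m * m) (hi + m * m) ×ˢ Set.Icc (lo - m * m) (hi + m * m)
    have hS : S.Finite := (Set.finite_Icc _ _).prod (Set.finite_Icc _ _)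
    have : Finite S := hS
    have hfin : ((fun l : List S => l.map Subtype.val) '' {l : List S | l.length ≤ m}).Finite :=
      (List.finite_length_le S m).image _
    refine Set.Finite.of_finite_image (f := Subtype.val) (hfin.subset ?_)
      Subtype.val_injective.injOn
    rintro _ ⟨⟨L, hL1, hL2, hL3⟩, hL, rfl⟩
    have hlen : L.length ≤ m ∧ ∀ p ∈ L, p.2 - p.1 ≤ (m : ℤ) := by
      rw [← hL3] at *
      clear hL hL2 hfin
      have : ∀ L : List (ℤ × ℤ), (∀ p ∈ L, p.1 < p.2) →
          (L.length : ℤ) ≤ (L.map fun p => p.2 - p.1).sum ∧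
            ∀ p ∈ L, p.2 - p.1 ≤ (L.map fun p => p.2 - p.1).sum := by
        intro L
        induction L with
        | nil => simp
        | cons q L ih =>
          intro h
          obtain ⟨i1, i2⟩ := ih fun p hp => h p (List.mem_cons_of_mem _ hp)
          have hq := h q List.mem_cons_self
          simp only [List.length_cons, List.map_cons, List.sum_cons]
          push_cast
          refine ⟨by omega, fun p hp => ?_⟩
          rcases List.mem_cons.1 hp with rfl | hp
          · omega
          · have := i2 p hp
            omega
      obtain ⟨j1, j2⟩ := this L hL1
      exact ⟨by omega, j2⟩
    obtain ⟨τ, a, h1, h2⟩ := hop_list_bound σ lo hi hlo hhi m L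
      fun p hp => ⟨hL1 p hp, hlen.2 p hp⟩
    have ha : a ≠ 0 := by
      rintro rfl
      apply hL
      simp [transferTerms, h1]
    have h3 := (h2 ha).2.2
    have hmm : (m : ℤ) * L.length ≤ m * m :=
      mul_le_mul_of_nonneg_left (by exact_mod_cast hlen.1) (by positivity)
    refine ⟨L.attach.map fun p => ⟨p.1, ?_⟩, by simpa using hlen.1, by
      
      change List.map Subtype.val (List.map _ L.attach) = L
      rw [List.map_map]
      exact List.attach_map_subtype_val L⟩
    have h4 := h3 p.1 p.2
    have h5 := hL1 p.1 p.2
    exact ⟨⟨by omega, by omega⟩, ⟨by omega, by omega⟩⟩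
  intro v
  refine (Set.Finite.biUnion v.support.finite_toSet fun σ _ => basic σ).subset fun L hL => ?_
  by_contra hc
  apply hL
  simp only [Set.mem_iUnion, not_exists, Function.mem_support, not_not] at hc
  change transferTerms m L v = 0
  conv_lhs => rw [← Finsupp.sum_single v]
  rw [Finsupp.sum, map_sum]
  refine Finset.sum_eq_zero fun σ hσ => ?_
  have := hc σ hσ
  rw [show Finsupp.single σ (v σ) = v σ • Finsupp.single σ (1 : K) by simp, map_smul, this,
    smul_zero]

/-- The coefficient `A_m(t)` of `A(x;t)`. -/
def transferCoeff (m : ℕ) : Module.End K Fock := sumOp (transferTerms m)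

/-- The operator
`A(x;t) = 1 + ∑_{r>0} ∑_{i_1<j_1<⋯<i_r<j_r} (xt) ^ (j_1-i_1+⋯+j_r-i_r) E_{i_1j_1}(t)⋯E_{i_rj_r}(t)`
as a power series in `x`. -/
def transfer : (Module.End K Fock)⟦X⟧ := PowerSeries.mk transferCoeff

/-- The inverse `A⁻¹(x;t)` of the power series `A(x;t)`. -/
def transferInv : (Module.End K Fock)⟦X⟧ := Ring.inverse transfer

/-- The coefficient of `x ^ m` in `A⁻¹(x;t)`. -/
def transferInvCoeff (m : ℕ) : Module.End K Fock := PowerSeries.coeff m transferInv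

/-! ### The asymmetric six-vertex model -/

/-- The Boltzmann weight of a vertex with edge values `W`, `N`, `E`, `S`, for the parameters
`ω₁ = ω₃ = ω₅ = 1`, `ω₂ = -x`, `ω₄ = tx`, `ω₆ = (t-1)x`. -/
def vertexWeight : Bool → Bool → Bool → Bool → K⟦X⟧
  | false, false, false, false => 1
  | true, true, true, true => -PowerSeries.X
  | false, true, false, true => 1
  | true, false, true, false => PowerSeries.C t * PowerSeries.X
  | true, false, false, true => 1
  | false, true, true, false => PowerSeries.C (t - 1) * PowerSeries.X
  | _, _, _, _ => 0

/-- The partition function of an infinite lattice row with upper vertical edges `σ` and lower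
vertical edges `σ'`. A row configuration is given by the values `e i` of the horizontal edges
between the vertices `i` and `i + 1`, which have to vanish far to the left and to the right. -/
def rowPartition (σ σ' : Maya) : K⟦X⟧ :=
  ∑ᶠ e : {e : ℤ → Bool // {i : ℤ | e i = true}.Finite},
    ∏ᶠ i : ℤ, vertexWeight (e.1 (i - 1)) (σ.val i) (e.1 i) (σ'.val i)

/-! ### The boson-fermion correspondence -/

/-- The space `⨁_c z ^ c ⊗ Λ(t)`. -/
abbrev Boson : Type := ℤ →₀ Lam

/-- The boson-fermion correspondence `ι_t`, the linear map with `σ(λ, c) ↦ z ^ c ⊗ s_λ`. -/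
def iota : Fock →ₗ[K] Boson :=
  Finsupp.linearCombination K fun σ : Maya =>
    Finsupp.single (mayaEquiv.symm σ).2 (schur (mayaEquiv.symm σ).1)

/-- The operator `1 ⊗ f` on `⨁_c z ^ c ⊗ Λ(t)`. -/
def onBoson (f : Module.End K Lam) : Module.End K Boson := Finsupp.mapRange.linearMap f

/-- The deformed inner product on `⨁_c z ^ c ⊗ Λ(t)`, for which the summands are orthogonal. -/
def bosonForm : LinearMap.BilinForm K Boson :=
  Finsupp.lsum K fun c : ℤ => tForm.compl₂ (Finsupp.lapply c)

/-- The deformed inner product on `ℱ(t)`, the pullback along `ι_t`. -/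
def fockForm : LinearMap.BilinForm K Fock := bosonForm.compl₁₂ iota iota

/-- The coefficient of `x ^ (-m)` in `A^*(x;t)`, where the adjoint is taken for the deformed inner
product and `x^* = x ^ (-1)`. -/
def transferAdj (m : ℕ) : Module.End K Fock := adjointOp fockForm (transferCoeff m)

/-- The coefficient of `x ^ (-m)` in `(A⁻¹(x;t))^*`. -/
def transferInvAdj (m : ℕ) : Module.End K Fock := adjointOp fockForm (transferInvCoeff m)

/-- The terms of the operator `Ψ_m = ∑_{r-s=m} A⁻¹_r A^*_s`. -/
def psiModeTerms (m : ℤ) : {p : ℕ × ℕ // (p.1 : ℤ) - (p.2 : ℤ) = m} → Module.End K Fock :=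
  laurentTerms transferInvCoeff transferAdj m

/-- The operator `Ψ_m = ∑_{r-s=m} A⁻¹_r A^*_s`, the coefficient of `x ^ m` in
`A⁻¹(x;t) ∘ A^*(x;t)`. -/
def psiMode (m : ℤ) : Module.End K Fock := sumOp (psiModeTerms m)

/-- The terms of the coefficient of `x ^ m` in `A(x;t) ∘ (A⁻¹(x;t))^*`. -/
def psiPlusModeTerms (m : ℤ) : {p : ℕ × ℕ // (p.1 : ℤ) - (p.2 : ℤ) = m} → Module.End K Fock :=
  laurentTerms transferCoeff transferInvAdj m

/-- The coefficient of `x ^ m` in `A(x;t) ∘ (A⁻¹(x;t))^*`. -/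
def psiPlusMode (m : ℤ) : Module.End K Fock := sumOp (psiPlusModeTerms m)

end

end HallLittlewoodIce

open HallLittlewoodIce

open scoped PowerSeries

/-!
For a series `∑ n, c_n x ^ n` in `Λ(t)⟦x⟧` let `Γ_c(x)` be the vertex operator that translates
`f[Y]` to `f[Y - 1/x]` and multiplies by the series. The modes of `Γ_h` are Bernstein's
operators, and the Jacobi-Trudi formula identifies them with the undeformed fermions. The
operators `A_m` satisfy an exchange relation with the fermions: at each position of the row, this
is a relation between edge weights. Multiplication by `g_m`, where
`∑ m, g_m x ^ m = exp (∑ r, (t ^ r - 1) / r * p_r x ^ r)`, satisfies the same relation with the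
modes of `Γ_h`. As both sides agree on the vacuum, where the hops of `A_m` add up to hook Schur
functions, `ι_t ∘ A_m` is multiplication by `g_m` after `ι_t`.

The adjoint of multiplication by `exp (∑ r, ε * (1 - t ^ r) / r * p_r x ^ r)` is the translation
`p_r ↦ p_r + ε x ^ (-r)`. Hence `A⁻¹ A^*` corresponds to `Γ_q = Φ⁻`, where `q = 1 / g`, and its
commutation relation is the symmetry of a product of two vertex operators under exchanging them.
In the variables `y_1, …, y_n`, the partial fraction expansion of `∏ (1 - t y_i x) / (1 - y_i x)`
turns a mode of `Φ⁻` into a sum over the variable that is removed, and iterating this gives the sum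
over `S_n` in the Hall-Littlewood function.
-/

namespace HallLittlewoodIce

noncomputable section

/-! ### Exponentials of power series -/

section Exponential

open PowerSeries
open Finset.HasAntidiagonal (antidiagonal mem_antidiagonal)

variable {R : Type*} [CommRing R]

theorem eq_of_derivative_eq_mul [IsAddTorsionFree R] {F a b : R⟦X⟧}
    (h0 : constantCoeff a = constantCoeff b) (ha : d⁄dX R a = F * a) (hb : d⁄dX R b = F * b) :
    a = b := by
  ext n
  induction n using Nat.strong_induction_on with
  | _ n ih =>
    cases n with
    | zero => simpa using h0
    | succ n =>
      apply nsmul_right_injective n.succ_ne_zero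
      simp only [nsmul_eq_mul, Nat.cast_succ, mul_comm ((n : R) + 1)]
      rw [← coeff_derivative, ← coeff_derivative, ha, hb, coeff_mul, coeff_mul]
      refine Finset.sum_congr rfl fun p hp => ?_
      rw [ih p.2 (by have := mem_antidiagonal.1 hp; omega)]

theorem coeff_pow_of_lt {F : R⟦X⟧} (h0 : constantCoeff F = 0) {n k : ℕ} (h : n < k) :
    coeff n (F ^ k) = 0 :=
  X_pow_dvd_iff.1 (pow_dvd_pow_of_dvd (X_dvd_iff.2 h0) k) n h

variable [Algebra K R]

theorem isAddTorsionFree_of_algebra (R : Type*) [Ring R] [Algebra K R] : IsAddTorsionFree R :=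
  letI := Module.compHom R (algebraMap ℚ K)
  .of_module_rat R

theorem constantCoeff_expSeries (F : R⟦X⟧) : constantCoeff (expSeries F) = 1 := by
  rw [← coeff_zero_eq_constantCoeff_apply, expSeries, coeff_mk]
  simp

theorem coeff_expSeries {F : R⟦X⟧} (h0 : constantCoeff F = 0) {n N : ℕ} (h : n ≤ N) :
    coeff n (expSeries F) =
      ∑ k ∈ Finset.range (N + 1), ((k.factorial : K)⁻¹) • coeff n (F ^ k) := by
  rw [expSeries, coeff_mk]
  refine Finset.sum_subset (Finset.range_mono (by omega)) fun k _ hk => ?_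
  rw [coeff_pow_of_lt h0 (by simpa using hk), smul_zero]

theorem derivative_pow_div_factorial (F : R⟦X⟧) (k : ℕ) :
    ((k + 1).factorial : K)⁻¹ • d⁄dX R (F ^ (k + 1)) =
      (k.factorial : K)⁻¹ • (d⁄dX R F * F ^ k) := by
  rw [derivative_pow, Nat.add_sub_cancel, mul_assoc, ← nsmul_eq_mul, ← Nat.cast_smul_eq_nsmul K,
    smul_smul, mul_comm (F ^ k), Nat.factorial_succ]
  congr 1
  push_cast
  field_simp

theorem derivative_expSeries {F : R⟦X⟧} (h0 : constantCoeff F = 0) :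
    d⁄dX R (expSeries F) = d⁄dX R F * expSeries F := by
  ext n
  calc coeff n (d⁄dX R (expSeries F))
      = ∑ k ∈ Finset.range (n + 2), ((k.factorial : K)⁻¹) • coeff n (d⁄dX R (F ^ k)) := by
        simp only [coeff_derivative, coeff_expSeries h0 le_rfl, Finset.sum_mul, smul_mul_assoc]
    _ = ∑ k ∈ Finset.range (n + 1), ((k.factorial : K)⁻¹) • coeff n (d⁄dX R F * F ^ k) := by
        rw [Finset.sum_range_succ', pow_zero, Derivation.map_one_eq_zero, map_zero, smul_zero,
          add_zero]
        refine Finset.sum_congr rfl fun k _ => ?_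
        rw [← coeff_smul, derivative_pow_div_factorial, coeff_smul]
    _ = coeff n (d⁄dX R F * expSeries F) := by
        simp only [coeff_mul, Finset.smul_sum]
        rw [Finset.sum_comm]
        refine Finset.sum_congr rfl fun p hp => ?_
        rw [coeff_expSeries h0 (N := n) (by have := mem_antidiagonal.1 hp; omega),
          Finset.mul_sum]
        simp only [mul_smul_comm]

theorem expSeries_eq_of_derivative {F a : R⟦X⟧} (h0 : constantCoeff F = 0)
    (ha0 : constantCoeff a = 1) (ha : d⁄dX R a = d⁄dX R F * a) : expSeries F = a :=
  haveI := isAddTorsionFree_of_algebra R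
  eq_of_derivative_eq_mul (by rw [constantCoeff_expSeries, ha0]) (derivative_expSeries h0) ha

theorem expSeries_add {F G : R⟦X⟧} (hF : constantCoeff F = 0) (hG : constantCoeff G = 0) :
    expSeries (F + G) = expSeries F * expSeries G := by
  refine expSeries_eq_of_derivative (by simp [hF, hG]) (by simp [constantCoeff_expSeries]) ?_
  rw [Derivation.leibniz, derivative_expSeries hF, derivative_expSeries hG, map_add]
  simp only [smul_eq_mul]
  ring

theorem expSeries_zero : expSeries (0 : R⟦X⟧) = 1 :=
  expSeries_eq_of_derivative (by simp) (by simp) (by simp)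

theorem map_expSeries {R S : Type*} [Ring R] [Ring S] [Algebra K R] [Algebra K S] (f : R →ₐ[K] S)
    (F : R⟦X⟧) :
    PowerSeries.map (f : R →+* S) (expSeries F) = expSeries (PowerSeries.map (f : R →+* S) F) := by
  ext n
  simp only [expSeries, coeff_map, coeff_mk, map_sum, ← map_pow]
  exact Finset.sum_congr rfl fun k _ => map_smul f _ _

theorem rescale_expSeries (a : R) (F : R⟦X⟧) :
    rescale a (expSeries F) = expSeries (rescale a F) := by
  ext n
  simp only [expSeries, coeff_mk, ← map_pow, coeff_rescale, Finset.mul_sum, mul_smul_comm]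

theorem coeff_succ_positiveSeries {R : Type*} [Ring R] [Algebra K R] (c : ℕ+ → K) (P : ℕ+ → R)
    (n : ℕ) :
    coeff (n + 1) (positiveSeries c P) = c n.succPNat • P n.succPNat := by
  rw [positiveSeries, coeff_mk, dif_pos n.succ_pos]
  rfl

theorem constantCoeff_positiveSeries {R : Type*} [Ring R] [Algebra K R] (c : ℕ+ → K)
    (P : ℕ+ → R) :
    constantCoeff (positiveSeries c P) = 0 := by
  simp [positiveSeries, ← coeff_zero_eq_constantCoeff_apply, -coeff_zero_eq_constantCoeff]

/-- The series `exp (∑ r > 0, a_r x ^ r)` over a commutative algebra. -/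
def expPos (a : ℕ+ → R) : R⟦X⟧ := expSeries (positiveSeries 1 a)

theorem expSeries_positiveSeries (c : ℕ+ → K) (P : ℕ+ → R) :
    expSeries (positiveSeries c P) = expPos fun r => c r • P r := by
  rw [expPos]
  congr 1
  ext n
  cases n <;> simp [constantCoeff_positiveSeries, coeff_succ_positiveSeries]

theorem coeff_zero_expPos (a : ℕ+ → R) : coeff 0 (expPos a) = 1 := by
  rw [coeff_zero_eq_constantCoeff_apply]
  exact constantCoeff_expSeries _

theorem expPos_add (a b : ℕ+ → R) : expPos (a + b) = expPos a * expPos b := by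
  rw [expPos, expPos, expPos, ← expSeries_add (constantCoeff_positiveSeries _ _)
    (constantCoeff_positiveSeries _ _)]
  congr 1
  ext n
  cases n <;> simp [constantCoeff_positiveSeries, coeff_succ_positiveSeries]

theorem expPos_zero : expPos (0 : ℕ+ → R) = 1 := by
  rw [expPos, ← expSeries_zero]
  congr 1
  ext n
  cases n <;> simp [constantCoeff_positiveSeries, coeff_succ_positiveSeries]

theorem expPos_mul_neg (a : ℕ+ → R) : expPos a * expPos (-a) = 1 := by
  rw [← expPos_add, add_neg_cancel, expPos_zero]

theorem map_expPos {S : Type*} [CommRing S] [Algebra K S] (f : R →ₐ[K] S) (a : ℕ+ → R) :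
    PowerSeries.map (f : R →+* S) (expPos a) = expPos fun r => f (a r) := by
  rw [expPos, map_expSeries, expPos]
  congr 1
  ext n
  cases n <;> simp [constantCoeff_positiveSeries, coeff_succ_positiveSeries]

theorem rescale_expPos (b : R) (a : ℕ+ → R) :
    rescale b (expPos a) = expPos fun r => b ^ (r : ℕ) * a r := by
  rw [expPos, rescale_expSeries, expPos]
  congr 1
  ext n
  cases n <;> simp [constantCoeff_positiveSeries, coeff_succ_positiveSeries]

theorem expPos_recursion (a : ℕ+ → R) (n : ℕ) :
    ((n : K) + 1) • coeff (n + 1) (expPos a) =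
      ∑ p ∈ antidiagonal n,
        ((p.1 : K) + 1) • (a p.1.succPNat * coeff p.2 (expPos a)) := by
  have h := congrArg (coeff n) (derivative_expSeries (constantCoeff_positiveSeries 1 a))
  rw [coeff_derivative, coeff_mul] at h
  simp only [coeff_derivative, coeff_succ_positiveSeries, Pi.one_apply, one_smul] at h
  simp only [Algebra.smul_def, map_add, map_natCast, map_one]
  rw [mul_comm, expPos, h]
  exact Finset.sum_congr rfl fun p _ => by ring

theorem expPos_neg_pow_div (a : R) :
    expPos (fun r : ℕ+ => -(((r : ℕ) : K)⁻¹ • a ^ (r : ℕ))) = 1 - C a * X := by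
  refine expSeries_eq_of_derivative (constantCoeff_positiveSeries _ _) (by simp) ?_
  have hd : d⁄dX R (positiveSeries 1 fun r : ℕ+ => -(((r : ℕ) : K)⁻¹ • a ^ (r : ℕ))) =
      mk fun n => -a ^ (n + 1) := by
    ext n
    have hK : ((n : K) + 1) ≠ 0 := by exact_mod_cast n.succ_ne_zero
    have hn : ((n : R) + 1) = algebraMap K R ((n : K) + 1) := by simp
    rw [coeff_derivative, coeff_succ_positiveSeries, coeff_mk, Pi.one_apply, one_smul, mul_comm, hn,
      ← Algebra.smul_def, Nat.succPNat_coe, Nat.cast_succ, smul_neg, smul_inv_smul₀ hK]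
  rw [hd]
  ext n
  rw [mul_sub, mul_one, ← mul_assoc, coeff_derivative, map_sub, map_sub]
  cases n with
  | zero => simp [coeff_one, mul_assoc]
  | succ n =>
    rw [coeff_succ_mul_X, coeff_succ_mul_X, coeff_mul_C]
    simp [coeff_one, coeff_mk]
    ring

theorem one_sub_mul_expPos_pow_div (a : R) :
    (1 - C a * X) * expPos (fun r : ℕ+ => ((r : ℕ) : K)⁻¹ • a ^ (r : ℕ)) = 1 := by
  rw [← expPos_neg_pow_div, mul_comm]
  exact expPos_mul_neg _

end Exponential

/-! ### Generating series of symmetric functions -/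

section SymmetricFunctions

open PowerSeries

/-- The coefficient of `x ^ n` in a power series, for an integer `n`; it is `0` for `n < 0`. -/
def intCoeff {R : Type*} [Semiring R] (a : R⟦X⟧) (n : ℤ) : R :=
  if 0 ≤ n then coeff n.toNat a else 0

theorem intCoeff_natCast {R : Type*} [Semiring R] (a : R⟦X⟧) (n : ℕ) :
    intCoeff a n = coeff n a := by
  simp [intCoeff]

theorem intCoeff_of_neg {R : Type*} [Semiring R] (a : R⟦X⟧) {n : ℤ} (h : n < 0) :
    intCoeff a n = 0 := by
  simp [intCoeff, h]

theorem intCoeff_map {R S : Type*} [Semiring R] [Semiring S] (f : R →+* S) (a : R⟦X⟧) (n : ℤ) :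
    intCoeff (PowerSeries.map f a) n = f (intCoeff a n) := by
  rw [intCoeff, intCoeff]
  split_ifs
  · exact coeff_map _ _ _
  · exact (map_zero f).symm

theorem intCoeff_one_sub_mul {R : Type*} [CommRing R] (v : R) (a : R⟦X⟧) (n : ℤ) :
    intCoeff ((1 - C v * X) * a) n = intCoeff a n - v * intCoeff a (n - 1) := by
  rw [sub_mul, one_mul, mul_right_comm, mul_assoc]
  rcases lt_or_ge n 0 with h | h
  · rw [intCoeff_of_neg _ h, intCoeff_of_neg _ h, intCoeff_of_neg _ (by omega), mul_zero, sub_zero]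
  · obtain ⟨m, rfl⟩ := Int.eq_ofNat_of_zero_le h
    rw [intCoeff_natCast, intCoeff_natCast, map_sub, coeff_C_mul]
    cases m with
    | zero => simp [intCoeff]
    | succ m => rw [coeff_succ_mul_X, Nat.cast_succ, add_sub_cancel_right, intCoeff_natCast]

/-- The series `∑ h_n x ^ n = ∏ (1 - x y_i)⁻¹` of complete symmetric functions. -/
def hSeries : Lam⟦X⟧ := expPos fun r => ((r : ℕ) : K)⁻¹ • MvPolynomial.X r

/-- The series `∑ (-1) ^ n e_n x ^ n = ∏ (1 - x y_i)`. -/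
def eSeries : Lam⟦X⟧ := expPos fun r => -(((r : ℕ) : K)⁻¹ • MvPolynomial.X r)

/-- The series `∏ (1 - t x y_i) / (1 - x y_i)`, the creation part of `Φ⁻(x;t)`. -/
def qSeries : Lam⟦X⟧ := expPos fun r => gCoeff r • MvPolynomial.X r

/-- The series `∏ (1 - x y_i) / (1 - t x y_i)`, the creation part of `Φ⁺(x;t)`. -/
def gSeries : Lam⟦X⟧ := expPos fun r => -(gCoeff r • MvPolynomial.X r)

/-- The signed elementary symmetric function `(-1) ^ n e_n`. -/
abbrev eSymm : ℤ → Lam := intCoeff eSeries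

/-- The coefficients of `∏ (1 - t x y_i) / (1 - x y_i)`. -/
abbrev qSymm : ℤ → Lam := intCoeff qSeries

/-- The coefficients of `∏ (1 - x y_i) / (1 - t x y_i)`. -/
abbrev gSymm : ℤ → Lam := intCoeff gSeries

theorem complete_eq_intCoeff (n : ℤ) : complete n = intCoeff hSeries n := by
  rw [complete, expSeries_positiveSeries, intCoeff, hSeries]

theorem complete_natCast (n : ℕ) : complete n = coeff n hSeries := by
  rw [complete_eq_intCoeff, intCoeff_natCast]

theorem eSymm_natCast (n : ℕ) : eSymm n = coeff n eSeries := intCoeff_natCast _ _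

theorem qSymm_natCast (n : ℕ) : qSymm n = coeff n qSeries := intCoeff_natCast _ _

theorem gSymm_natCast (n : ℕ) : gSymm n = coeff n gSeries := intCoeff_natCast _ _

theorem hSeries_mul_eSeries : hSeries * eSeries = 1 := expPos_mul_neg _

theorem qSeries_mul_gSeries : qSeries * gSeries = 1 := expPos_mul_neg _

theorem gCoeff_eq (r : ℕ+) : gCoeff r = ((r : ℕ) : K)⁻¹ - t ^ (r : ℕ) * ((r : ℕ) : K)⁻¹ := by
  rw [gCoeff]
  ring

theorem gSeries_eq : gSeries = rescale (algebraMap K Lam t) hSeries * eSeries := by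
  rw [hSeries, rescale_expPos, gSeries, eSeries, ← expPos_add]
  congr 1
  ext1 r
  rw [Pi.add_apply, ← map_pow, ← Algebra.smul_def, smul_smul, gCoeff_eq, sub_smul]
  abel

theorem expPos_gCoeff_pow_mul {R : Type*} [CommRing R] [Algebra K R] (a : R) :
    expPos (fun r : ℕ+ => gCoeff r • a ^ (r : ℕ)) * (1 - C a * X) = 1 - C (t • a) * X := by
  rw [← expPos_neg_pow_div, ← expPos_neg_pow_div, ← expPos_add]
  congr 1
  ext1 r
  rw [Pi.add_apply, gCoeff_eq, sub_smul, smul_pow, smul_smul, mul_comm (t ^ _)]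
  abel

/-! ### The shift `p_r ↦ p_r + ε u ^ r` -/

/-- The algebra map `f[Y] ↦ f[Y + ε u]` given by `p_r ↦ p_r + ε u ^ r`. -/
def shift (ε : K) : Lam →ₐ[K] Polynomial Lam :=
  MvPolynomial.aeval fun r : ℕ+ =>
    Polynomial.C (MvPolynomial.X r) + ε • (Polynomial.X : Polynomial Lam) ^ (r : ℕ)

theorem shift_X (ε : K) (r : ℕ+) : shift ε (MvPolynomial.X r) =
    Polynomial.C (MvPolynomial.X r) + ε • (Polynomial.X : Polynomial Lam) ^ (r : ℕ) := by
  simp [shift]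

theorem map_shift_expPos (ε : K) (c : ℕ+ → K) :
    PowerSeries.map (shift ε : Lam →+* Polynomial Lam)
        (expPos fun r => c r • (MvPolynomial.X r : Lam)) =
      PowerSeries.map Polynomial.C (expPos fun r => c r • (MvPolynomial.X r : Lam)) *
        expPos fun r => (ε * c r) • (Polynomial.X : Polynomial Lam) ^ (r : ℕ) := by
  have hC : (Polynomial.C : Lam →+* Polynomial Lam) =
    (IsScalarTower.toAlgHom K Lam (Polynomial Lam) : Lam →+* Polynomial Lam) := rfl
  rw [hC, map_expPos, map_expPos, ← expPos_add]
  congr 1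
  ext1 r
  rw [Pi.add_apply, map_smul, map_smul, shift_X, smul_add, smul_smul, mul_comm (c r) ε]
  rfl

/-- The algebra map `f[Y] ↦ f[Y - u]` given by `p_r ↦ p_r - u ^ r`. -/
abbrev tau : Lam →ₐ[K] Polynomial Lam := shift (-1)

theorem map_tau_hSeries : PowerSeries.map (tau : Lam →+* Polynomial Lam) hSeries =
    (1 - C Polynomial.X * X) * PowerSeries.map Polynomial.C hSeries := by
  rw [hSeries, map_shift_expPos, mul_comm, ← expPos_neg_pow_div]
  simp only [neg_mul, one_mul, neg_smul]

theorem map_tau_eSeries : (1 - C Polynomial.X * X) *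
    PowerSeries.map (tau : Lam →+* Polynomial Lam) eSeries =
      PowerSeries.map Polynomial.C eSeries := by
  simp only [eSeries, ← neg_smul]
  rw [map_shift_expPos, mul_left_comm]
  simp only [neg_mul, one_mul, neg_neg]
  rw [one_sub_mul_expPos_pow_div, mul_one]

theorem map_tau_gSeries : (1 - C Polynomial.X * X) *
    PowerSeries.map (tau : Lam →+* Polynomial Lam) gSeries =
      (1 - C (t • Polynomial.X) * X) * PowerSeries.map Polynomial.C gSeries := by
  simp only [gSeries, ← neg_smul]
  rw [map_shift_expPos, ← expPos_gCoeff_pow_mul]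
  simp only [neg_mul, one_mul, neg_neg]
  ring

theorem map_tau_qSeries : (1 - C (t • Polynomial.X) * X) *
    PowerSeries.map (tau : Lam →+* Polynomial Lam) qSeries =
      (1 - C Polynomial.X * X) * PowerSeries.map Polynomial.C qSeries := by
  rw [qSeries, map_shift_expPos, ← expPos_gCoeff_pow_mul]
  simp only [neg_mul, one_mul, neg_smul]
  linear_combination (1 - C Polynomial.X * X) * PowerSeries.map Polynomial.C (expPos _) *
    expPos_mul_neg fun r : ℕ+ => gCoeff r • (Polynomial.X : Polynomial Lam) ^ (r : ℕ)

theorem tau_complete (n : ℤ) : tau (complete n) =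
    Polynomial.C (complete n) - Polynomial.X * Polynomial.C (complete (n - 1)) := by
  have h := congrArg (intCoeff · n) map_tau_hSeries
  simp only [intCoeff_one_sub_mul, intCoeff_map, ← complete_eq_intCoeff] at h
  exact h

theorem tau_eSymm (n : ℤ) :
    tau (eSymm n) - Polynomial.X * tau (eSymm (n - 1)) = Polynomial.C (eSymm n) := by
  have h := congrArg (intCoeff · n) map_tau_eSeries
  simp only [intCoeff_one_sub_mul, intCoeff_map] at h
  exact h

theorem tau_gSymm (n : ℤ) : tau (gSymm n) - Polynomial.X * tau (gSymm (n - 1)) =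
    Polynomial.C (gSymm n) - t • Polynomial.X * Polynomial.C (gSymm (n - 1)) := by
  have h := congrArg (intCoeff · n) map_tau_gSeries
  simp only [intCoeff_one_sub_mul, intCoeff_map] at h
  exact h

theorem tau_qSymm (n : ℤ) : tau (qSymm n) - t • Polynomial.X * tau (qSymm (n - 1)) =
    Polynomial.C (qSymm n) - Polynomial.X * Polynomial.C (qSymm (n - 1)) := by
  have h := congrArg (intCoeff · n) map_tau_qSeries
  simp only [intCoeff_one_sub_mul, intCoeff_map] at h
  exact h

end SymmetricFunctions

/-! ### Vertex operators -/

section VertexOperators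

open Polynomial

section UmbralEvaluation

variable {R : Type*} [CommRing R]

/-- The umbral evaluation `u ^ k ↦ φ (n + k)`, an `R`-linear map on `R[u]`. -/
def umbralEval (φ : ℤ → R) (n : ℤ) : R[X] →ₗ[R] R :=
  lsum fun k : ℕ => LinearMap.toSpanSingleton R R (φ (n + k))

theorem umbralEval_monomial (φ : ℤ → R) (n : ℤ) (k : ℕ) (a : R) :
    umbralEval φ n (monomial k a) = a * φ (n + k) := by
  rw [umbralEval, lsum_apply, sum_monomial_index _ _ (by simp), LinearMap.toSpanSingleton_apply,
    smul_eq_mul]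

theorem umbralEval_C_mul (φ : ℤ → R) (n : ℤ) (a : R) (P : R[X]) :
    umbralEval φ n (C a * P) = a * umbralEval φ n P := by
  rw [← smul_eq_C_mul, map_smul, smul_eq_mul]

theorem umbralEval_X_mul (φ : ℤ → R) (n : ℤ) (P : R[X]) :
    umbralEval φ n (X * P) = umbralEval φ (n + 1) P := by
  induction P using Polynomial.induction_on' with
  | add p q hp hq => rw [mul_add, map_add, map_add, hp, hq]
  | monomial k a =>
    rw [X_mul_monomial, umbralEval_monomial, umbralEval_monomial, Nat.cast_succ, add_assoc,
      add_comm (k : ℤ)]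

/-- The umbral evaluation `u ^ l v ^ k ↦ φ (r + l) φ (s + k)` on `R[u][v]`. -/
def umbralEval₂ (φ : ℤ → R) (r s : ℤ) : R[X][X] →ₗ[R] R :=
  lsum fun k : ℕ => (LinearMap.toSpanSingleton R R (φ (s + k))).comp (umbralEval φ r)

theorem umbralEval₂_monomial (φ : ℤ → R) (r s : ℤ) (k : ℕ) (P : R[X]) :
    umbralEval₂ φ r s (monomial k P) = umbralEval φ r P * φ (s + k) := by
  rw [umbralEval₂, lsum_apply, sum_monomial_index _ _ (by simp), LinearMap.comp_apply,
    LinearMap.toSpanSingleton_apply, smul_eq_mul]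

theorem umbralEval₂_swap (φ : ℤ → R) (r s : ℤ) (Z : R[X][X]) :
    umbralEval₂ φ r s (Bivariate.swap Z) = umbralEval₂ φ s r Z := by
  induction Z using Polynomial.induction_on' with
  | add p q hp hq => rw [map_add, map_add, map_add, hp, hq]
  | monomial k P =>
    induction P using Polynomial.induction_on' with
    | add p q hp hq => rw [map_add, map_add, map_add, map_add, hp, hq]
    | monomial l a =>
      rw [Bivariate.swap_monomial_monomial, umbralEval₂_monomial, umbralEval₂_monomial,
        umbralEval_monomial, umbralEval_monomial]
      ring

theorem swap_C_sub_pow_sub_pow (a : R) (n : ℕ) :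
    Bivariate.swap (C (C a) - C X ^ n - X ^ n : R[X][X]) = C (C a) - C X ^ n - X ^ n := by
  simp only [map_sub, map_pow, Bivariate.swap_C_C, Bivariate.swap_X, Bivariate.swap_Y]
  exact sub_right_comm _ _ _

end UmbralEvaluation

/-- The mode `f ↦ ∑ k, φ_{n+k} f_k`, where `f[Y - u] = ∑ k, f_k u ^ k`. It is the coefficient of
`x ^ n` in the operator `f ↦ (∑ m, φ_m x ^ m) f[Y - 1 / x]`. -/
def vertexOp (φ : ℤ → Lam) (n : ℤ) : Module.End K Lam :=
  ((umbralEval φ n).restrictScalars K).comp tau.toLinearMap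

theorem vertexOp_apply (φ : ℤ → Lam) (n : ℤ) (f : Lam) :
    vertexOp φ n f = umbralEval φ n (tau f) := rfl

theorem vertexOp_mul_gSymm (φ : ℤ → Lam) (n m : ℤ) (f : Lam) :
    vertexOp φ n (gSymm m * f) - vertexOp φ (n + 1) (gSymm (m - 1) * f) =
      gSymm m * vertexOp φ n f - t • (gSymm (m - 1) * vertexOp φ (n + 1) f) := by
  have h : tau (gSymm m) * tau f - X * (tau (gSymm (m - 1)) * tau f) =
      C (gSymm m) * tau f - t • (C (gSymm (m - 1)) * (X * tau f)) := by
    rw [← mul_assoc, ← sub_mul, tau_gSymm, sub_mul, smul_mul_assoc, smul_mul_assoc, mul_right_comm,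
      mul_comm (X * _)]
  simp only [vertexOp_apply, map_mul]
  rw [← umbralEval_X_mul, ← umbralEval_X_mul, ← map_sub, h, map_sub, umbralEval_C_mul,
    LinearMap.map_smul_of_tower, umbralEval_C_mul]

theorem vertexOp_mul_qSymm (φ : ℤ → Lam) (n m : ℤ) (f : Lam) :
    vertexOp φ n (f * qSymm m) - t • vertexOp φ (n + 1) (f * qSymm (m - 1)) =
      vertexOp φ n f * qSymm m - vertexOp φ (n + 1) f * qSymm (m - 1) := by
  have h : tau f * tau (qSymm m) - t • (X * (tau f * tau (qSymm (m - 1)))) =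
      C (qSymm m) * tau f - C (qSymm (m - 1)) * (X * tau f) := by
    rw [mul_left_comm X, ← mul_smul_comm, ← smul_mul_assoc, ← mul_sub, tau_qSymm]
    ring
  simp only [vertexOp_apply, map_mul]
  rw [← umbralEval_X_mul, ← umbralEval_X_mul, ← LinearMap.map_smul_of_tower, ← map_sub, h, map_sub,
    umbralEval_C_mul, umbralEval_C_mul, mul_comm, mul_comm (qSymm (m - 1))]

/-- `f[Y - u - v]` as a polynomial in `v` over `Λ(t)[u]`. -/
def tau₂ : Lam →ₐ[K] Lam[X][X] := (mapAlgHom tau).comp tau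

theorem swap_tau₂ (f : Lam) : Bivariate.swap (tau₂ f) = tau₂ f := by
  have h : ((Bivariate.swap (R := Lam)).toAlgHom.restrictScalars K).comp tau₂ = tau₂ := by
    refine MvPolynomial.algHom_ext fun r => ?_
    change Bivariate.swap (tau₂ (MvPolynomial.X r)) = tau₂ (MvPolynomial.X r)
    have hX : tau₂ (MvPolynomial.X r) =
        C (C (MvPolynomial.X r)) - (C X ^ (r : ℕ) : Lam[X][X]) - X ^ (r : ℕ) := by
      simp [tau₂, shift_X, ← sub_eq_add_neg]
    rw [hX]
    exact swap_C_sub_pow_sub_pow _ _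
  exact DFunLike.congr_fun h f

theorem umbralEval₂_tau₂_comm (φ : ℤ → Lam) (r s : ℤ) (f : Lam) :
    umbralEval₂ φ r s (tau₂ f) = umbralEval₂ φ s r (tau₂ f) := by
  rw [← umbralEval₂_swap, swap_tau₂]

theorem vertexOp_qSymm_comp (r s : ℤ) (f : Lam) :
    vertexOp qSymm (r - 1) (vertexOp qSymm s f) - t • vertexOp qSymm r (vertexOp qSymm (s - 1) f) =
      umbralEval₂ qSymm (r - 1) s (tau₂ f) - umbralEval₂ qSymm r (s - 1) (tau₂ f) := by
  rw [tau₂, AlgHom.comp_apply, vertexOp_apply qSymm s, vertexOp_apply qSymm (s - 1)]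
  generalize tau f = P
  induction P using Polynomial.induction_on' with
  | add p q hp hq =>
    simp only [map_add, smul_add]
    linear_combination hp + hq
  | monomial k a =>
    have h := vertexOp_mul_qSymm qSymm (r - 1) (s + k) a
    rw [sub_add_cancel] at h
    rw [mapAlgHom_monomial, umbralEval₂_monomial, umbralEval₂_monomial, umbralEval_monomial,
      umbralEval_monomial, sub_add_eq_add_sub, h, vertexOp_apply, vertexOp_apply]

theorem vertexOp_qSymm_relation (r s : ℤ) (f : Lam) :
    vertexOp qSymm (r - 1) (vertexOp qSymm s f) - t • vertexOp qSymm r (vertexOp qSymm (s - 1) f) =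
      t • vertexOp qSymm s (vertexOp qSymm (r - 1) f) -
        vertexOp qSymm (s - 1) (vertexOp qSymm r f) := by
  rw [vertexOp_qSymm_comp, umbralEval₂_tau₂_comm qSymm (r - 1), umbralEval₂_tau₂_comm qSymm r,
    ← neg_sub, ← vertexOp_qSymm_comp s r f, neg_sub]

end VertexOperators

/-! ### Hook functions -/

theorem complete_zero : complete 0 = 1 :=
  (complete_natCast 0).trans (coeff_zero_expPos _)

theorem eSymm_zero : eSymm 0 = 1 :=
  (eSymm_natCast 0).trans (coeff_zero_expPos _)

theorem gSymm_zero : gSymm 0 = 1 :=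
  (gSymm_natCast 0).trans (coeff_zero_expPos _)

theorem vertexOp_eSymm (φ : ℤ → Lam) (n : ℤ) (b : ℕ) :
    vertexOp φ n (eSymm b) = ∑ l ∈ Finset.range (b + 1), φ (n + b - l) * eSymm l := by
  have step (n b : ℤ) :
      vertexOp φ n (eSymm b) = φ n * eSymm b + vertexOp φ (n + 1) (eSymm (b - 1)) := by
    rw [vertexOp_apply, vertexOp_apply, ← umbralEval_X_mul, ← sub_eq_iff_eq_add, ← map_sub,
      tau_eSymm, ← Polynomial.monomial_zero_left, umbralEval_monomial, mul_comm, Nat.cast_zero,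
      add_zero]
  induction b generalizing n with
  | zero =>
    rw [step, show eSymm (((0 : ℕ) : ℤ) - 1) = 0 from intCoeff_of_neg _ (by simp), map_zero]
    simp
  | succ b ih =>
    rw [step, Finset.sum_range_succ, add_comm, Nat.cast_succ, add_sub_cancel_right, ih,
      add_sub_cancel_right, add_right_comm n, add_assoc n]

theorem sum_complete_mul_eSymm (n : ℕ) :
    ∑ l ∈ Finset.range (n + 2), complete ((n : ℤ) + 1 - l) * eSymm l = 0 := by
  have h := congrArg (PowerSeries.coeff (n + 1)) hSeries_mul_eSeries
  rw [PowerSeries.coeff_mul, PowerSeries.coeff_one, if_neg n.succ_ne_zero,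
    ← Finset.Nat.sum_antidiagonal_swap, Finset.Nat.sum_antidiagonal_eq_sum_range_succ_mk] at h
  rw [← h]
  refine Finset.sum_congr rfl fun l hl => ?_
  rw [show (n : ℤ) + 1 - l = ((n + 1 - l : ℕ) : ℤ) by have := Finset.mem_range.1 hl; omega,
    complete_natCast, eSymm_natCast]
  rfl

theorem vertexOp_complete_one_eSymm (b : ℕ) :
    vertexOp complete 1 (eSymm b) = -eSymm (b + 1) := by
  have h := sum_complete_mul_eSymm b
  rw [Finset.sum_range_succ, Nat.cast_succ, sub_self, complete_zero, one_mul] at h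
  rw [vertexOp_eSymm, add_comm (1 : ℤ)]
  exact eq_neg_of_add_eq_zero_left h

theorem sub_one_smul_sum_pow_smul_sum {R M : Type*} [CommRing R] [AddCommGroup M] [Module R M]
    (x : R) (c : ℕ → M) (n : ℕ) :
    (x - 1) • ∑ b ∈ Finset.range (n + 1), x ^ (n - b) • ∑ l ∈ Finset.range (b + 1), c l =
      ∑ l ∈ Finset.range (n + 1), (x ^ (n + 1 - l) - 1) • c l := by
  simp only [Finset.smul_sum]
  rw [Finset.sum_comm' (t' := Finset.range (n + 1)) (s' := fun l => Finset.Ico l (n + 1))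
    fun b l => by simp only [Finset.mem_range, Finset.mem_Ico]; omega]
  refine Finset.sum_congr rfl fun l _ => ?_
  rw [← Finset.smul_sum, ← Finset.sum_smul, smul_smul, Finset.sum_Ico_reflect _ _ le_rfl,
    Nat.sub_self, ← Finset.range_eq_Ico, mul_geom_sum]

theorem gSymm_succ (n : ℕ) : gSymm (n + 1) =
    ∑ l ∈ Finset.range (n + 2), t ^ (n + 1 - l) • (complete ((n : ℤ) + 1 - l) * eSymm l) := by
  rw [← Nat.cast_succ, gSymm_natCast, gSeries_eq, PowerSeries.coeff_mul,
    ← Finset.Nat.sum_antidiagonal_swap, Finset.Nat.sum_antidiagonal_eq_sum_range_succ_mk]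
  refine Finset.sum_congr rfl fun l hl => ?_
  rw [show ((n + 1 : ℕ) : ℤ) - l = ((n + 1 - l : ℕ) : ℤ) by
    have := Finset.mem_range.1 hl; omega, complete_natCast, eSymm_natCast, Algebra.smul_def,
    Prod.swap_prod_mk, PowerSeries.coeff_rescale, map_pow, mul_assoc]

theorem gSymm_eq_sum_hooks (n : ℕ) :
    gSymm (n + 1) = (t - 1) • ∑ b ∈ Finset.range (n + 1),
      t ^ (n - b) • vertexOp complete ((n : ℤ) - b + 1) (eSymm b) := by
  have hook (b : ℕ) : vertexOp complete ((n : ℤ) - b + 1) (eSymm b) =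
      ∑ l ∈ Finset.range (b + 1), complete ((n : ℤ) + 1 - l) * eSymm l := by
    rw [vertexOp_eSymm, show (n : ℤ) - b + 1 + b = n + 1 by ring]
  simp only [hook]
  rw [sub_one_smul_sum_pow_smul_sum t fun l => complete ((n : ℤ) + 1 - l) * eSymm l, gSymm_succ,
    ← sub_zero (∑ l ∈ Finset.range (n + 2), _), ← sum_complete_mul_eSymm n,
    ← Finset.sum_sub_distrib, Finset.sum_range_succ]
  simp [sub_smul]

/-! ### The deformed inner product and adjoints -/

theorem one_sub_t_pow_ne_zero {r : ℕ} (hr : 0 < r) : (1 : K) - t ^ r ≠ 0 := by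
  intro h
  have h1 : algebraMap (Polynomial ℂ) K (Polynomial.X ^ r) = algebraMap _ _ 1 := by
    rw [map_pow, map_one, RatFunc.algebraMap_X]
    exact (sub_eq_zero.1 h).symm
  have h2 := congrArg (Polynomial.eval 0) (RatFunc.algebraMap_injective ℂ h1)
  simp [hr.ne'] at h2

/-- The norm `⟨p_λ, p_λ⟩_t`, as a function of the multiplicities of `λ`. -/
def tNumber (m : ℕ+ →₀ ℕ) : K :=
  m.prod fun r k => ((r : ℕ) : K) ^ k * (k.factorial : K) * ((1 - t ^ (r : ℕ))⁻¹) ^ k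

theorem tNumber_ne_zero (m : ℕ+ →₀ ℕ) : tNumber m ≠ 0 := by
  rw [tNumber, Finsupp.prod, Finset.prod_ne_zero_iff]
  exact fun r _ => mul_ne_zero
    (mul_ne_zero (pow_ne_zero _ (Nat.cast_ne_zero.2 r.ne_zero))
      (Nat.cast_ne_zero.2 (Nat.factorial_ne_zero _)))
    (pow_ne_zero _ (inv_ne_zero (one_sub_t_pow_ne_zero r.pos)))

theorem tNumber_add_single (m : ℕ+ →₀ ℕ) (r : ℕ+) :
    tNumber (m + Finsupp.single r 1) =
      tNumber m * ((r : ℕ) / (1 - t ^ (r : ℕ)) * ((m r : K) + 1)) := by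
  rw [tNumber, tNumber, ← Finsupp.mul_prod_erase' (m + Finsupp.single r 1) r _ (by simp),
    ← Finsupp.mul_prod_erase' m r _ (by simp), Finsupp.erase_add, Finsupp.erase_single, add_zero]
  simp only [Finsupp.add_apply, Finsupp.single_eq_same, Nat.factorial_succ]
  push_cast
  ring

theorem plethysm_monomial (m : ℕ+ →₀ ℕ) (a : K) :
    plethysm (MvPolynomial.monomial m a) =
      (m.prod fun r k => ((1 - t ^ (r : ℕ))⁻¹) ^ k) • MvPolynomial.monomial m a := by
  rw [plethysm, MvPolynomial.aeval_monomial, MvPolynomial.monomial_eq, ← mul_smul_comm]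
  simp only [Finsupp.prod, smul_pow, Finset.prod_smul]
  rfl

theorem hallForm_monomial_one (m : ℕ+ →₀ ℕ) :
    hallForm (MvPolynomial.monomial m 1) = zNumber m • MvPolynomial.lcoeff K m := by
  have h := (MvPolynomial.basisMonomials ℕ+ K).constr_basis K
    (fun m => zNumber m • MvPolynomial.lcoeff K m) m
  rwa [MvPolynomial.coe_basisMonomials] at h

theorem tForm_monomial (m : ℕ+ →₀ ℕ) (a : K) (g : Lam) :
    tForm (MvPolynomial.monomial m a) g = a * (tNumber m * MvPolynomial.coeff m g) := by
  rw [← mul_one a, ← smul_eq_mul, ← MvPolynomial.smul_monomial, map_smul, tForm,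
    LinearMap.comp_apply, AlgHom.toLinearMap_apply, plethysm_monomial, map_smul,
    hallForm_monomial_one]
  simp only [LinearMap.smul_apply, smul_eq_mul, MvPolynomial.lcoeff_apply, mul_one]
  rw [tNumber, zNumber, ← mul_assoc (Finsupp.prod _ _), ← Finsupp.prod_mul]
  congr 3
  ext r k
  ring

theorem tForm_separatingRight : tForm.SeparatingRight := by
  intro g h
  ext m
  have hm := h (MvPolynomial.monomial m 1)
  rw [tForm_monomial, one_mul] at hm
  simpa using (mul_eq_zero.1 hm).resolve_left (tNumber_ne_zero m)

section Adjoint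

open LinearMap (BilinForm IsAdjointPair)

section Uniqueness

variable {R V : Type*} [CommRing R] [AddCommGroup V] [Module R V] {B : BilinForm R V}

theorem adjoint_unique (hB : B.SeparatingRight) {f g g' : Module.End R V}
    (h : IsAdjointPair B B f g) (h' : IsAdjointPair B B f g') : g = g' := by
  ext w
  rw [← sub_eq_zero]
  refine hB _ fun v => ?_
  rw [map_sub, ← h, ← h', sub_self]

theorem existsUnique_adjoint (hB : B.SeparatingRight) {f g : Module.End R V}
    (h : IsAdjointPair B B f g) : ∃! g : Module.End R V, IsAdjointPair B B f g :=
  ⟨g, h, fun _ h' => adjoint_unique hB h' h⟩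

theorem isAdjointPair_sum {I : Type*} (s : Finset I) {f g : I → Module.End R V}
    (h : ∀ i ∈ s, IsAdjointPair B B (f i) (g i)) :
    IsAdjointPair B B (∑ i ∈ s, f i : Module.End R V) (∑ i ∈ s, g i : Module.End R V) := by
  intro v w
  simp only [LinearMap.sum_apply, map_sum]
  exact Finset.sum_congr rfl fun i hi => h i hi v w

end Uniqueness

variable {V : Type*} [AddCommGroup V] [Module K V] {B : BilinForm K V}

theorem adjointOp_eq (hB : B.SeparatingRight) {f g : Module.End K V}
    (h : IsAdjointPair B B f g) : adjointOp B f = g := by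
  have hex : ∃ g : Module.End K V, IsAdjointPair B B f g := ⟨g, h⟩
  rw [adjointOp, dif_pos hex]
  exact adjoint_unique hB hex.choose_spec h

theorem isAdjointPair_coeff_pow {F F' : (Module.End K V)⟦X⟧}
    (h : ∀ n, IsAdjointPair B B (PowerSeries.coeff n F : Module.End K V)
      (PowerSeries.coeff n F' : Module.End K V)) (k n : ℕ) :
    IsAdjointPair B B (PowerSeries.coeff n (F ^ k) : Module.End K V)
      (PowerSeries.coeff n (F' ^ k) : Module.End K V) := by
  induction k generalizing n with
  | zero =>
    intro v w
    rw [pow_zero, pow_zero, PowerSeries.coeff_one]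
    split_ifs <;> simp
  | succ k ih =>
    rw [pow_succ, pow_succ', PowerSeries.coeff_mul, PowerSeries.coeff_mul,
      ← Finset.Nat.sum_antidiagonal_swap]
    exact isAdjointPair_sum _ fun p _ => (ih p.2).mul (h p.1)

theorem isAdjointPair_coeff_expSeries {F F' : (Module.End K V)⟦X⟧}
    (h : ∀ n, IsAdjointPair B B (PowerSeries.coeff n F : Module.End K V)
      (PowerSeries.coeff n F' : Module.End K V)) (n : ℕ) :
    IsAdjointPair B B (PowerSeries.coeff n (expSeries F) : Module.End K V)
      (PowerSeries.coeff n (expSeries F') : Module.End K V) := by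
  rw [expSeries, expSeries, PowerSeries.coeff_mk, PowerSeries.coeff_mk]
  exact isAdjointPair_sum _ fun k _ => (isAdjointPair_coeff_pow h k n).smul _

theorem isAdjointPair_pMul (r : ℕ+) : IsAdjointPair tForm tForm (pMul r)
    (((r : ℕ) / (1 - t ^ (r : ℕ)) : K) • (MvPolynomial.pderiv r).toLinearMap :
      Module.End K Lam) := by
  intro f g
  induction f using MvPolynomial.induction_on' with
  | add p q hp hq =>
    rw [map_add, map_add, map_add, LinearMap.add_apply, LinearMap.add_apply, hp, hq]
  | monomial m a =>
    have hcoeff : MvPolynomial.coeff m ((MvPolynomial.pderiv r).toLinearMap g) =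
        MvPolynomial.coeff (m + Finsupp.single r 1) g * (m r + 1) :=
      MvPolynomial.coeff_pderiv _ _
    rw [pMul, LinearMap.mulLeft_apply, mul_comm, MvPolynomial.X, MvPolynomial.monomial_mul, mul_one,
      tForm_monomial, tForm_monomial, tNumber_add_single, LinearMap.smul_apply,
      MvPolynomial.coeff_smul, hcoeff, smul_eq_mul]
    ring

theorem pAdj_eq (r : ℕ+) : pAdj r =
    ((r : ℕ) / (1 - t ^ (r : ℕ)) : K) • (MvPolynomial.pderiv r).toLinearMap :=
  adjointOp_eq tForm_separatingRight (isAdjointPair_pMul r)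

theorem isAdjointPair_pAdj (r : ℕ+) : IsAdjointPair tForm tForm (pMul r) (pAdj r) := by
  rw [pAdj_eq]
  exact isAdjointPair_pMul r

theorem gCoeff_smul_pAdj (r : ℕ+) :
    gCoeff r • pAdj r = (MvPolynomial.pderiv r).toLinearMap := by
  have h1 := one_sub_t_pow_ne_zero r.pos
  have h2 : ((r : ℕ) : K) ≠ 0 := Nat.cast_ne_zero.2 r.ne_zero
  rw [pAdj_eq, gCoeff, smul_smul, div_mul_div_cancel₀ h2, div_self h1, one_smul]

/-- The operator `f ↦ f_n`, where `f[Y + ε u] = ∑ n, f_n u ^ n`. -/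
def shiftCoeff (ε : K) (n : ℕ) : Module.End K Lam :=
  ((Polynomial.lcoeff Lam n).restrictScalars K).comp (shift ε).toLinearMap

theorem shiftCoeff_apply (ε : K) (n : ℕ) (f : Lam) :
    shiftCoeff ε n f = (shift ε f).coeff n := rfl

theorem derivative_shift_X (ε : K) {k : ℕ+} {N : ℕ} (hN : k ≤ N) :
    Polynomial.derivative (shift ε (MvPolynomial.X k)) =
      ∑ r ∈ Finset.range N, (((r : K) + 1) * ε) •
        (Polynomial.X ^ r * shift ε (MvPolynomial.pderiv r.succPNat (MvPolynomial.X k))) := by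
  have hk : k.natPred.succPNat = k := PNat.succPNat_natPred k
  have hcast : (k.natPred : K) + 1 = ((k : ℕ) : K) := by
    rw [← Nat.cast_succ, Nat.succ_eq_add_one, PNat.natPred_add_one]
  rw [Finset.sum_eq_single k.natPred]
  · rw [hk, MvPolynomial.pderiv_X_self, map_one, mul_one, shift_X, Polynomial.derivative_add,
      Polynomial.derivative_C, zero_add, Polynomial.derivative_smul, Polynomial.derivative_X_pow,
      hcast, mul_comm _ ε, mul_smul, Nat.cast_smul_eq_nsmul, nsmul_eq_mul, Polynomial.C_eq_natCast]
    rfl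
  · intro r _ hr
    rw [MvPolynomial.pderiv_X_of_ne, map_zero, mul_zero, smul_zero]
    rintro rfl
    exact hr (Nat.natPred_succPNat r).symm
  · intro h
    exact absurd (Finset.mem_range.2 ((Nat.lt_of_succ_le (by simpa using hN)))) h

theorem derivative_shift (ε : K) (f : Lam) : ∃ N₀ : ℕ, ∀ N ≥ N₀,
    Polynomial.derivative (shift ε f) = ∑ r ∈ Finset.range N, (((r : K) + 1) * ε) •
      (Polynomial.X ^ r * shift ε (MvPolynomial.pderiv r.succPNat f)) := by
  induction f using MvPolynomial.induction_on with
  | C a => exact ⟨0, fun N _ => by simp⟩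
  | add p q hp hq =>
    obtain ⟨n, hn⟩ := hp
    obtain ⟨m, hm⟩ := hq
    refine ⟨max n m, fun N hN => ?_⟩
    simp only [map_add, mul_add, smul_add, Finset.sum_add_distrib]
    rw [← hn N (le_of_max_le_left hN), ← hm N (le_of_max_le_right hN)]
  | mul_X p k hp =>
    obtain ⟨n, hn⟩ := hp
    refine ⟨max n k, fun N hN => ?_⟩
    rw [map_mul, Polynomial.derivative_mul, hn N (le_of_max_le_left hN),
      derivative_shift_X ε (le_of_max_le_right hN), Finset.sum_mul, Finset.mul_sum,
      ← Finset.sum_add_distrib]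
    refine Finset.sum_congr rfl fun r _ => ?_
    rw [Derivation.leibniz, map_add, smul_eq_mul, smul_eq_mul, map_mul, map_mul, smul_mul_assoc,
      mul_smul_comm, ← smul_add]
    congr 1
    ring

theorem shiftCoeff_recursion (ε : K) (n : ℕ) :
    ((n : K) + 1) • shiftCoeff ε (n + 1) = ∑ p ∈ Finset.HasAntidiagonal.antidiagonal n,
      (((p.1 : K) + 1) * ε) • (shiftCoeff ε p.2 *
        (MvPolynomial.pderiv p.1.succPNat).toLinearMap : Module.End K Lam) := by
  refine LinearMap.ext fun f => ?_
  obtain ⟨N₀, hN⟩ := derivative_shift ε f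
  have h := congrArg (Polynomial.coeff · n) (hN (max N₀ (n + 1)) (le_max_left _ _))
  simp only [Polynomial.coeff_derivative, Polynomial.finsetSum_coeff, Polynomial.coeff_smul,
    Polynomial.coeff_X_pow_mul'] at h
  rw [LinearMap.smul_apply, shiftCoeff_apply, Algebra.smul_def, map_add, map_natCast, map_one,
    mul_comm, h, Finset.Nat.sum_antidiagonal_eq_sum_range_succ_mk, LinearMap.sum_apply]
  refine (Finset.sum_subset_zero_on_sdiff (Finset.range_mono (le_max_right _ _)) ?_ ?_).symm
  · intro r hr
    have hnr : n < r := by simpa using (Finset.mem_sdiff.1 hr).2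
    rw [if_neg (by omega), smul_zero]
  · intro r hr
    rw [if_pos (Finset.mem_range_succ_iff.1 hr)]
    rfl

theorem shiftCoeff_zero (ε : K) : shiftCoeff ε 0 = 1 := by
  have h : ((Polynomial.evalRingHom (0 : Lam)).comp (shift ε : Lam →+* Polynomial Lam)) =
      RingHom.id Lam :=
    MvPolynomial.ringHom_ext (fun a => by simp) fun r => by simp [shift_X]
  refine LinearMap.ext fun f => ?_
  rw [shiftCoeff_apply, Polynomial.coeff_zero_eq_eval_zero]
  exact DFunLike.congr_fun h f

/-- Both sides satisfy the recursion of an exponential, with `p_r` on the left and its adjoint on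
the right. -/
theorem isAdjointPair_mulLeft_expPos (ε : K) (n : ℕ) : IsAdjointPair tForm tForm
    (LinearMap.mulLeft K
      (PowerSeries.coeff n (expPos fun r => (ε * gCoeff r) • (MvPolynomial.X r : Lam))))
    (shiftCoeff ε n) := by
  induction n using Nat.strong_induction_on with
  | _ n ih =>
    cases n with
    | zero =>
      rw [coeff_zero_expPos, shiftCoeff_zero, LinearMap.mulLeft_one]
      exact LinearMap.isAdjointPair_id
    | succ n =>
      have hn : ((n : K) + 1) ≠ 0 := Nat.cast_add_one_ne_zero n
      set a := expPos fun r => (ε * gCoeff r) • (MvPolynomial.X r : Lam) with ha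
      have hmul : LinearMap.mulLeft K (PowerSeries.coeff (n + 1) a) = ((n : K) + 1)⁻¹ •
          ∑ p ∈ Finset.HasAntidiagonal.antidiagonal n,
            (((p.1 : K) + 1) * (ε * gCoeff p.1.succPNat)) • (pMul p.1.succPNat *
              LinearMap.mulLeft K (PowerSeries.coeff p.2 a) : Module.End K Lam) := by
        rw [eq_inv_smul_iff₀ hn]
        refine LinearMap.ext fun f => ?_
        rw [LinearMap.smul_apply, LinearMap.mulLeft_apply, ← smul_mul_assoc, ha, expPos_recursion,
          Finset.sum_mul, LinearMap.sum_apply]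
        refine Finset.sum_congr rfl fun p _ => ?_
        rw [smul_mul_assoc, smul_mul_assoc, smul_mul_assoc, smul_smul, mul_assoc]
        rfl
      have hshift : shiftCoeff ε (n + 1) = ((n : K) + 1)⁻¹ •
          ∑ p ∈ Finset.HasAntidiagonal.antidiagonal n,
            (((p.1 : K) + 1) * (ε * gCoeff p.1.succPNat)) • (shiftCoeff ε p.2 *
              pAdj p.1.succPNat : Module.End K Lam) := by
        rw [eq_inv_smul_iff₀ hn, shiftCoeff_recursion]
        refine Finset.sum_congr rfl fun p _ => ?_
        rw [← gCoeff_smul_pAdj, mul_smul_comm, smul_smul, mul_assoc]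
      rw [hmul, hshift]
      refine (isAdjointPair_sum _ fun p hp => ?_).smul _
      have hp := Finset.HasAntidiagonal.mem_antidiagonal.1 hp
      exact ((isAdjointPair_pAdj _).mul (ih p.2 (by omega))).smul _

theorem coeff_expSeries_pMul (c : ℕ+ → K) (n : ℕ) :
    PowerSeries.coeff n (expSeries (positiveSeries c pMul)) = LinearMap.mulLeft K
      (PowerSeries.coeff n (expPos fun r => c r • (MvPolynomial.X r : Lam))) := by
  have h : positiveSeries c pMul = PowerSeries.map (Algebra.lmul K Lam : Lam →+* Module.End K Lam)
      (positiveSeries c MvPolynomial.X) := by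
    ext1 n
    cases n with
    | zero => simp [constantCoeff_positiveSeries]
    | succ n =>
      rw [coeff_succ_positiveSeries, PowerSeries.coeff_map, coeff_succ_positiveSeries,
        RingHom.coe_coe, map_smul]
      rfl
  rw [h, ← map_expSeries, PowerSeries.coeff_map, expSeries_positiveSeries]
  rfl

theorem coeff_expSeries_pAdj (ε : K) (n : ℕ) :
    PowerSeries.coeff n (expSeries (positiveSeries (fun r => ε * gCoeff r) pAdj)) =
      shiftCoeff ε n := by
  refine adjoint_unique tForm_separatingRight ?_ (isAdjointPair_mulLeft_expPos ε n)
  rw [← coeff_expSeries_pMul]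
  refine isAdjointPair_coeff_expSeries (fun k => ?_) n
  cases k with
  | zero =>
    simp only [PowerSeries.coeff_zero_eq_constantCoeff, constantCoeff_positiveSeries]
    exact LinearMap.isAdjointPair_zero (B := tForm) (B' := tForm)
  | succ k =>
    simp only [coeff_succ_positiveSeries]
    exact (isAdjointPair_pAdj _).smul _

end Adjoint

/-! ### Jacobi–Trudi determinants -/

section JacobiTrudi

variable {N : ℕ}

/-- The determinant `det (h_{a_i + j})`, with column indices `j = 0, 1, …`; it is the Schur
function `s_λ` for `a_i = λ_{i+1} - i`. -/
def jacobiTrudi (a : Fin N → ℤ) : Lam :=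
  Matrix.det (Matrix.of fun i j : Fin N => complete (a i + (j : ℕ)))

theorem tau_jacobiTrudi (a : Fin N → ℤ) : tau (jacobiTrudi a) =
    Matrix.det (Matrix.of (Matrix.vecCons (fun j : Fin (N + 1) => Polynomial.X ^ (j : ℕ))
      fun i j => Polynomial.C (complete (a i - 1 + (j : ℕ))))) := by
  -- Subtracting `u` times the preceding column leaves only the first entry of the first row.
  rw [Matrix.det_eq_of_forall_col_eq_smul_add_pred (fun _ => Polynomial.X)
    (B := Matrix.of (Matrix.vecCons (Matrix.vecCons 1 0)
      fun i => Matrix.vecCons (Polynomial.C (complete (a i - 1)))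
        fun j : Fin N => tau (complete (a i + (j : ℕ)))))]
  · rw [Matrix.det_succ_row_zero, Finset.sum_eq_single 0]
    · simp only [Fin.val_zero, pow_zero, one_mul, Matrix.of_apply, Matrix.cons_val_zero]
      rw [jacobiTrudi, AlgHom.map_det]
      rfl
    · intro j _ hj
      obtain ⟨j, rfl⟩ := Fin.exists_succ_eq.2 hj
      simp
    · simp
  · intro i
    cases i using Fin.cases <;> simp
  · intro i j
    cases i using Fin.cases with
    | zero => simp [pow_succ']
    | succ i =>
      simp only [Matrix.of_apply, Matrix.cons_val_succ]
      rw [tau_complete, Fin.val_castSucc, Fin.val_succ, Nat.cast_succ, add_comm (j : ℤ),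
        ← add_assoc, sub_add_cancel, sub_add_eq_add_sub (a i) 1 (j : ℤ), sub_add_cancel]

theorem vertexOp_jacobiTrudi (n : ℤ) (a : Fin N → ℤ) :
    vertexOp complete n (jacobiTrudi a) = jacobiTrudi (Matrix.vecCons n fun i => a i - 1) := by
  rw [vertexOp_apply, tau_jacobiTrudi, Matrix.det_succ_row_zero, jacobiTrudi,
    Matrix.det_succ_row_zero, map_sum]
  refine Finset.sum_congr rfl fun j _ => ?_
  have hminor : ((Matrix.of (Matrix.vecCons (fun j : Fin (N + 1) => Polynomial.X ^ (j : ℕ))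
      fun i j => Polynomial.C (complete (a i - 1 + (j : ℕ))))).submatrix
        Fin.succ j.succAbove).det =
      Polynomial.C ((Matrix.of fun i j : Fin (N + 1) =>
        complete (Matrix.vecCons n (fun i => a i - 1) i + (j : ℕ))).submatrix
          Fin.succ j.succAbove).det := by
    rw [RingHom.map_det]
    rfl
  have hsign : (-1 : Polynomial Lam) ^ (j : ℕ) = Polynomial.C ((-1) ^ (j : ℕ)) := by simp
  simp only [Matrix.of_apply, Matrix.cons_val_zero]
  rw [hminor, hsign, mul_right_comm, ← Polynomial.C_mul, umbralEval_C_mul,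
    Polynomial.X_pow_eq_monomial, umbralEval_monomial, one_mul, mul_right_comm]

theorem jacobiTrudi_insertNth (k : Fin (N + 1)) (n : ℤ) (a : Fin N → ℤ) :
    jacobiTrudi (k.insertNth n a : Fin (N + 1) → ℤ) =
      (-1) ^ (k : ℕ) * jacobiTrudi (Matrix.vecCons n a) := by
  rw [jacobiTrudi, jacobiTrudi, Matrix.det_succ_row _ k, Matrix.det_succ_row_zero, Finset.mul_sum]
  refine Finset.sum_congr rfl fun j _ => ?_
  rw [pow_add, mul_assoc, mul_assoc, mul_assoc]
  congr 2
  simp only [Matrix.of_apply, Fin.insertNth_apply_same, Matrix.cons_val_zero]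
  congr 2
  ext i l
  simp

theorem jacobiTrudi_eq_zero {a : Fin N → ℤ} {i j : Fin N} (hij : i ≠ j) (h : a i = a j) :
    jacobiTrudi a = 0 :=
  Matrix.det_zero_of_row_eq hij (by ext l; simp [h])

theorem jacobiTrudi_succ {a : ℕ → ℤ} (h : a N = -N) :
    jacobiTrudi (fun j : Fin (N + 1) => a j) = jacobiTrudi fun j : Fin N => a j := by
  rw [jacobiTrudi, Matrix.det_succ_row _ (Fin.last N), Finset.sum_eq_single (Fin.last N)]
  · simp only [Matrix.of_apply, Fin.val_last, h, neg_add_cancel, complete_zero, mul_one]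
    rw [← two_mul, pow_mul, neg_one_sq, one_pow, one_mul, jacobiTrudi]
    congr 1
    ext i j
    simp
  · intro j _ hj
    have hneg : complete (-(N : ℤ) + (j : ℕ)) = 0 := by
      have := Fin.val_lt_last hj
      rw [complete_eq_intCoeff, intCoeff_of_neg _ (by omega)]
    simp only [Matrix.of_apply, Fin.val_last, h]
    rw [hneg, mul_zero, zero_mul]
  · simp

theorem schur_eq_jacobiTrudi (lam : YoungDiagram) (hN : lam.colLen 0 ≤ N) :
    schur lam = jacobiTrudi fun j : Fin N => (lam.rowLen j : ℤ) - (j : ℕ) := by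
  induction N, hN using Nat.le_induction with
  | base => rfl
  | succ N hN ih =>
    rw [ih, jacobiTrudi_succ (a := fun j => (lam.rowLen j : ℤ) - j)]
    simp [maya_rowLen_zero lam hN]

end JacobiTrudi

/-! ### Bosonization of the fermions -/

/-- The sequence `b` lists the positions of the ones of `σ` in decreasing order. The charge of `σ`
is `c`, and from the index `N` on the positions are those of the vacuum of this charge. -/
structure Maya.IsEnumeration (σ : Maya) (b : ℕ → ℤ) (c : ℤ) (N : ℕ) : Prop where
  strictAnti : StrictAnti b
  val_eq_true_iff : ∀ i, σ.val i = true ↔ i ∈ Set.range b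
  eq_of_le : ∀ j ≥ N, b j = c - j

theorem Maya.IsEnumeration.mono {σ : Maya} {b : ℕ → ℤ} {c : ℤ} {N M : ℕ}
    (h : σ.IsEnumeration b c N) (hNM : N ≤ M) : σ.IsEnumeration b c M :=
  ⟨h.strictAnti, h.val_eq_true_iff, fun j hj => h.eq_of_le j (hNM.trans hj)⟩

theorem isEnumeration_ofPartition (lam : YoungDiagram) (c : ℤ) :
    (Maya.ofPartition lam c).IsEnumeration (fun j => c + (lam.rowLen j : ℤ) - j) c
      (lam.colLen 0) where
  strictAnti i j hij := by
    have := lam.rowLen_anti i j hij.le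
    simp only
    omega
  val_eq_true_iff i := by
    rw [maya_val_eq_true_iff]
    refine exists_congr fun j => ?_
    constructor <;> intro h <;> dsimp only at h ⊢ <;> omega
  eq_of_le j hj := by
    rw [maya_rowLen_zero lam hj, Nat.cast_zero, add_zero]

theorem Maya.exists_isEnumeration (σ : Maya) : ∃ b c N, σ.IsEnumeration b c N := by
  obtain ⟨⟨lam, c⟩, rfl⟩ := mayaEquiv.surjective σ
  exact ⟨_, _, _, isEnumeration_ofPartition lam c⟩

theorem iota_ofPartition (lam : YoungDiagram) (c : ℤ) :
    iota (Finsupp.single (Maya.ofPartition lam c) 1) = Finsupp.single c (schur lam) := by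
  have h : mayaEquiv.symm (Maya.ofPartition lam c) = (lam, c) :=
    mayaEquiv.symm_apply_apply (lam, c)
  rw [iota, Finsupp.linearCombination_single, one_smul, h]

theorem iota_vacuum (c : ℤ) :
    iota (Finsupp.single (Maya.ofPartition ⊥ c) 1) = Finsupp.single c 1 := by
  rw [iota_ofPartition, schur, Matrix.det_eq_one_of_card_eq_zero]
  rw [Fintype.card_fin, ← Nat.le_zero, ← not_lt, ← YoungDiagram.mem_iff_lt_colLen]
  exact YoungDiagram.notMem_bot _

namespace Maya.IsEnumeration

variable {σ : Maya} {b : ℕ → ℤ} {c i : ℤ} {k N : ℕ}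

theorem iota_single (h : σ.IsEnumeration b c N) :
    iota (Finsupp.single σ 1) = Finsupp.single c (jacobiTrudi fun j : Fin N => b j - c) := by
  obtain ⟨⟨mu, d⟩, rfl⟩ := mayaEquiv.surjective σ
  have hmu := isEnumeration_ofPartition mu d
  have hrange : Set.range b = Set.range fun j : ℕ => d + (mu.rowLen j : ℤ) - j :=
    Set.ext fun i => (h.val_eq_true_iff i).symm.trans (hmu.val_eq_true_iff i)
  obtain rfl : b = fun j : ℕ => d + (mu.rowLen j : ℤ) - j :=
    (StrictMono.range_inj (γ := ℤᵒᵈ) h.strictAnti.dual_right hmu.strictAnti.dual_right).1 hrange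
  obtain rfl : d = c := sub_left_injective <|
    (hmu.eq_of_le (max N (mu.colLen 0)) (le_max_right _ _)).symm.trans
      (h.eq_of_le _ (le_max_left _ _))
  have hN : mu.colLen 0 ≤ N := by
    have hlen := h.eq_of_le N le_rfl
    have hrow : ¬ 0 < mu.rowLen N := by omega
    rw [← YoungDiagram.mem_iff_lt_rowLen, YoungDiagram.mem_iff_lt_colLen, not_lt] at hrow
    exact hrow
  refine (iota_ofPartition mu d).trans ?_
  rw [schur_eq_jacobiTrudi mu hN]
  congr 2
  ext j
  ring

theorem exists_index (h : σ.IsEnumeration b c N) (i : ℤ) : ∃ k, ∀ j, j < k ↔ i < b j := by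
  have hex : ∃ j, b j ≤ i := by
    refine ⟨max N (c - i).toNat, ?_⟩
    rw [h.eq_of_le _ (le_max_left _ _)]
    omega
  classical
  refine ⟨Nat.find hex, fun j => ?_⟩
  rw [Nat.lt_find_iff]
  exact ⟨fun hj => not_le.1 (hj j le_rfl), fun hj m hm =>
    not_le.2 (hj.trans_le (h.strictAnti.antitone hm))⟩

theorem onesAbove_eq (h : σ.IsEnumeration b c N) (hk : ∀ j, j < k ↔ i < b j) :
    σ.onesAbove i = k := by
  have himage : {j : ℤ | i < j ∧ σ.val j = true} = b '' Set.Iio k := by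
    ext j
    rw [Set.mem_ofPred_eq, h.val_eq_true_iff]
    constructor
    · rintro ⟨hij, m, rfl⟩
      exact ⟨m, (hk m).2 hij, rfl⟩
    · rintro ⟨m, hm, rfl⟩
      exact ⟨(hk m).1 hm, m, rfl⟩
  rw [Maya.onesAbove, himage, Set.ncard_image_of_injective _ h.strictAnti.injective,
    ← Finset.coe_Iio, Set.ncard_coe_finset, Nat.card_Iio]

end Maya.IsEnumeration

/-- The sequence `b` with the entry `i` inserted at the index `k`. -/
def insertAt (k : ℕ) (i : ℤ) (b : ℕ → ℤ) (j : ℕ) : ℤ :=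
  if j < k then b j else if j = k then i else b (j - 1)

theorem range_insertAt (k : ℕ) (i : ℤ) (b : ℕ → ℤ) :
    Set.range (insertAt k i b) = insert i (Set.range b) := by
  ext l
  constructor
  · rintro ⟨j, rfl⟩
    unfold insertAt
    split_ifs
    · exact Or.inr ⟨_, rfl⟩
    · exact Or.inl rfl
    · exact Or.inr ⟨_, rfl⟩
  · rintro (rfl | ⟨j, rfl⟩)
    · exact ⟨k, by simp [insertAt]⟩
    · by_cases hj : j < k
      · exact ⟨j, if_pos hj⟩
      · exact ⟨j + 1, by rw [insertAt, if_neg (by omega), if_neg (by omega), Nat.add_sub_cancel]⟩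

theorem insertAt_eq_insertNth {N : ℕ} (k : Fin (N + 1)) (i : ℤ) (b : ℕ → ℤ) :
    (fun j : Fin (N + 1) => insertAt k i b j) = k.insertNth i fun j : Fin N => b j := by
  rw [Fin.eq_insertNth_iff]
  refine ⟨by simp [insertAt], funext fun j => ?_⟩
  by_cases hj : (j : ℕ) < k
  · rw [Fin.removeNth, Fin.succAbove_of_castSucc_lt _ _ (by simpa [Fin.lt_def] using hj),
      Fin.val_castSucc, insertAt, if_pos hj]
  · rw [Fin.removeNth, Fin.succAbove_of_le_castSucc _ _ (by simpa [Fin.le_def] using hj),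
      Fin.val_succ, insertAt, if_neg (by omega), if_neg (by omega), Nat.add_sub_cancel]

theorem Maya.IsEnumeration.set_true {σ : Maya} {b : ℕ → ℤ} {c i : ℤ} {k N : ℕ}
    (h : σ.IsEnumeration b c N) (hi : σ.val i = false) (hk : ∀ j, j < k ↔ i < b j) (hkN : k ≤ N) :
    (σ.set i true).IsEnumeration (insertAt k i b) (c + 1) (N + 1) where
  strictAnti := by
    have hne (j : ℕ) : b j ≠ i := fun hj => by
      simpa [hi] using (h.val_eq_true_iff i).2 ⟨j, hj⟩
    refine strictAnti_nat_of_succ_lt fun j => ?_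
    have hbefore := hk j
    have hcur := hne j
    have hstep : b (j + 1) < b j := h.strictAnti (Nat.lt_succ_self j)
    have hprev : k < j → b j < b (j - 1) := fun hj => h.strictAnti (by omega)
    simp only [insertAt, Nat.add_sub_cancel]
    split_ifs <;> omega
  val_eq_true_iff l := by
    rw [range_insertAt, Set.mem_insert_iff, ← h.val_eq_true_iff]
    by_cases hl : l = i <;> simp [Maya.set, hl]
  eq_of_le j hj := by
    rw [insertAt, if_neg (by omega), if_neg (by omega), h.eq_of_le _ (by omega)]
    omega

/-- The fermion creation operator `ψ_i⁺` at `t = 1`. -/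
def fermion (i : ℤ) : Module.End K Fock :=
  Finsupp.linearCombination K fun σ : Maya =>
    if σ.val i = false then Finsupp.single (σ.set i true) ((-1) ^ σ.onesAbove i) else 0

theorem fermion_single (i : ℤ) (σ : Maya) : fermion i (Finsupp.single σ 1) =
    if σ.val i = false then Finsupp.single (σ.set i true) ((-1) ^ σ.onesAbove i) else 0 := by
  rw [fermion, Finsupp.linearCombination_single, one_smul]

/-- The bosonic form of the fermion creation operator. -/
def bosonFermion (i : ℤ) : Module.End K Boson :=
  Finsupp.lsum K fun c : ℤ => (Finsupp.lsingle (c + 1)).comp (vertexOp complete (i - c - 1))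

theorem bosonFermion_single (i c : ℤ) (f : Lam) : bosonFermion i (Finsupp.single c f) =
    Finsupp.single (c + 1) (vertexOp complete (i - c - 1) f) := by
  simp [bosonFermion]

section FermionSingle

variable {σ : Maya} {b : ℕ → ℤ} {c : ℤ} {N : ℕ}

theorem bosonFermion_iota_single (h : σ.IsEnumeration b c N) (i : ℤ) :
    bosonFermion i (iota (Finsupp.single σ 1)) = Finsupp.single (c + 1)
      (jacobiTrudi (Matrix.vecCons (i - (c + 1)) fun j : Fin N => b j - (c + 1))) := by
  rw [h.iota_single, bosonFermion_single, vertexOp_jacobiTrudi, sub_sub]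
  simp only [sub_sub]

theorem iota_fermion_single_of_hole (h : σ.IsEnumeration b c N) {i : ℤ} (hi : σ.val i = false)
    (hN : b N < i) :
    iota (fermion i (Finsupp.single σ 1)) = bosonFermion i (iota (Finsupp.single σ 1)) := by
  obtain ⟨k, hk⟩ := h.exists_index i
  have hkN : k ≤ N := not_lt.1 fun hlt => lt_asymm hN ((hk N).1 hlt)
  have hins : (fun j : Fin (N + 1) => insertAt k i b j - (c + 1)) =
      (⟨k, Nat.lt_succ_of_le hkN⟩ : Fin (N + 1)).insertNth (i - (c + 1))
        (fun j : Fin N => b j - (c + 1)) := by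
    rw [← insertAt_eq_insertNth ⟨k, Nat.lt_succ_of_le hkN⟩ (i - (c + 1)) fun j => b j - (c + 1)]
    ext j
    simp only [insertAt]
    split_ifs <;> rfl
  rw [fermion_single, if_pos hi, h.onesAbove_eq hk, ← Finsupp.smul_single_one, map_smul,
    (h.set_true hi hk hkN).iota_single, hins, jacobiTrudi_insertNth, bosonFermion_iota_single h,
    Finsupp.smul_single, Algebra.smul_def, ← mul_assoc, map_pow, map_neg, map_one, ← mul_pow,
    neg_one_mul, neg_neg, one_pow, one_mul]

theorem bosonFermion_iota_single_of_particle (h : σ.IsEnumeration b c N) {i : ℤ}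
    (hi : σ.val i = true) (hN : b N < i) : bosonFermion i (iota (Finsupp.single σ 1)) = 0 := by
  obtain ⟨j, rfl⟩ := (h.val_eq_true_iff i).1 hi
  have hjN : j < N := h.strictAnti.lt_iff_gt.1 hN
  rw [bosonFermion_iota_single h, jacobiTrudi_eq_zero (i := 0) (j := Fin.succ ⟨j, hjN⟩)
    (Fin.succ_ne_zero _).symm (by simp), Finsupp.single_zero]

end FermionSingle

theorem iota_fermion_single (i : ℤ) (σ : Maya) :
    iota (fermion i (Finsupp.single σ 1)) = bosonFermion i (iota (Finsupp.single σ 1)) := by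
  obtain ⟨b, c, N₀, h₀⟩ := σ.exists_isEnumeration
  set N := max N₀ (c - i + 1).toNat
  have h : σ.IsEnumeration b c N := h₀.mono (le_max_left _ _)
  have hN : b N < i := by
    rw [h.eq_of_le N le_rfl]
    omega
  cases hi : σ.val i with
  | false => exact iota_fermion_single_of_hole h hi hN
  | true =>
    rw [bosonFermion_iota_single_of_particle h hi hN, fermion_single, hi, if_neg (by decide),
      map_zero]

theorem iota_fermion (i : ℤ) (v : Fock) : iota (fermion i v) = bosonFermion i (iota v) := by
  have h : iota ∘ₗ fermion i = bosonFermion i ∘ₗ iota :=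
    Finsupp.lhom_ext' fun σ => LinearMap.ext_ring (iota_fermion_single i σ)
  exact LinearMap.congr_fun h v

/-! ### Row configurations -/

/-- The weight at `x = 1` of a vertex with left, upper and right edge values `W`, `N`, `E`. These
three determine the lower edge value. -/
def edgeWeight : Bool → Bool → Bool → K
  | _, false, false => 1
  | false, true, false => 1
  | true, true, false => 0
  | false, false, true => 0
  | true, false, true => t
  | false, true, true => t - 1
  | true, true, true => -1

/-- The value of the horizontal edge `i` in the row configuration `e`, encoded as the set of the
horizontal edges of value one. -/
def edgeBit (e : Finset ℤ) (i : ℤ) : Bool := decide (i ∈ e)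

/-- The weight of the vertex `i` in the row configuration `e` below `σ`. -/
def siteWeight (e : Finset ℤ) (σ : Maya) (i : ℤ) : K :=
  edgeWeight (edgeBit e (i - 1)) (σ.val i) (edgeBit e i)

/-- The weight at `x = 1` of the row configuration `e` below `σ`. -/
def rowWeight (e : Finset ℤ) (σ : Maya) : K := ∏ᶠ i : ℤ, siteWeight e σ i

theorem edgeWeight_false_false (N : Bool) : edgeWeight false N false = 1 := by
  cases N <;> rfl

theorem edgeBit_eq_false {e : Finset ℤ} {i : ℤ} (h : i ∉ e) : edgeBit e i = false :=
  decide_eq_false h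

theorem edgeBit_eq_true {e : Finset ℤ} {i : ℤ} (h : i ∈ e) : edgeBit e i = true :=
  decide_eq_true h

theorem exists_forall_ge_edgeBit_eq_false (e : Finset ℤ) : ∃ b, ∀ i ≥ b, edgeBit e i = false := by
  obtain ⟨b, hb⟩ := e.bddAbove
  refine ⟨b + 1, fun i hi => edgeBit_eq_false fun h => ?_⟩
  have := hb h
  omega

theorem exists_forall_le_edgeBit_eq_false (e : Finset ℤ) : ∃ b, ∀ i ≤ b, edgeBit e i = false := by
  obtain ⟨b, hb⟩ := e.bddBelow
  refine ⟨b - 1, fun i hi => edgeBit_eq_false fun h => ?_⟩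
  have := hb h
  omega

theorem hasFiniteMulSupport_siteWeight (e : Finset ℤ) (σ : Maya) :
    Function.HasFiniteMulSupport (siteWeight e σ) := by
  refine (e.finite_toSet.union (e.finite_toSet.image (· + 1))).subset fun i hi => ?_
  by_contra hc
  simp only [Set.mem_union, Finset.mem_coe, Set.mem_image, not_or, not_exists, not_and] at hc
  apply hi
  rw [siteWeight, edgeBit_eq_false hc.1, edgeBit_eq_false fun h => hc.2 _ h (sub_add_cancel i 1),
    edgeWeight_false_false]

/-- The lower edge values of the row configuration `e` with upper edge values `σ`. -/
def rowOut (e : Finset ℤ) (σ : Maya) : Maya where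
  val := fun i => ((edgeBit e (i - 1)).xor (σ.val i)).xor (edgeBit e i)
  left_one := by
    obtain ⟨a, ha⟩ := σ.left_one
    obtain ⟨b, hb⟩ := exists_forall_le_edgeBit_eq_false e
    refine ⟨min a b, fun i hi => ?_⟩
    rw [hb i (by omega), hb (i - 1) (by omega), ha i (by omega)]
    rfl
  right_zero := by
    obtain ⟨a, ha⟩ := σ.right_zero
    obtain ⟨b, hb⟩ := exists_forall_ge_edgeBit_eq_false e
    refine ⟨max a (b + 1), fun i hi => ?_⟩
    rw [hb i (by omega), hb (i - 1) (by omega), ha i (by omega)]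
    rfl

theorem rowOut_val (e : Finset ℤ) (σ : Maya) (i : ℤ) :
    (rowOut e σ).val i = ((edgeBit e (i - 1)).xor (σ.val i)).xor (edgeBit e i) := rfl

/-- The contribution of the row configuration `e` to the row transfer matrix at `x = 1`. -/
def edgeOp (e : Finset ℤ) : Module.End K Fock :=
  Finsupp.linearCombination K fun σ : Maya => Finsupp.single (rowOut e σ) (rowWeight e σ)

theorem edgeOp_single (e : Finset ℤ) (σ : Maya) (a : K) :
    edgeOp e (Finsupp.single σ a) = Finsupp.single (rowOut e σ) (a * rowWeight e σ) := by
  rw [edgeOp, Finsupp.linearCombination_single, Finsupp.smul_single, smul_eq_mul]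

/-! ### Counting ones -/

theorem Maya.finite_onesAbove (σ : Maya) (i : ℤ) : {j : ℤ | i < j ∧ σ.val j = true}.Finite := by
  obtain ⟨b, hb⟩ := σ.right_zero
  refine (Set.finite_Ioo i b).subset fun j hj => ⟨hj.1, ?_⟩
  by_contra hc
  have h := hj.2
  rw [hb j (by omega)] at h
  simp at h

theorem Maya.onesAbove_eq_add_ite (σ : Maya) (i : ℤ) :
    σ.onesAbove i = σ.onesAbove (i + 1) + if σ.val (i + 1) = true then 1 else 0 := by
  have hmem (j : ℤ) : i < j ↔ j = i + 1 ∨ i + 1 < j := by omega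
  rw [Maya.onesAbove, Maya.onesAbove]
  split_ifs with h
  · rw [← Set.ncard_insert_of_notMem (fun hj => lt_irrefl _ hj.1) (σ.finite_onesAbove (i + 1))]
    congr 1
    ext j
    simp only [Set.mem_ofPred_eq, Set.mem_insert_iff, hmem, or_and_right]
    exact or_congr_left (and_iff_left_of_imp fun hj => hj ▸ h)
  · rw [add_zero]
    congr 1
    ext j
    simp only [Set.mem_ofPred_eq, hmem, or_and_right]
    exact or_iff_right fun hj => h (hj.1 ▸ hj.2)

theorem Maya.onesAbove_congr {σ τ : Maya} {i : ℤ} (h : ∀ j, i < j → σ.val j = τ.val j) :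
    σ.onesAbove i = τ.onesAbove i := by
  rw [Maya.onesAbove, Maya.onesAbove]
  congr 1
  ext j
  simp only [Set.mem_ofPred_eq]
  exact and_congr_right fun hj => by rw [h j hj]

theorem Maya.onesAbove_eq_zero {σ : Maya} {i : ℤ} (h : ∀ j, i < j → σ.val j = false) :
    σ.onesAbove i = 0 := by
  rw [Maya.onesAbove, Set.ncard_eq_zero (σ.finite_onesAbove i)]
  ext j
  simp only [Set.mem_ofPred_eq, Set.mem_empty_iff_false, iff_false, not_and]
  intro hj
  rw [h j hj]
  simp

/-- The sign `-1` for the letter one and `1` for the letter zero. -/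
def bitSign (b : Bool) : K := if b = true then -1 else 1

theorem neg_one_pow_onesAbove (σ : Maya) (i : ℤ) :
    (-1 : K) ^ σ.onesAbove i = (-1) ^ σ.onesAbove (i + 1) * bitSign (σ.val (i + 1)) := by
  rw [σ.onesAbove_eq_add_ite i, bitSign]
  split_ifs
  · rw [pow_succ]
  · rw [add_zero, mul_one]

theorem bitSign_xor (a b : Bool) : bitSign (a.xor b) = bitSign a * bitSign b := by
  cases a <;> cases b <;> simp [bitSign]

theorem bitSign_mul_self (a : Bool) : bitSign a * bitSign a = 1 := by
  cases a <;> simp [bitSign]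

theorem neg_one_pow_onesAbove_rowOut (e : Finset ℤ) (σ : Maya) (i : ℤ) :
    (-1 : K) ^ (rowOut e σ).onesAbove i = (-1) ^ σ.onesAbove i * bitSign (edgeBit e i) := by
  obtain ⟨M, hM⟩ : ∃ M, ∀ i ≥ M,
      (-1 : K) ^ (rowOut e σ).onesAbove i = (-1) ^ σ.onesAbove i * bitSign (edgeBit e i) := by
    obtain ⟨a, ha⟩ := σ.right_zero
    obtain ⟨a', ha'⟩ := (rowOut e σ).right_zero
    obtain ⟨b, hb⟩ := exists_forall_ge_edgeBit_eq_false e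
    refine ⟨max (max a a') b, fun i hi => ?_⟩
    rw [Maya.onesAbove_eq_zero fun j hj => ha' j (by omega),
      Maya.onesAbove_eq_zero fun j hj => ha j (by omega), hb i (by omega)]
    simp [bitSign]
  rcases le_total M i with hi | hi
  · exact hM i hi
  · induction i, hi using Int.leInductionDown with
    | base => exact hM M le_rfl
    | pred i _ ih =>
      rw [neg_one_pow_onesAbove, neg_one_pow_onesAbove σ, sub_add_cancel, ih, rowOut_val,
        bitSign_xor, bitSign_xor]
      linear_combination ((-1 : K) ^ σ.onesAbove i * bitSign (edgeBit e (i - 1)) *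
        bitSign (σ.val i)) * bitSign_mul_self (edgeBit e i)

/-! ### Exchange relations of row configurations and fermions -/

theorem Maya.set_val (σ : Maya) (i : ℤ) (b : Bool) (j : ℤ) :
    (σ.set i b).val j = if j = i then b else σ.val j := by
  change Function.update σ.val i b j = _
  rw [Function.update_apply]

theorem prod_mul_finprod_mem_compl {α M : Type*} [CommMonoid M] (s : Finset α) {f : α → M}
    (hf : f.HasFiniteMulSupport) : (∏ i ∈ s, f i) * ∏ᶠ i ∈ (s : Set α)ᶜ, f i = ∏ᶠ i, f i := by
  rw [← finprod_mem_coe_finset, ← finprod_mem_union' disjoint_compl_right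
    (s.finite_toSet.inter_of_left _) (hf.inter_of_right _), Set.union_compl_self, finprod_mem_univ]

section Exchange

variable (e₀ : Finset ℤ) (σ : Maya) (i : ℤ)

/-- The contribution of the vertices other than `i` and `i + 1` to the weight of a row
configuration. -/
def restWeight : K := ∏ᶠ j ∈ (({i, i + 1} : Finset ℤ) : Set ℤ)ᶜ, siteWeight e₀ σ j

/-- The lower edge values of `e₀`, with the letters `x` at `i` and `y` at `i + 1` instead. -/
def modOut (x y : Bool) : Maya := ((rowOut e₀ σ).set i x).set (i + 1) y

variable {e₀ σ i} {e : Finset ℤ} {σ' : Maya}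

theorem rowWeight_eq_rest (he : ∀ j, j ≠ i → edgeBit e j = edgeBit e₀ j)
    (hσ : ∀ j, j ≠ i → j ≠ i + 1 → σ'.val j = σ.val j) :
    rowWeight e σ' = edgeWeight (edgeBit e₀ (i - 1)) (σ'.val i) (edgeBit e i) *
      edgeWeight (edgeBit e i) (σ'.val (i + 1)) (edgeBit e₀ (i + 1)) * restWeight e₀ σ i := by
  rw [rowWeight, ← prod_mul_finprod_mem_compl {i, i + 1} (hasFiniteMulSupport_siteWeight e σ'),
    Finset.prod_pair (by omega), restWeight]
  congr 1
  · rw [siteWeight, siteWeight, add_sub_cancel_right, he (i - 1) (by omega),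
      he (i + 1) (by omega)]
  · refine finprod_mem_congr rfl fun j hj => ?_
    simp only [Finset.coe_pair, Set.mem_compl_iff, Set.mem_insert_iff, Set.mem_singleton_iff,
      not_or] at hj
    rw [siteWeight, siteWeight, he j hj.1, he (j - 1) (by omega), hσ j hj.1 hj.2]

theorem rowOut_eq_modOut (he : ∀ j, j ≠ i → edgeBit e j = edgeBit e₀ j)
    (hσ : ∀ j, j ≠ i → j ≠ i + 1 → σ'.val j = σ.val j) :
    rowOut e σ' = modOut e₀ σ i (((edgeBit e₀ (i - 1)).xor (σ'.val i)).xor (edgeBit e i))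
      (((edgeBit e i).xor (σ'.val (i + 1))).xor (edgeBit e₀ (i + 1))) := by
  ext j
  rw [modOut, Maya.set_val, Maya.set_val, rowOut_val]
  split_ifs with h1 h2
  · rw [h1, add_sub_cancel_right, he (i + 1) (by omega)]
  · rw [h2, he (i - 1) (by omega)]
  · rw [rowOut_val, he j h2, he (j - 1) (by omega), hσ j h2 h1]

theorem modOut_set_left (x y b : Bool) : (modOut e₀ σ i x y).set i b = modOut e₀ σ i b y := by
  ext j
  simp only [modOut, Maya.set_val]
  split_ifs <;> first | rfl | omega

theorem modOut_set_right (x y b : Bool) :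
    (modOut e₀ σ i x y).set (i + 1) b = modOut e₀ σ i x b := by
  ext j
  simp only [modOut, Maya.set_val]
  split_ifs <;> rfl

theorem modOut_val_left (x y : Bool) : (modOut e₀ σ i x y).val i = x := by
  simp [modOut, Maya.set_val]

theorem modOut_val_right (x y : Bool) : (modOut e₀ σ i x y).val (i + 1) = y := by
  simp [modOut, Maya.set_val]

theorem edgeOp_fermion_left (he : ∀ j, j ≠ i → edgeBit e j = edgeBit e₀ j) :
    edgeOp e (fermion i (Finsupp.single σ 1)) = if σ.val i = false then
      Finsupp.single (modOut e₀ σ i (((edgeBit e₀ (i - 1)).xor true).xor (edgeBit e i))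
        (((edgeBit e i).xor (σ.val (i + 1))).xor (edgeBit e₀ (i + 1))))
        ((-1) ^ σ.onesAbove (i + 1) * bitSign (σ.val (i + 1)) *
          (edgeWeight (edgeBit e₀ (i - 1)) true (edgeBit e i) *
            edgeWeight (edgeBit e i) (σ.val (i + 1)) (edgeBit e₀ (i + 1)) * restWeight e₀ σ i))
      else 0 := by
  rw [fermion_single]
  split_ifs with h
  · have hσ : ∀ j, j ≠ i → j ≠ i + 1 → (σ.set i true).val j = σ.val j := fun j h1 _ => by
      rw [Maya.set_val, if_neg h1]
    rw [edgeOp_single, rowOut_eq_modOut he hσ, rowWeight_eq_rest he hσ, neg_one_pow_onesAbove,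
      Maya.set_val, Maya.set_val, if_pos rfl, if_neg (by omega)]
  · exact map_zero _

theorem edgeOp_fermion_right (he : ∀ j, j ≠ i → edgeBit e j = edgeBit e₀ j) :
    edgeOp e (fermion (i + 1) (Finsupp.single σ 1)) = if σ.val (i + 1) = false then
      Finsupp.single (modOut e₀ σ i (((edgeBit e₀ (i - 1)).xor (σ.val i)).xor (edgeBit e i))
        (((edgeBit e i).xor true).xor (edgeBit e₀ (i + 1))))
        ((-1) ^ σ.onesAbove (i + 1) * (edgeWeight (edgeBit e₀ (i - 1)) (σ.val i) (edgeBit e i) *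
            edgeWeight (edgeBit e i) true (edgeBit e₀ (i + 1)) * restWeight e₀ σ i))
      else 0 := by
  rw [fermion_single]
  split_ifs with h
  · have hσ : ∀ j, j ≠ i → j ≠ i + 1 → (σ.set (i + 1) true).val j = σ.val j := fun j _ h1 => by
      rw [Maya.set_val, if_neg h1]
    rw [edgeOp_single, rowOut_eq_modOut he hσ, rowWeight_eq_rest he hσ,
      Maya.set_val, Maya.set_val, if_pos rfl, if_neg (by omega)]
  · exact map_zero _

theorem fermion_left_edgeOp (he : ∀ j, j ≠ i → edgeBit e j = edgeBit e₀ j) :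
    fermion i (edgeOp e (Finsupp.single σ 1)) =
      if ((edgeBit e₀ (i - 1)).xor (σ.val i)).xor (edgeBit e i) = false then
      Finsupp.single (modOut e₀ σ i true
        (((edgeBit e i).xor (σ.val (i + 1))).xor (edgeBit e₀ (i + 1))))
        ((-1) ^ σ.onesAbove (i + 1) * bitSign (σ.val (i + 1)) * bitSign (edgeBit e i) *
          (edgeWeight (edgeBit e₀ (i - 1)) (σ.val i) (edgeBit e i) *
            edgeWeight (edgeBit e i) (σ.val (i + 1)) (edgeBit e₀ (i + 1)) * restWeight e₀ σ i))
      else 0 := by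
  rw [edgeOp_single, one_mul, fermion, Finsupp.linearCombination_single,
    neg_one_pow_onesAbove_rowOut, neg_one_pow_onesAbove, rowWeight_eq_rest he fun _ _ _ => rfl,
    rowOut_eq_modOut he fun _ _ _ => rfl, modOut_val_left, modOut_set_left]
  split_ifs
  · rw [Finsupp.smul_single, smul_eq_mul]
    congr 1
    ring
  · exact smul_zero _

theorem fermion_right_edgeOp (he : ∀ j, j ≠ i → edgeBit e j = edgeBit e₀ j) :
    fermion (i + 1) (edgeOp e (Finsupp.single σ 1)) =
      if ((edgeBit e i).xor (σ.val (i + 1))).xor (edgeBit e₀ (i + 1)) = false then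
      Finsupp.single (modOut e₀ σ i
        (((edgeBit e₀ (i - 1)).xor (σ.val i)).xor (edgeBit e i)) true)
        ((-1) ^ σ.onesAbove (i + 1) * bitSign (edgeBit e₀ (i + 1)) *
          (edgeWeight (edgeBit e₀ (i - 1)) (σ.val i) (edgeBit e i) *
            edgeWeight (edgeBit e i) (σ.val (i + 1)) (edgeBit e₀ (i + 1)) * restWeight e₀ σ i))
      else 0 := by
  rw [edgeOp_single, one_mul, fermion, Finsupp.linearCombination_single,
    neg_one_pow_onesAbove_rowOut, rowWeight_eq_rest he fun _ _ _ => rfl,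
    rowOut_eq_modOut he fun _ _ _ => rfl, modOut_val_right, modOut_set_right,
    he (i + 1) (by omega)]
  split_ifs
  · rw [Finsupp.smul_single, smul_eq_mul]
    congr 1
    ring
  · exact smul_zero _

end Exchange

theorem edgeOp_comm_fermion {e : Finset ℤ} {i : ℤ} (hi : i ∉ e) (v : Fock) :
    edgeOp e (fermion i v) = fermion i (edgeOp e v) := by
  suffices h : edgeOp e ∘ₗ fermion i = fermion i ∘ₗ edgeOp e from LinearMap.congr_fun h v
  refine Finsupp.lhom_ext' fun σ => LinearMap.ext_ring ?_
  change edgeOp e (fermion i (Finsupp.single σ 1)) = fermion i (edgeOp e (Finsupp.single σ 1))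
  rw [edgeOp_fermion_left (e₀ := e) fun _ _ => rfl, fermion_left_edgeOp (e₀ := e) fun _ _ => rfl,
    edgeBit_eq_false hi]
  cases edgeBit e (i - 1) <;> cases edgeBit e (i + 1) <;> cases σ.val i <;>
    cases σ.val (i + 1) <;>
    simp [edgeWeight, bitSign]

theorem edgeOp_comm_fermion_succ {e : Finset ℤ} {i : ℤ} (hi : i ∈ e) (v : Fock) :
    t • edgeOp e (fermion (i + 1) v) = fermion (i + 1) (edgeOp e v) := by
  suffices h : t • (edgeOp e ∘ₗ fermion (i + 1)) = fermion (i + 1) ∘ₗ edgeOp e from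
    LinearMap.congr_fun h v
  refine Finsupp.lhom_ext' fun σ => LinearMap.ext_ring ?_
  change t • edgeOp e (fermion (i + 1) (Finsupp.single σ 1)) =
    fermion (i + 1) (edgeOp e (Finsupp.single σ 1))
  rw [edgeOp_fermion_right (e₀ := e) fun _ _ => rfl, fermion_right_edgeOp (e₀ := e) fun _ _ => rfl,
    edgeBit_eq_true hi]
  cases edgeBit e (i - 1) <;> cases edgeBit e (i + 1) <;> cases σ.val i <;>
    cases σ.val (i + 1) <;>
    simp only [edgeWeight, bitSign, Bool.xor_true, Bool.xor_false, Bool.not_true, Bool.not_false,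
      reduceCtorEq, if_true, if_false, Finsupp.smul_single, smul_eq_mul, Finsupp.single_zero,
      smul_zero, mul_zero, zero_mul] <;>
    exact congrArg _ (by ring)

theorem edgeOp_insert_fermion {e : Finset ℤ} {i : ℤ} (hi : i ∉ e) (v : Fock) :
    edgeOp (insert i e) (fermion i v) - t • edgeOp e (fermion (i + 1) v) =
      fermion i (edgeOp (insert i e) v) - fermion (i + 1) (edgeOp e v) := by
  suffices h : edgeOp (insert i e) ∘ₗ fermion i - t • (edgeOp e ∘ₗ fermion (i + 1)) =
      fermion i ∘ₗ edgeOp (insert i e) - fermion (i + 1) ∘ₗ edgeOp e from LinearMap.congr_fun h v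
  refine Finsupp.lhom_ext' fun σ => LinearMap.ext_ring ?_
  change edgeOp (insert i e) (fermion i (Finsupp.single σ 1)) -
      t • edgeOp e (fermion (i + 1) (Finsupp.single σ 1)) =
    fermion i (edgeOp (insert i e) (Finsupp.single σ 1)) -
      fermion (i + 1) (edgeOp e (Finsupp.single σ 1))
  have he : ∀ j, j ≠ i → edgeBit (insert i e) j = edgeBit e j := by
    intro j hj
    simp [edgeBit, hj]
  rw [edgeOp_fermion_left he, edgeOp_fermion_right (e₀ := e) fun _ _ => rfl,
    fermion_left_edgeOp he, fermion_right_edgeOp (e₀ := e) fun _ _ => rfl,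
    edgeBit_eq_true (Finset.mem_insert_self i e), edgeBit_eq_false hi,
    ← sub_eq_zero]
  cases edgeBit e (i - 1) <;> cases edgeBit e (i + 1) <;> cases σ.val i <;>
    cases σ.val (i + 1) <;>
    simp only [edgeWeight, bitSign, Bool.xor_true, Bool.xor_false, Bool.not_true, Bool.not_false,
      reduceCtorEq, if_true, if_false, Finsupp.smul_single, smul_eq_mul, ← Finsupp.single_sub,
      ← Finsupp.single_neg, Finsupp.single_zero, smul_zero, mul_zero, zero_mul, sub_zero,
      zero_sub] <;>
    exact Finsupp.single_eq_zero.2 (by ring)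

/-! ### Hops and row configurations -/

/-- The horizontal edges with value one for a sequence of hops. -/
def hopEdges : List (ℤ × ℤ) → Finset ℤ
  | [] => ∅
  | p :: L => Finset.Ico p.1 p.2 ∪ hopEdges L

/-- The condition `i_1 < j_1 < i_2 < j_2 < ⋯`. -/
def IsHopList (L : List (ℤ × ℤ)) : Prop :=
  (∀ p ∈ L, p.1 < p.2) ∧ L.Pairwise fun p q => p.2 < q.1

theorem isHopList_cons {p : ℤ × ℤ} {L : List (ℤ × ℤ)} :
    IsHopList (p :: L) ↔ p.1 < p.2 ∧ (∀ q ∈ L, p.2 < q.1) ∧ IsHopList L := by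
  simp only [IsHopList, List.forall_mem_cons, List.pairwise_cons]
  tauto

theorem mem_hopEdges {L : List (ℤ × ℤ)} {i : ℤ} :
    i ∈ hopEdges L ↔ ∃ p ∈ L, p.1 ≤ i ∧ i < p.2 := by
  induction L with
  | nil => simp [hopEdges]
  | cons p L ih => simp [hopEdges, ih]

theorem lt_of_mem_hopEdges {p : ℤ × ℤ} {L : List (ℤ × ℤ)} (h : IsHopList (p :: L)) {i : ℤ}
    (hi : i ∈ hopEdges L) : p.2 < i := by
  obtain ⟨q, hq, hqi, _⟩ := mem_hopEdges.1 hi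
  exact ((isHopList_cons.1 h).2.1 q hq).trans_le hqi

theorem card_Ico_union {i j : ℤ} {e : Finset ℤ} (he : ∀ k ∈ e, j < k) :
    (Finset.Ico i j ∪ e).card = (j - i).toNat + e.card := by
  have hdisj : Disjoint (Finset.Ico i j) e := Finset.disjoint_left.2 fun k hk hke =>
    ((Finset.mem_Ico.1 hk).2.trans (he k hke)).false
  rw [Finset.card_union_of_disjoint hdisj, Int.card_Ico]

theorem card_hopEdges {L : List (ℤ × ℤ)} (h : IsHopList L) :
    ((hopEdges L).card : ℤ) = (L.map fun p => p.2 - p.1).sum := by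
  induction L with
  | nil => simp [hopEdges]
  | cons p L ih =>
    obtain ⟨hp, _, hL⟩ := isHopList_cons.1 h
    rw [hopEdges, card_Ico_union fun k => lt_of_mem_hopEdges h, List.map_cons, List.sum_cons,
      ← ih hL, Nat.cast_add, Int.toNat_of_nonneg (by omega)]

theorem Ico_union_inj {i j i' j' : ℤ} {e e' : Finset ℤ} (hij : i < j) (hij' : i' < j')
    (he : ∀ k ∈ e, j < k) (he' : ∀ k ∈ e', j' < k)
    (h : Finset.Ico i j ∪ e = Finset.Ico i' j' ∪ e') : i = i' ∧ j = j' ∧ e = e' := by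
  have hmem (k : ℤ) : (i ≤ k ∧ k < j) ∨ k ∈ e ↔ (i' ≤ k ∧ k < j') ∨ k ∈ e' := by
    simpa only [Finset.mem_union, Finset.mem_Ico] using Finset.ext_iff.1 h k
  have hi : i = i' := by grind [hmem i, hmem i']
  have hj : j = j' := by grind [hmem j, hmem j']
  exact ⟨hi, hj, by grind⟩

theorem exists_eq_Ico_union {e : Finset ℤ} (he : e.Nonempty) :
    ∃ i j, i < j ∧ ∃ e', (∀ k ∈ e', j < k) ∧ e = Finset.Ico i j ∪ e' := by
  set i := e.min' he
  have hi : i ∈ e := e.min'_mem he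
  have hgap : ∃ d : ℕ, i + d ∉ e := by
    obtain ⟨b, hb⟩ := e.bddAbove
    have hib := hb hi
    exact ⟨(b - i + 1).toNat, fun h => by have := hb h; omega⟩
  classical
  have hrun (k : ℤ) (hik : i ≤ k) (hk : k < i + Nat.find hgap) : k ∈ e := by
    have := Nat.find_min hgap (m := (k - i).toNat) (by omega)
    rwa [not_not, Int.toNat_of_nonneg (by omega), add_sub_cancel] at this
  have hpos : 0 < Nat.find hgap := by simpa [Nat.find_pos] using hi
  refine ⟨i, i + Nat.find hgap, by omega, e.filter (i + Nat.find hgap < ·), by simp, ?_⟩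
  ext k
  simp only [Finset.mem_union, Finset.mem_Ico, Finset.mem_filter]
  refine ⟨fun hk => ?_, fun hk => hk.elim (fun hk => hrun k hk.1 hk.2) And.left⟩
  have hik : i ≤ k := e.min'_le k hk
  have hne : k ≠ i + Nat.find hgap := fun h => Nat.find_spec hgap (h ▸ hk)
  grind

theorem hopEdges_cons_nonempty {p : ℤ × ℤ} {L : List (ℤ × ℤ)} (h : IsHopList (p :: L)) :
    (hopEdges (p :: L)).Nonempty :=
  ⟨p.1, mem_hopEdges.2 ⟨p, List.mem_cons_self, le_rfl, (isHopList_cons.1 h).1⟩⟩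

theorem hopEdges_injective {L L' : List (ℤ × ℤ)} (h : IsHopList L) (h' : IsHopList L')
    (he : hopEdges L = hopEdges L') : L = L' := by
  induction L generalizing L' with
  | nil =>
    cases L' with
    | nil => rfl
    | cons p' L' => exact absurd he.symm (hopEdges_cons_nonempty h').ne_empty
  | cons p L ih =>
    cases L' with
    | nil => exact absurd he (hopEdges_cons_nonempty h).ne_empty
    | cons p' L' =>
      obtain ⟨hp, _, hL⟩ := isHopList_cons.1 h
      obtain ⟨hp', _, hL'⟩ := isHopList_cons.1 h'
      obtain ⟨hfst, hsnd, htail⟩ := Ico_union_inj hp hp' (fun k => lt_of_mem_hopEdges h)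
        (fun k => lt_of_mem_hopEdges h') he
      rw [ih hL hL' htail, Prod.ext hfst hsnd]

theorem exists_hopList (e : Finset ℤ) : ∃ L, IsHopList L ∧ hopEdges L = e := by
  induction e using Finset.strongInduction with
  | H e ih =>
    rcases e.eq_empty_or_nonempty with rfl | hne
    · exact ⟨[], ⟨by simp, List.Pairwise.nil⟩, rfl⟩
    obtain ⟨i, j, hij, e', he', rfl⟩ := exists_eq_Ico_union hne
    have hss : e' ⊂ Finset.Ico i j ∪ e' := Finset.ssubset_iff.2 ⟨i, fun hi => by
      have := he' i hi
      omega, by simp [Finset.insert_subset_iff, hij]⟩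
    obtain ⟨L, hL, rfl⟩ := ih e' hss
    refine ⟨(i, j) :: L, isHopList_cons.2 ⟨hij, fun q hq => he' q.1 ?_, hL⟩, rfl⟩
    exact mem_hopEdges.2 ⟨q, hq, le_rfl, hL.1 q hq⟩

/-- Hop sequences of total length `m` correspond to row configurations with `m` edges. -/
def hopEquiv (m : ℕ) : HopSeq m ≃ {e : Finset ℤ // e.card = m} :=
  Equiv.ofBijective
    (fun L => ⟨hopEdges L.1, Int.natCast_inj.1 <|
      (card_hopEdges (L := L.1) ⟨L.2.1, L.2.2.1⟩).trans L.2.2.2⟩) <| by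
    refine ⟨fun L L' h => Subtype.ext <| hopEdges_injective ⟨L.2.1, L.2.2.1⟩
      ⟨L'.2.1, L'.2.2.1⟩ (congrArg Subtype.val h), fun ⟨e, he⟩ => ?_⟩
    obtain ⟨L, hL, rfl⟩ := exists_hopList e
    exact ⟨⟨L, hL.1, hL.2, by rw [← card_hopEdges hL, he]⟩, rfl⟩

theorem edgeBit_Ico (i j k : ℤ) : edgeBit (Finset.Ico i j) k = decide (i ≤ k ∧ k < j) := by
  simp only [edgeBit, Finset.mem_Ico]

theorem rowOut_Ico {σ : Maya} {i j : ℤ} (hij : i < j) (hi : σ.val i = true)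
    (hj : σ.val j = false) :
    rowOut (Finset.Ico i j) σ = (σ.set j true).set i false := by
  ext k
  rw [rowOut_val, Maya.set_val, Maya.set_val, edgeBit_Ico, edgeBit_Ico]
  grind

theorem rowWeight_Ico (σ : Maya) {i j : ℤ} (hij : i < j) : rowWeight (Finset.Ico i j) σ =
    (if σ.val i = true then t - 1 else 0) * (if σ.val j = true then 0 else 1) *
      ∏ k ∈ Finset.Ioo i j, (if σ.val k = true then -1 else t) := by
  have hsite (k : ℤ) : siteWeight (Finset.Ico i j) σ k =
      edgeWeight (decide (i ≤ k - 1 ∧ k - 1 < j)) (σ.val k) (decide (i ≤ k ∧ k < j)) := by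
    rw [siteWeight, edgeBit_Ico, edgeBit_Ico]
  have hsupp : Function.mulSupport (siteWeight (Finset.Ico i j) σ) ⊆
      ↑(insert i (insert j (Finset.Ioo i j))) := by
    intro k hk
    by_contra hc
    simp only [Finset.coe_insert, Finset.coe_Ioo, Set.mem_insert_iff, Set.mem_Ioo] at hc
    apply hk
    rw [hsite, decide_eq_false (by omega), decide_eq_false (by omega), edgeWeight_false_false]
  have hleft : siteWeight (Finset.Ico i j) σ i = if σ.val i = true then t - 1 else 0 := by
    rw [hsite, decide_eq_false (by omega), decide_eq_true (by omega)]
    cases σ.val i <;> simp [edgeWeight]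
  have hright : siteWeight (Finset.Ico i j) σ j = if σ.val j = true then 0 else 1 := by
    rw [hsite, decide_eq_true (by omega), decide_eq_false (by omega)]
    cases σ.val j <;> simp [edgeWeight]
  rw [rowWeight, finprod_eq_prod_of_mulSupport_subset _ hsupp, Finset.prod_insert (by grind),
    Finset.prod_insert (by simp), hleft, hright, ← mul_assoc]
  congr 1
  refine Finset.prod_congr rfl fun k hk => ?_
  rw [Finset.mem_Ioo] at hk
  rw [hsite, decide_eq_true (by omega), decide_eq_true (by omega)]
  cases σ.val k <;> simp [edgeWeight]

theorem Maya.onesAbove_eq_add_card (σ : Maya) {i j : ℤ} (hij : i ≤ j) :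
    σ.onesAbove i = σ.onesAbove j + {k ∈ Finset.Ioc i j | σ.val k = true}.card := by
  induction j, hij using Int.leInduction with
  | base => simp
  | succ j hij ih =>
    have hIoc : Finset.Ioc i (j + 1) = insert (j + 1) (Finset.Ioc i j) := by
      ext k
      simp only [Finset.mem_Ioc, Finset.mem_insert]
      omega
    rw [ih, Maya.onesAbove_eq_add_ite, hIoc, Finset.filter_insert]
    split_ifs
    · rw [Finset.card_insert_of_notMem (by simp)]
      ring
    · rw [add_zero]

theorem Maya.onesAbove_set_true (σ : Maya) {i j : ℤ} (hij : i < j) :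
    (σ.set j true).onesAbove i =
      σ.onesAbove j + 1 + {k ∈ Finset.Ioo i j | σ.val k = true}.card := by
  have habove : (σ.set j true).onesAbove j = σ.onesAbove j :=
    Maya.onesAbove_congr fun k hk => by rw [Maya.set_val, if_neg hk.ne']
  have hones : {k ∈ Finset.Ioc i j | (σ.set j true).val k = true} =
      insert j {k ∈ Finset.Ioo i j | σ.val k = true} := by
    ext k
    simp only [Finset.mem_filter, Finset.mem_insert, Finset.mem_Ioc, Finset.mem_Ioo, Maya.set_val]
    grind
  rw [Maya.onesAbove_eq_add_card _ hij.le, habove, hones, Finset.card_insert_of_notMem (by simp)]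
  ring

theorem pow_card_eq_neg_pow_mul_prod_ite (s : Finset ℤ) (p : ℤ → Prop) [DecidablePred p] :
    t ^ s.card = (-t) ^ {k ∈ s | p k}.card * ∏ k ∈ s, (if p k then -1 else t) := by
  rw [Finset.prod_ite, Finset.prod_const, Finset.prod_const, ← mul_assoc, ← mul_pow, neg_mul_neg,
    mul_one, ← pow_add, Finset.card_filter_add_card_filter_not]

theorem hop_eq_edgeOp (p : ℤ × ℤ) (hp : p.1 < p.2) :
    t ^ (p.2 - p.1).toNat • hop p = edgeOp (Finset.Ico p.1 p.2) := by
  refine Finsupp.lhom_ext' fun σ => LinearMap.ext_ring ?_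
  change t ^ (p.2 - p.1).toNat • hop p (Finsupp.single σ 1) =
    edgeOp (Finset.Ico p.1 p.2) (Finsupp.single σ 1)
  rw [edgeOp_single, one_mul, rowWeight_Ico σ hp, hop, LinearMap.smul_apply, Module.End.mul_apply,
    psiPlus, Finsupp.linearCombination_single, one_smul]
  by_cases h2 : σ.val p.2 = true
  · simp [h2]
  have h2' : σ.val p.2 = false := Bool.eq_false_of_not_eq_true h2
  rw [if_pos h2', if_neg h2, psiMinus, Finsupp.linearCombination_single, Maya.set_val,
    if_neg hp.ne, mul_one]
  by_cases h1 : σ.val p.1 = true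
  · have ht : t ≠ 0 := RatFunc.X_ne_zero
    have hcard : (p.2 - p.1).toNat = (Finset.Ioo p.1 p.2).card + 1 := by
      rw [Int.card_Ioo]
      omega
    rw [if_pos h1, if_pos h1, rowOut_Ico hp h1 h2', Finsupp.smul_single, Finsupp.smul_single,
      Finsupp.smul_single, σ.onesAbove_set_true hp, hcard, pow_succ,
      pow_card_eq_neg_pow_mul_prod_ite _ fun k => σ.val k = true]
    congr 1
    simp only [smul_eq_mul, pow_add, pow_one]
    have hnt : -t ≠ 0 := neg_ne_zero.2 ht
    field_simp
    ring
  · simp [h1]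

theorem edgeOp_empty : edgeOp ∅ = 1 := by
  refine Finsupp.lhom_ext' fun σ => LinearMap.ext_ring ?_
  change edgeOp ∅ (Finsupp.single σ 1) = Finsupp.single σ 1
  have hbit (k : ℤ) : edgeBit ∅ k = false := edgeBit_eq_false (Finset.notMem_empty k)
  have hout : rowOut ∅ σ = σ := by
    ext k
    rw [rowOut_val, hbit, hbit, Bool.false_xor, Bool.xor_false]
  have hweight : rowWeight ∅ σ = 1 := finprod_eq_one_of_forall_eq_one fun k => by
    rw [siteWeight, hbit, hbit, edgeWeight_false_false]
  rw [edgeOp_single, hout, hweight, one_mul]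

theorem edgeOp_mul {i j : ℤ} {e : Finset ℤ} (he : ∀ k ∈ e, j < k) :
    edgeOp (Finset.Ico i j) * edgeOp e = edgeOp (Finset.Ico i j ∪ e) := by
  refine Finsupp.lhom_ext' fun σ => LinearMap.ext_ring ?_
  change edgeOp (Finset.Ico i j) (edgeOp e (Finsupp.single σ 1)) =
    edgeOp (Finset.Ico i j ∪ e) (Finsupp.single σ 1)
  have hlow (k : ℤ) (hk : k ≤ j) : edgeBit e k = false :=
    edgeBit_eq_false fun h => (he k h).not_ge hk
  have hhigh (k : ℤ) (hk : j ≤ k) : edgeBit (Finset.Ico i j) k = false :=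
    edgeBit_eq_false fun h => (Finset.mem_Ico.1 h).2.not_ge hk
  have hunion (k : ℤ) :
      edgeBit (Finset.Ico i j ∪ e) k = (edgeBit (Finset.Ico i j) k || edgeBit e k) := by
    simp only [edgeBit, Finset.mem_union, Bool.decide_or]
  rw [edgeOp_single, edgeOp_single, edgeOp_single, one_mul, one_mul]
  congr 1
  · ext k
    rw [rowOut_val, rowOut_val, rowOut_val, hunion, hunion]
    rcases le_or_gt k j with hk | hk
    · rw [hlow k hk, hlow (k - 1) (by omega)]
      simp
    · rw [hhigh k hk.le, hhigh (k - 1) (by omega)]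
      simp
  · rw [rowWeight, rowWeight, rowWeight, ← finprod_mul_distrib
      (hasFiniteMulSupport_siteWeight _ _) (hasFiniteMulSupport_siteWeight _ _)]
    refine finprod_congr fun k => ?_
    rw [siteWeight, siteWeight, siteWeight, rowOut_val, hunion, hunion]
    rcases le_or_gt k j with hk | hk
    · rw [hlow k hk, hlow (k - 1) (by omega), edgeWeight_false_false]
      simp
    · rw [hhigh k hk.le, hhigh (k - 1) (by omega), edgeWeight_false_false]
      simp

theorem prod_hop_eq_edgeOp {L : List (ℤ × ℤ)} (h : IsHopList L) :
    t ^ (hopEdges L).card • (L.map hop).prod = edgeOp (hopEdges L) := by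
  induction L with
  | nil => rw [hopEdges, edgeOp_empty, Finset.card_empty, pow_zero, one_smul, List.map_nil,
      List.prod_nil]
  | cons p L ih =>
    obtain ⟨hp, _, hL⟩ := isHopList_cons.1 h
    have hlt (k : ℤ) (hk : k ∈ hopEdges L) : p.2 < k := lt_of_mem_hopEdges h hk
    rw [hopEdges, ← edgeOp_mul hlt, ← ih hL, ← hop_eq_edgeOp p hp, card_Ico_union hlt,
      List.map_cons, List.prod_cons, pow_add, smul_mul_smul_comm]

theorem transferTerms_eq_edgeOp (m : ℕ) (L : HopSeq m) :
    transferTerms m L = edgeOp (hopEquiv m L).1 := by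
  have h := prod_hop_eq_edgeOp (L := L.1) ⟨L.2.1, L.2.2.1⟩
  have hcard : (hopEdges L.1).card = m := (hopEquiv m L).2
  rwa [hcard] at h

/-! ### The transfer matrix as a sum over row configurations -/

theorem sumOp_apply {V : Type*} [AddCommGroup V] [Module K V] {I : Type*}
    {T : I → Module.End K V} (h : PointwiseFinite T) (v : V) : sumOp T v = ∑ᶠ i, T i v := by
  rw [sumOp, dif_pos h]
  rfl

theorem transferCoeff_eq_finsum (m : ℕ) (v : Fock) :
    transferCoeff m v = ∑ᶠ e : {e : Finset ℤ // e.card = m}, edgeOp e.1 v := by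
  rw [transferCoeff, sumOp_apply (transferTerms_pointwiseFinite m),
    ← finsum_comp_equiv (hopEquiv m)]
  exact finsum_congr fun L => by rw [transferTerms_eq_edgeOp]

theorem finite_support_edgeOp (m : ℕ) (v : Fock) :
    (Function.support fun e : {e : Finset ℤ // e.card = m} => edgeOp e.1 v).Finite := by
  have h := (transferTerms_pointwiseFinite m v).image (hopEquiv m)
  refine h.subset fun e he => ⟨(hopEquiv m).symm e, ?_, by simp⟩
  rw [Function.mem_support, transferTerms_eq_edgeOp]
  simpa using he

theorem eventually_transferCoeff_eq_sum (m : ℕ) (v : Fock) : ∀ᶠ S : Finset ℤ in Filter.atTop,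
    transferCoeff m v = ∑ e ∈ Finset.powersetCard m S, edgeOp e v := by
  have hfin := finite_support_edgeOp m v
  filter_upwards [Filter.eventually_ge_atTop (hfin.toFinset.biUnion Subtype.val)] with S hS
  rw [transferCoeff_eq_finsum, finsum_eq_sum_of_support_subset (s := hfin.toFinset) _ (by simp)]
  refine Finset.sum_of_injOn Subtype.val Subtype.val_injective.injOn (fun e he => ?_)
    (fun e he hne => ?_) fun _ _ => rfl
  · exact Finset.mem_powersetCard.2 ⟨(Finset.subset_biUnion_of_mem Subtype.val he).trans hS, e.2⟩
  · by_contra hc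
    exact hne ⟨⟨e, (Finset.mem_powersetCard.1 he).2⟩, by simpa using hc, rfl⟩

theorem transferCoeff_zero : transferCoeff 0 = 1 := by
  refine LinearMap.ext fun v => ?_
  obtain ⟨S, hS⟩ := (eventually_transferCoeff_eq_sum 0 v).exists
  rw [hS, Finset.powersetCard_zero, Finset.sum_singleton, edgeOp_empty]

theorem sum_powersetCard_succ_insert {α M : Type*} [DecidableEq α] [AddCommMonoid M] {i : α}
    {S : Finset α} (hi : i ∉ S) (m : ℕ) (f : Finset α → M) :
    ∑ e ∈ Finset.powersetCard (m + 1) (insert i S), f e =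
      ∑ e ∈ Finset.powersetCard (m + 1) S, f e +
        ∑ e ∈ Finset.powersetCard m S, f (insert i e) := by
  have hmem {k : ℕ} {e : Finset α} (he : e ∈ Finset.powersetCard k S) : i ∉ e := fun hc =>
    hi ((Finset.mem_powersetCard.1 he).1 hc)
  rw [Finset.powersetCard_succ_insert hi, Finset.sum_union, Finset.sum_image]
  · intro e he e' he' h
    rw [← Finset.erase_insert (hmem he), ← Finset.erase_insert (hmem he')]
    exact congrArg (Finset.erase · i) h
  · refine Finset.disjoint_left.2 fun e he he' => ?_
    obtain ⟨e', -, rfl⟩ := Finset.mem_image.1 he'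
    exact hmem he (Finset.mem_insert_self _ _)

theorem sum_powersetCard_edgeOp_fermion_succ {i : ℤ} {S : Finset ℤ} (m : ℕ) (v : Fock) :
    t • ∑ e ∈ Finset.powersetCard m (insert i S), edgeOp e (fermion (i + 1) v) -
        fermion (i + 1) (∑ e ∈ Finset.powersetCard m (insert i S), edgeOp e v) =
      t • ∑ e ∈ Finset.powersetCard m S, edgeOp e (fermion (i + 1) v) -
        fermion (i + 1) (∑ e ∈ Finset.powersetCard m S, edgeOp e v) := by
  simp only [map_sum, Finset.smul_sum, ← Finset.sum_sub_distrib]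
  refine (Finset.sum_subset (Finset.powersetCard_mono (Finset.subset_insert i S))
    fun e he hne => ?_).symm
  rw [Finset.mem_powersetCard] at he hne
  have hie : i ∈ e := by
    by_contra hie
    exact hne ⟨(Finset.subset_insert_iff_of_notMem hie).1 he.1, he.2⟩
  rw [edgeOp_comm_fermion_succ hie, sub_self]

theorem sum_powersetCard_edgeOp_fermion {i : ℤ} {S : Finset ℤ} (hi : i ∉ S) (m : ℕ) (v : Fock) :
    ∑ e ∈ Finset.powersetCard (m + 1) (insert i S), edgeOp e (fermion i v) -
        t • ∑ e ∈ Finset.powersetCard m (insert i S), edgeOp e (fermion (i + 1) v) =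
      fermion i (∑ e ∈ Finset.powersetCard (m + 1) (insert i S), edgeOp e v) -
        fermion (i + 1) (∑ e ∈ Finset.powersetCard m (insert i S), edgeOp e v) := by
  have hmem {k : ℕ} {e : Finset ℤ} (he : e ∈ Finset.powersetCard k S) : i ∉ e := fun hc =>
    hi ((Finset.mem_powersetCard.1 he).1 hc)
  have hcomm : ∑ e ∈ Finset.powersetCard (m + 1) S, edgeOp e (fermion i v) =
      fermion i (∑ e ∈ Finset.powersetCard (m + 1) S, edgeOp e v) := by
    rw [map_sum]
    exact Finset.sum_congr rfl fun e he => edgeOp_comm_fermion (hmem he) v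
  have hinsert : ∑ e ∈ Finset.powersetCard m S, edgeOp (insert i e) (fermion i v) -
      t • ∑ e ∈ Finset.powersetCard m S, edgeOp e (fermion (i + 1) v) =
      fermion i (∑ e ∈ Finset.powersetCard m S, edgeOp (insert i e) v) -
        fermion (i + 1) (∑ e ∈ Finset.powersetCard m S, edgeOp e v) := by
    simp only [map_sum, Finset.smul_sum, ← Finset.sum_sub_distrib]
    exact Finset.sum_congr rfl fun e he => edgeOp_insert_fermion (hmem he) v
  have hsucc := sum_powersetCard_edgeOp_fermion_succ (i := i) (S := S) m v
  rw [sum_powersetCard_succ_insert hi, sum_powersetCard_succ_insert hi, map_add, hcomm]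
  grind

theorem transferCoeff_fermion (m : ℕ) (i : ℤ) (v : Fock) :
    transferCoeff (m + 1) (fermion i v) - t • transferCoeff m (fermion (i + 1) v) =
      fermion i (transferCoeff (m + 1) v) - fermion (i + 1) (transferCoeff m v) := by
  obtain ⟨S, ⟨⟨h₁, h₂⟩, h₃, h₄⟩, hi⟩ :=
    ((((eventually_transferCoeff_eq_sum (m + 1) (fermion i v)).and
      (eventually_transferCoeff_eq_sum m (fermion (i + 1) v))).and
      ((eventually_transferCoeff_eq_sum (m + 1) v).and
        (eventually_transferCoeff_eq_sum m v))).and (Filter.eventually_ge_atTop {i})).exists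
  rw [h₁, h₂, h₃, h₄, ← Finset.insert_erase (Finset.singleton_subset_iff.1 hi)]
  exact sum_powersetCard_edgeOp_fermion (Finset.notMem_erase i S) m v

/-! ### The six-vertex model -/

theorem vertexWeight_eq (W N E S : Bool) : vertexWeight W N E S =
    if S = ((W.xor N).xor E) then
      (if E = true then PowerSeries.X else 1) * PowerSeries.C (edgeWeight W N E) else 0 := by
  cases W <;> cases N <;> cases E <;> cases S <;>
    simp [vertexWeight, edgeWeight, mul_comm]

theorem finprod_vertexWeight_rowOut (e : Finset ℤ) (σ : Maya) :
    ∏ᶠ i, vertexWeight (edgeBit e (i - 1)) (σ.val i) (edgeBit e i) ((rowOut e σ).val i) =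
      PowerSeries.X ^ e.card * PowerSeries.C (rowWeight e σ) := by
  have hsupp : Function.mulSupport
      (fun i => if edgeBit e i = true then (PowerSeries.X : K⟦X⟧) else 1) ⊆ e := by
    refine Function.mulSupport_subset_iff'.2 fun i hi => ?_
    rw [edgeBit_eq_false hi, if_neg Bool.false_ne_true]
  have hcard : ∏ᶠ i, (if edgeBit e i = true then (PowerSeries.X : K⟦X⟧) else 1) =
      PowerSeries.X ^ e.card := by
    rw [finprod_eq_prod_of_mulSupport_subset _ hsupp, ← Finset.prod_const]
    exact Finset.prod_congr rfl fun i hi => if_pos (edgeBit_eq_true hi)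
  have hsite := hasFiniteMulSupport_siteWeight e σ
  have hC : ∏ᶠ i, PowerSeries.C (siteWeight e σ i) = PowerSeries.C (rowWeight e σ) :=
    (MonoidHom.map_finprod (PowerSeries.C (R := K)).toMonoidHom hsite).symm
  have hsiteC : Function.HasFiniteMulSupport fun i => PowerSeries.C (siteWeight e σ i) :=
    hsite.subset (Function.mulSupport_comp_subset (map_one PowerSeries.C) _)
  rw [← hcard, ← hC, ← finprod_mul_distrib (e.finite_toSet.subset hsupp) hsiteC]
  exact finprod_congr fun i => by rw [vertexWeight_eq, if_pos (rowOut_val e σ i), siteWeight]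

theorem hasFiniteMulSupport_vertexWeight (e : Finset ℤ) (σ σ' : Maya) :
    Function.HasFiniteMulSupport fun i =>
      vertexWeight (edgeBit e (i - 1)) (σ.val i) (edgeBit e i) (σ'.val i) := by
  obtain ⟨a, ha⟩ := σ.left_one
  obtain ⟨a', ha'⟩ := σ'.left_one
  obtain ⟨b, hb⟩ := σ.right_zero
  obtain ⟨b', hb'⟩ := σ'.right_zero
  obtain ⟨c, hc⟩ := exists_forall_le_edgeBit_eq_false e
  obtain ⟨d, hd⟩ := exists_forall_ge_edgeBit_eq_false e
  refine (Set.finite_Ioo (min (min a a') c) (max (max b b') (d + 1))).subset fun i hi => ?_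
  by_contra hout
  rw [Set.mem_Ioo, not_and_or, not_lt, not_lt, le_min_iff, le_min_iff, max_le_iff,
    max_le_iff] at hout
  refine hi ?_
  beta_reduce
  rcases hout with ⟨⟨h, h'⟩, he⟩ | ⟨⟨h, h'⟩, he⟩
  · rw [ha i h, ha' i h', hc i he, hc (i - 1) (by omega), vertexWeight]
  · rw [hb i h, hb' i h', hd i (by omega), hd (i - 1) (by omega), vertexWeight]

theorem finprod_vertexWeight (e : Finset ℤ) (σ σ' : Maya) :
    ∏ᶠ i, vertexWeight (edgeBit e (i - 1)) (σ.val i) (edgeBit e i) (σ'.val i) =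
      PowerSeries.X ^ e.card * PowerSeries.C (edgeOp e (Finsupp.single σ 1) σ') := by
  rw [edgeOp_single, one_mul]
  by_cases h : σ' = rowOut e σ
  · rw [h, Finsupp.single_eq_same, finprod_vertexWeight_rowOut]
  · obtain ⟨i, hi⟩ : ∃ i, σ'.val i ≠ (rowOut e σ).val i := by
      by_contra! hc
      exact h (Maya.ext (funext hc))
    rw [Finsupp.single_eq_of_ne h, map_zero, mul_zero]
    refine finprod_eq_zero _ i ?_ (hasFiniteMulSupport_vertexWeight e σ σ')
    rw [vertexWeight_eq]
    exact if_neg hi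

theorem rowOut_injective (σ : Maya) : Function.Injective fun e => rowOut e σ := by
  intro e e' h
  by_contra hne
  have hD : (symmDiff e e').Nonempty := Finset.nonempty_iff_ne_empty.2 (mt symmDiff_eq_bot.1 hne)
  set i := (symmDiff e e').min' hD
  have hprev : i - 1 ∉ symmDiff e e' := fun hi =>
    absurd ((symmDiff e e').min'_le _ hi) (by omega)
  have hbit (k : ℤ) : edgeBit e k = edgeBit e' k ↔ k ∉ symmDiff e e' := by
    rw [edgeBit, edgeBit, decide_eq_decide, Finset.mem_symmDiff]
    tauto
  refine (hbit i).1 ?_ ((symmDiff e e').min'_mem hD)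
  have hval : (rowOut e σ).val i = (rowOut e' σ).val i := congrArg (fun τ => τ.val i) h
  rw [rowOut_val, rowOut_val, (hbit _).2 hprev] at hval
  exact Bool.xor_right_inj.1 hval

/-- Horizontal edge values with finitely many ones, as finite sets. -/
def rowEquiv : Finset ℤ ≃ {e : ℤ → Bool // {i : ℤ | e i = true}.Finite} where
  toFun e := ⟨edgeBit e, e.finite_toSet.subset fun i hi => of_decide_eq_true hi⟩
  invFun e := e.2.toFinset
  left_inv e := by
    ext i
    simp [edgeBit]
  right_inv e := by
    refine Subtype.ext (funext fun i => ?_)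
    simp [edgeBit]

theorem transfer_eq_rowPartition (σ σ' : Maya) :
    PowerSeries.mk (fun m => transferCoeff m (Finsupp.single σ 1) σ') = rowPartition σ σ' := by
  set w : Finset ℤ → K := fun e => edgeOp e (Finsupp.single σ 1) σ'
  have hrow : rowPartition σ σ' =
      ∑ᶠ e : Finset ℤ, PowerSeries.X ^ e.card * PowerSeries.C (w e) := by
    rw [rowPartition, ← finsum_comp_equiv rowEquiv]
    exact finsum_congr fun e => finprod_vertexWeight e σ σ'
  have hmem (e : Finset ℤ) (he : e ∈ Function.support w) : rowOut e σ = σ' := by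
    by_contra h
    refine he ?_
    change edgeOp e (Finsupp.single σ 1) σ' = 0
    rw [edgeOp_single, Finsupp.single_eq_of_ne (Ne.symm h)]
  have hfin : (Function.support w).Finite := Set.Subsingleton.finite fun e he e' he' =>
    rowOut_injective σ ((hmem e he).trans (hmem e' he').symm)
  have htransfer (m : ℕ) : transferCoeff m (Finsupp.single σ 1) σ' =
      ∑ᶠ e : {e : Finset ℤ // e.card = m}, w e.1 := by
    rw [transferCoeff_eq_finsum]
    exact AddMonoidHom.map_finsum (Finsupp.applyAddHom σ') (finite_support_edgeOp m _)
  ext m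
  have hcoeff : PowerSeries.coeff m (rowPartition σ σ') =
      ∑ᶠ e : Finset ℤ, if e.card = m then w e else 0 := by
    rw [hrow]
    refine (AddMonoidHom.map_finsum (PowerSeries.coeff (R := K) m).toAddMonoidHom
      (hfin.subset fun e he => ?_)).trans (finsum_congr fun e => ?_)
    · contrapose! he
      rw [Function.notMem_support] at he ⊢
      rw [he, map_zero, mul_zero]
    · change PowerSeries.coeff m (PowerSeries.X ^ e.card * PowerSeries.C (w e)) = _
      rw [PowerSeries.coeff_mul_C, PowerSeries.coeff_X_pow, ite_mul, one_mul, zero_mul]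
      simp only [eq_comm]
  rw [PowerSeries.coeff_mk, hcoeff, htransfer, finsum_subtype_eq_finsum_cond]
  exact finsum_congr fun e => finsum_eq_if

/-! ### The transfer matrix on the vacuum -/

theorem rowLen_bot (j : ℕ) : (⊥ : YoungDiagram).rowLen j = 0 := by
  by_contra h
  exact YoungDiagram.notMem_bot _ (YoungDiagram.mem_iff_lt_rowLen.2 (Nat.pos_of_ne_zero h))

theorem vacuum_val (c k : ℤ) : (Maya.ofPartition ⊥ c).val k = decide (k ≤ c) := by
  rw [Bool.eq_iff_iff, maya_val_eq_true_iff, decide_eq_true_iff]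
  simp only [rowLen_bot]
  constructor
  · rintro ⟨j, rfl⟩
    omega
  · exact fun h => ⟨(c - k).toNat, by omega⟩

theorem eq_vacuum {σ : Maya} {c : ℤ} (hle : ∀ k ≤ c, σ.val k = true)
    (hlt : ∀ k, c < k → σ.val k = false) : σ = Maya.ofPartition ⊥ c := by
  ext k
  rw [vacuum_val]
  rcases le_or_gt k c with h | h
  · rw [hle k h, decide_eq_true h]
  · rw [hlt k h, decide_eq_false h.not_ge]

theorem fermion_single_top {σ : Maya} {i : ℤ} (h : ∀ k, i ≤ k → σ.val k = false) :
    fermion i (Finsupp.single σ 1) = Finsupp.single (σ.set i true) 1 := by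
  rw [fermion_single, if_pos (h i le_rfl), Maya.onesAbove_eq_zero fun k hk => h k hk.le, pow_zero]

theorem vacuum_set_false_val {c i k : ℤ} (hk : c < k) :
    ((Maya.ofPartition ⊥ c).set i false).val k = false := by
  rw [Maya.set_val, vacuum_val, decide_eq_false hk.not_ge, ite_self]

theorem iota_vacuum_hole (b : ℕ) (c : ℤ) :
    iota (Finsupp.single ((Maya.ofPartition ⊥ c).set (c - b) false) 1) =
      Finsupp.single (c - 1) ((-1 : K) ^ b • eSymm b) := by
  induction b generalizing c with
  | zero =>
    have h : (Maya.ofPartition ⊥ c).set (c - (0 : ℕ)) false = Maya.ofPartition ⊥ (c - 1) := by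
      ext k
      simp only [Maya.set_val, vacuum_val]
      grind
    rw [h, iota_vacuum, pow_zero, one_smul, Nat.cast_zero, eSymm_zero]
  | succ b ih =>
    have hset : (Maya.ofPartition ⊥ c).set (c - (b + 1 : ℕ)) false =
        ((Maya.ofPartition ⊥ (c - 1)).set (c - 1 - b) false).set c true := by
      ext k
      simp only [Maya.set_val, vacuum_val]
      split_ifs
      all_goals first | rfl | omega | exact decide_eq_true (by omega) |
        exact decide_eq_decide.2 (by omega)
    rw [hset, ← fermion_single_top fun k hk => vacuum_set_false_val (by omega), iota_fermion, ih,
      bosonFermion_single, map_smul, show c - (c - 1 - 1) - 1 = 1 by ring,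
      vertexOp_complete_one_eSymm, pow_succ, mul_smul, neg_one_smul, sub_add_cancel, Nat.cast_succ]

theorem eq_Ico_of_mem_imp {c : ℤ} {e : Finset ℤ} (hne : e.Nonempty)
    (hright : ∀ k ≤ c, k - 1 ∈ e → k ∈ e) (hleft : ∀ k, c < k → k ∈ e → k - 1 ∈ e) :
    ∃ i j, i ≤ c ∧ c < j ∧ e = Finset.Ico i j := by
  obtain ⟨i, j, hij, e', he', rfl⟩ := exists_eq_Ico_union hne
  have hmem (k : ℤ) : k ∈ Finset.Ico i j ∪ e' ↔ (i ≤ k ∧ k < j) ∨ k ∈ e' := by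
    rw [Finset.mem_union, Finset.mem_Ico]
  simp only [hmem] at hright hleft
  have hjc : c < j := by
    by_contra! hjc
    have := hright j hjc (Or.inl (by omega))
    grind
  refine ⟨i, j, ?_, hjc, ?_⟩
  · by_contra! hci
    have := hleft i hci (Or.inl (by omega))
    grind
  · suffices e' = ∅ by rw [this, Finset.union_empty]
    by_contra! he'ne
    have hmin := e'.min'_mem he'ne
    have hprev := hleft _ (hjc.trans (he' _ hmin)) (Or.inr hmin)
    have hlow := e'.min'_le (e'.min' he'ne - 1)
    grind

theorem exists_eq_Ico_of_rowWeight_vacuum {c : ℤ} {e : Finset ℤ} (hne : e.Nonempty)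
    (h : rowWeight e (Maya.ofPartition ⊥ c) ≠ 0) : ∃ i j, i ≤ c ∧ c < j ∧ e = Finset.Ico i j := by
  have hsite (k : ℤ) : siteWeight e (Maya.ofPartition ⊥ c) k ≠ 0 := fun hk =>
    h (finprod_eq_zero _ k hk (hasFiniteMulSupport_siteWeight _ _))
  refine eq_Ico_of_mem_imp hne (fun k hk hprev => ?_) fun k hk hmem => ?_
  · by_contra hmem
    refine hsite k ?_
    rw [siteWeight, edgeBit_eq_true hprev, edgeBit_eq_false hmem, vacuum_val, decide_eq_true hk,
      edgeWeight]
  · by_contra hprev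
    refine hsite k ?_
    rw [siteWeight, edgeBit_eq_true hmem, edgeBit_eq_false hprev, vacuum_val,
      decide_eq_false hk.not_ge, edgeWeight]

theorem transferCoeff_vacuum (n : ℕ) (c : ℤ) :
    transferCoeff (n + 1) (Finsupp.single (Maya.ofPartition ⊥ c) 1) =
      ∑ b ∈ Finset.range (n + 1), edgeOp (Finset.Ico (c - (b : ℕ)) (c - b + (n + 1)))
        (Finsupp.single (Maya.ofPartition ⊥ c) 1) := by
  obtain ⟨S, hsum, hS⟩ := ((eventually_transferCoeff_eq_sum (n + 1) _).and
    (Filter.eventually_ge_atTop (Finset.Icc (c - n) (c + n + 1)))).exists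
  rw [hsum]
  refine (Finset.sum_of_injOn (fun b : ℕ => Finset.Ico (c - (b : ℤ)) (c - b + (n + 1)))
    (fun b _ b' _ h => ?_) (fun b hb => ?_) (fun e he hne => ?_) fun _ _ => rfl).symm
  · have h' := congrArg (fun e : Finset ℤ => (e : Set ℤ)) h
    simp only [Finset.coe_Ico] at h'
    have := ((Set.Ico_eq_Ico_iff (Or.inl (by omega))).1 h').1
    omega
  · rw [Finset.mem_coe, Finset.mem_range] at hb
    refine Finset.mem_powersetCard.2 ⟨fun k hk => hS ?_, by rw [Int.card_Ico]; omega⟩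
    rw [Finset.mem_Ico] at hk
    exact Finset.mem_Icc.2 (by omega)
  · have hcard := (Finset.mem_powersetCard.1 he).2
    by_contra hc
    have hweight : rowWeight e (Maya.ofPartition ⊥ c) ≠ 0 := by
      rintro h
      rw [edgeOp_single, h, mul_zero, Finsupp.single_zero] at hc
      exact hc rfl
    obtain ⟨i, j, hi, hj, rfl⟩ :=
      exists_eq_Ico_of_rowWeight_vacuum (Finset.card_pos.1 (by omega)) hweight
    rw [Int.card_Ico] at hcard
    refine hne ⟨(c - i).toNat, by rw [Finset.mem_coe, Finset.mem_range]; omega, ?_⟩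
    dsimp only
    congr 1 <;> omega

theorem rowWeight_vacuum {n b : ℕ} (hb : b ≤ n) (c : ℤ) :
    rowWeight (Finset.Ico (c - (b : ℕ)) (c - b + (n + 1))) (Maya.ofPartition ⊥ c) =
      (t - 1) * t ^ (n - b) * (-1) ^ b := by
  have hones : {k ∈ Finset.Ioo (c - (b : ℤ)) (c - b + (n + 1)) | k ≤ c} =
      Finset.Ioc (c - (b : ℤ)) c := by
    ext k
    simp only [Finset.mem_filter, Finset.mem_Ioo, Finset.mem_Ioc]
    omega
  have hzeros : {k ∈ Finset.Ioo (c - (b : ℤ)) (c - b + (n + 1)) | ¬k ≤ c} =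
      Finset.Ioo c (c - b + (n + 1)) := by
    ext k
    simp only [Finset.mem_filter, Finset.mem_Ioo]
    omega
  rw [rowWeight_Ico _ (by omega)]
  simp only [vacuum_val, decide_eq_true_iff]
  rw [if_pos (by omega), if_neg (by omega), mul_one, Finset.prod_ite, Finset.prod_const,
    Finset.prod_const, hones, hzeros, Int.card_Ioc, Int.card_Ioo,
    show (c - (c - (b : ℤ))).toNat = b by omega,
    show (c - (b : ℤ) + (n + 1) - c - 1).toNat = n - b by omega]
  ring

theorem iota_edgeOp_vacuum {n b : ℕ} (hb : b ≤ n) (c : ℤ) :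
    iota (edgeOp (Finset.Ico (c - (b : ℕ)) (c - b + (n + 1)))
        (Finsupp.single (Maya.ofPartition ⊥ c) 1)) =
      Finsupp.single c ((t - 1) • t ^ (n - b) • vertexOp complete ((n : ℤ) - b + 1) (eSymm b)) := by
  have hout : rowOut (Finset.Ico (c - (b : ℕ)) (c - b + (n + 1))) (Maya.ofPartition ⊥ c) =
      ((Maya.ofPartition ⊥ c).set (c - b) false).set (c - b + (n + 1)) true := by
    rw [rowOut_Ico (by omega) (by rw [vacuum_val, decide_eq_true (by omega)])
      (by rw [vacuum_val, decide_eq_false (by omega)])]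
    exact Maya.ext (Function.update_comm (by omega) _ _ _)
  rw [edgeOp_single, one_mul, hout, rowWeight_vacuum hb, ← Finsupp.smul_single_one,
    ← fermion_single_top fun k hk => vacuum_set_false_val (by omega), map_smul, iota_fermion,
    iota_vacuum_hole, bosonFermion_single, map_smul, Finsupp.smul_single, sub_add_cancel,
    show c - b + (n + 1) - (c - 1) - 1 = (n : ℤ) - b + 1 by ring, smul_smul, smul_smul, mul_assoc,
    ← mul_pow, neg_one_mul, neg_neg, one_pow, mul_one]

theorem onBoson_single (f : Module.End K Lam) (c : ℤ) (g : Lam) :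
    onBoson f (Finsupp.single c g) = Finsupp.single c (f g) :=
  Finsupp.mapRange_single (hf := map_zero f)

/-- Multiplication by `gSymm m` on `⨁_c z ^ c ⊗ Λ(t)`, the bosonic form of `A_m(t)`. -/
abbrev mulGSymm (m : ℕ) : Module.End K Boson := onBoson (LinearMap.mulLeft K (gSymm m))

theorem mulGSymm_bosonFermion (m : ℕ) (i : ℤ) (w : Boson) :
    mulGSymm (m + 1) (bosonFermion i w) - t • mulGSymm m (bosonFermion (i + 1) w) =
      bosonFermion i (mulGSymm (m + 1) w) - bosonFermion (i + 1) (mulGSymm m w) := by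
  induction w using Finsupp.induction_linear with
  | zero => simp
  | add v w hv hw =>
    simp only [map_add, smul_add]
    rw [add_sub_add_comm, add_sub_add_comm, hv, hw]
  | single c f =>
    have h := vertexOp_mul_gSymm complete (i - c - 1) (m + 1) f
    rw [add_sub_cancel_right] at h
    simp only [bosonFermion_single, onBoson_single, LinearMap.mulLeft_apply, Finsupp.smul_single,
      ← Finsupp.single_sub]
    rw [show i + 1 - c - 1 = i - c - 1 + 1 by ring, Nat.cast_succ]
    exact congrArg (Finsupp.single (c + 1)) (by grind)

theorem iota_transferCoeff_vacuum (m : ℕ) (c : ℤ) :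
    iota (transferCoeff (m + 1) (Finsupp.single (Maya.ofPartition ⊥ c) 1)) =
      mulGSymm (m + 1) (iota (Finsupp.single (Maya.ofPartition ⊥ c) 1)) := by
  rw [iota_vacuum, onBoson_single, LinearMap.mulLeft_apply, mul_one, transferCoeff_vacuum, map_sum,
    Nat.cast_succ, gSymm_eq_sum_hooks, Finset.smul_sum, Finsupp.single_finsetSum]
  exact Finset.sum_congr rfl fun b hb =>
    iota_edgeOp_vacuum (Nat.lt_succ_iff.1 (Finset.mem_range.1 hb)) c

/-! ### The transfer matrix as a multiplication operator -/

theorem Maya.set_set_of_val_eq {σ : Maya} {i : ℤ} {a : Bool} (h : σ.val i = a) (b : Bool) :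
    (σ.set i b).set i a = σ := by
  ext k
  rw [Maya.set_val, Maya.set_val]
  split_ifs with hk
  · rw [hk, h]
  · rfl

theorem Maya.IsEnumeration.set_false {σ : Maya} {b : ℕ → ℤ} {c : ℤ} {N : ℕ}
    (h : σ.IsEnumeration b c (N + 1)) :
    (σ.set (b 0) false).IsEnumeration (fun j => b (j + 1)) (c - 1) N where
  strictAnti _ _ hij := h.strictAnti (Nat.succ_lt_succ hij)
  val_eq_true_iff i := by
    have hne (j : ℕ) : b (j + 1) ≠ b 0 := (h.strictAnti j.succ_pos).ne
    rw [Maya.set_val]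
    split_ifs with hi
    · simp [hi, hne]
    · rw [h.val_eq_true_iff]
      constructor
      · rintro ⟨_ | j, rfl⟩
        · exact absurd rfl hi
        · exact ⟨j, rfl⟩
      · rintro ⟨j, rfl⟩
        exact ⟨j + 1, rfl⟩
  eq_of_le j hj := by
    rw [h.eq_of_le (j + 1) (Nat.succ_le_succ hj)]
    push_cast
    ring

theorem Maya.IsEnumeration.eq_vacuum {σ : Maya} {b : ℕ → ℤ} {c : ℤ} (h : σ.IsEnumeration b c 0) :
    σ = Maya.ofPartition ⊥ c := by
  have hb (j : ℕ) : b j = c - j := h.eq_of_le j j.zero_le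
  refine HallLittlewoodIce.eq_vacuum (fun k hk => (h.val_eq_true_iff k).2 ⟨(c - k).toNat, ?_⟩)
    fun k hk => ?_
  · rw [hb]
    omega
  · by_contra hne
    obtain ⟨j, rfl⟩ := (h.val_eq_true_iff k).1 (by simpa using hne)
    have := hb j
    omega

theorem Maya.induction_on_top {P : Maya → Prop} (vacuum : ∀ c, P (Maya.ofPartition ⊥ c))
    (insert : ∀ σ i, (∀ k, i ≤ k → σ.val k = false) → P σ → P (σ.set i true)) (σ : Maya) : P σ := by
  obtain ⟨b, c, N, h⟩ := σ.exists_isEnumeration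
  induction N generalizing σ b c with
  | zero => exact h.eq_vacuum ▸ vacuum c
  | succ N ih =>
    have htop (k : ℤ) (hk : b 0 ≤ k) : (σ.set (b 0) false).val k = false := by
      by_contra hne
      obtain ⟨j, rfl⟩ := (h.set_false.val_eq_true_iff k).1 (by simpa using hne)
      exact (h.strictAnti j.succ_pos).not_ge hk
    have hσ := insert _ _ htop (ih _ _ _ h.set_false)
    rwa [Maya.set_set_of_val_eq ((h.val_eq_true_iff _).2 ⟨0, rfl⟩)] at hσ

theorem iota_transferCoeff_succ_set_true {m : ℕ} {σ : Maya} {i : ℤ}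
    (hm : ∀ v, iota (transferCoeff m v) = mulGSymm m (iota v))
    (htop : ∀ k, i ≤ k → σ.val k = false)
    (hσ : iota (transferCoeff (m + 1) (Finsupp.single σ 1)) =
      mulGSymm (m + 1) (iota (Finsupp.single σ 1))) :
    iota (transferCoeff (m + 1) (Finsupp.single (σ.set i true) 1)) =
      mulGSymm (m + 1) (iota (Finsupp.single (σ.set i true) 1)) := by
  have hfermion := congrArg iota (transferCoeff_fermion m i (Finsupp.single σ 1))
  have hboson := mulGSymm_bosonFermion m i (iota (Finsupp.single σ 1))
  rw [map_sub, map_sub, map_smul, iota_fermion, iota_fermion, hm, hm, hσ, iota_fermion, ← hboson,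
    ← iota_fermion, ← iota_fermion, fermion_single_top htop] at hfermion
  exact sub_left_inj.1 hfermion

theorem iota_transferCoeff (m : ℕ) (v : Fock) :
    iota (transferCoeff m v) = mulGSymm m (iota v) := by
  induction m generalizing v with
  | zero =>
    rw [transferCoeff_zero, Module.End.one_apply, mulGSymm, Nat.cast_zero, gSymm_zero,
      LinearMap.mulLeft_one]
    exact Finsupp.mapRange_id _ |>.symm
  | succ m ih =>
    have hmap : iota ∘ₗ transferCoeff (m + 1) = mulGSymm (m + 1) ∘ₗ iota :=
      Finsupp.lhom_ext' fun σ => LinearMap.ext_ring <|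
        σ.induction_on_top (iota_transferCoeff_vacuum m) fun _ _ htop hσ =>
          iota_transferCoeff_succ_set_true ih htop hσ
    exact LinearMap.congr_fun hmap v

/-! ### The correspondence is an isomorphism -/

theorem fermion_apply (i : ℤ) (w : Fock) (τ : Maya) :
    fermion i w τ = w.sum fun σ a => a * fermion i (Finsupp.single σ 1) τ := by
  simp only [fermion_single]
  rw [fermion, Finsupp.linearCombination_apply, Finsupp.sum, Finsupp.finsetSum_apply]
  rfl

theorem exists_eq_set_true_of_fermion_apply_ne_zero {i : ℤ} {w : Fock} {τ : Maya}
    (h : fermion i w τ ≠ 0) : ∃ σ ∈ w.support, σ.val i = false ∧ τ = σ.set i true := by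
  rw [fermion_apply] at h
  obtain ⟨σ, hσ, hne⟩ := Finset.exists_ne_zero_of_sum_ne_zero h
  have hτ := right_ne_zero_of_mul hne
  rw [fermion_single] at hτ
  split_ifs at hτ with hi
  · refine ⟨σ, hσ, hi, ?_⟩
    by_contra hc
    exact hτ (Finsupp.single_eq_of_ne hc)
  · exact absurd rfl hτ

theorem fermion_apply_set_true {i : ℤ} {σ : Maya} (hi : σ.val i = false) (w : Fock) :
    fermion i w (σ.set i true) = w σ * (-1) ^ σ.onesAbove i := by
  rw [fermion_apply, Finsupp.sum_eq_single σ, fermion_single, if_pos hi, Finsupp.single_eq_same]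
  · intro σ' _ hne
    rw [fermion_single]
    split_ifs with hi'
    · rw [Finsupp.single_eq_of_ne, mul_zero]
      intro h
      refine hne ?_
      rw [← Maya.set_set_of_val_eq hi' true, ← h, Maya.set_set_of_val_eq hi]
    · rw [Finsupp.zero_apply, mul_zero]
  · intro
    exact zero_mul _

/-- The number of empty positions below `M`, on which injectivity of `ι_t` is proved by
induction. -/
def Maya.holesBelow (σ : Maya) (M : ℤ) : ℕ := {k : ℤ | k < M ∧ σ.val k = false}.ncard

theorem Maya.holesBelow_set_true_lt {σ : Maya} {M i : ℤ} (hM : i < M) (hi : σ.val i = false) :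
    (σ.set i true).holesBelow M < σ.holesBelow M := by
  obtain ⟨a, ha⟩ := σ.left_one
  have hfin : {k : ℤ | k < M ∧ σ.val k = false}.Finite := by
    refine (Set.finite_Ioo a M).subset fun k hk => ⟨lt_of_not_ge fun hka => ?_, hk.1⟩
    exact Bool.true_eq_false_eq_False ((ha k hka).symm.trans hk.2)
  refine Set.ncard_lt_ncard (Set.ssubset_iff_exists.2 ⟨fun k hk => ⟨hk.1, ?_⟩, i, ⟨hM, hi⟩, ?_⟩)
    hfin
  · have hk' := hk.2
    rw [Maya.set_val] at hk'
    split_ifs at hk'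
    exact hk'
  · rintro ⟨-, h⟩
    rw [Maya.set_val, if_pos rfl] at h
    exact Bool.true_eq_false_eq_False h

theorem eq_zero_of_iota_eq_zero_of_support_subset_vacuum {c : ℤ} {w : Fock}
    (hw : w.support ⊆ {Maya.ofPartition ⊥ c}) (h : iota w = 0) : w = 0 := by
  obtain ⟨a, rfl⟩ := Finsupp.support_subset_singleton'.1 hw
  rw [← Finsupp.smul_single_one, map_smul, iota_vacuum, Finsupp.smul_single] at h
  rw [(smul_eq_zero.1 (Finsupp.single_eq_zero.1 h)).resolve_right one_ne_zero,
    Finsupp.single_zero]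

theorem eq_zero_of_iota_eq_zero {M : ℤ} {n : ℕ} {w : Fock}
    (htop : ∀ σ ∈ w.support, ∀ k, M ≤ k → σ.val k = false)
    (hholes : ∀ σ ∈ w.support, σ.holesBelow M < n) (h : iota w = 0) : w = 0 := by
  induction n generalizing w with
  | zero =>
    refine Finsupp.support_eq_empty.1 (Finset.eq_empty_of_forall_notMem fun σ hσ => ?_)
    exact Nat.not_lt_zero _ (hholes σ hσ)
  | succ n ih =>
    suffices hfull : ∀ σ ∈ w.support, ∀ i < M, σ.val i = true by
      refine eq_zero_of_iota_eq_zero_of_support_subset_vacuum (c := M - 1) (fun σ hσ => ?_) h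
      exact Finset.mem_singleton.2 <| eq_vacuum (fun k hk => hfull σ hσ k (by omega))
        fun k hk => htop σ hσ k (by omega)
    intro σ hσ i hi
    by_contra hne
    have hfill : fermion i w = 0 := by
      refine ih (fun τ hτ k hk => ?_) (fun τ hτ => ?_) (by rw [iota_fermion, h, map_zero])
      all_goals obtain ⟨σ', hσ', hi', rfl⟩ :=
        exists_eq_set_true_of_fermion_apply_ne_zero (Finsupp.mem_support_iff.1 hτ)
      · rw [Maya.set_val, if_neg (by omega), htop σ' hσ' k hk]
      · exact (Maya.holesBelow_set_true_lt hi hi').trans_le (Nat.lt_succ_iff.1 (hholes σ' hσ'))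
    have hcoeff := fermion_apply_set_true (σ := σ) (by simpa using hne) w
    rw [hfill, Finsupp.zero_apply, zero_eq_mul] at hcoeff
    exact Finsupp.mem_support_iff.1 hσ
      (hcoeff.resolve_right (pow_ne_zero _ (neg_ne_zero.2 one_ne_zero)))

theorem iota_injective : Function.Injective iota := by
  rw [← LinearMap.ker_eq_bot, LinearMap.ker_eq_bot']
  intro w hw
  choose b hb using Maya.right_zero
  obtain ⟨M, hM⟩ := (w.support.image b).bddAbove
  refine eq_zero_of_iota_eq_zero (M := M) (n := w.support.sup (·.holesBelow M) + 1)
    (fun σ hσ k hk => hb σ k ((hM ?_).trans hk))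
    (fun σ hσ => Nat.lt_succ_of_le (Finset.le_sup (f := (·.holesBelow M)) hσ)) hw
  exact Finset.mem_coe.2 (Finset.mem_image_of_mem b hσ)

theorem gCoeff_ne_zero (r : ℕ+) : gCoeff r ≠ 0 :=
  div_ne_zero (one_sub_t_pow_ne_zero r.pos) (by exact_mod_cast r.ne_zero)

theorem eq_top_of_gSymm_mem {A : Subalgebra K Lam} (h : ∀ m : ℕ, gSymm m ∈ A) : A = ⊤ := by
  have hcoeff (m : ℕ) : PowerSeries.coeff m gSeries ∈ A := gSymm_natCast m ▸ h m
  have hX (n : ℕ) : (MvPolynomial.X n.succPNat : Lam) ∈ A := by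
    induction n using Nat.strong_induction_on with
    | _ n ih =>
      set c : K := ((n : K) + 1) * -gCoeff n.succPNat
      have hc : c ≠ 0 := mul_ne_zero (by exact_mod_cast n.succ_ne_zero)
        (neg_ne_zero.2 (gCoeff_ne_zero _))
      have hrec := expPos_recursion (fun r => -(gCoeff r • (MvPolynomial.X r : Lam))) n
      rw [Finset.Nat.sum_antidiagonal_eq_sum_range_succ_mk, Finset.sum_range_succ, Nat.sub_self,
        coeff_zero_expPos, mul_one, ← neg_smul, smul_smul, ← sub_eq_iff_eq_add'] at hrec
      rw [← inv_smul_smul₀ hc (MvPolynomial.X n.succPNat : Lam), ← hrec]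
      refine A.smul_mem (A.sub_mem (A.smul_mem (hcoeff _) _) (A.sum_mem fun k hk => ?_)) _
      exact A.smul_mem (A.mul_mem
        (A.neg_mem (A.smul_mem (ih k (Finset.mem_range.1 hk)) _)) (hcoeff _)) _
  rw [eq_top_iff, ← MvPolynomial.adjoin_range_X, Algebra.adjoin_le_iff]
  rintro _ ⟨r, rfl⟩
  exact PNat.succPNat_natPred r ▸ hX r.natPred

theorem mulLeft_preserves_range_iota {c : ℤ} {f : Lam}
    (hf : Finsupp.single c f ∈ LinearMap.range iota) (g : Lam) :
    Finsupp.single c (g * f) ∈ LinearMap.range iota := by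
  let A : Subalgebra K Lam :=
    { carrier := {g | ∀ f, Finsupp.single c f ∈ LinearMap.range iota →
        Finsupp.single c (g * f) ∈ LinearMap.range iota}
      mul_mem' := fun {g g'} hg hg' f hf => by
        rw [mul_assoc]
        exact hg _ (hg' _ hf)
      add_mem' := fun {g g'} hg hg' f hf => by
        rw [add_mul, Finsupp.single_add]
        exact Submodule.add_mem _ (hg _ hf) (hg' _ hf)
      algebraMap_mem' := fun a f hf => by
        rw [← Algebra.smul_def, ← Finsupp.smul_single]
        exact Submodule.smul_mem _ _ hf }
  have hA : A = ⊤ := by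
    refine eq_top_of_gSymm_mem fun m f hf => ?_
    obtain ⟨v, hv⟩ := hf
    refine ⟨transferCoeff m v, ?_⟩
    rw [iota_transferCoeff, hv, onBoson_single, LinearMap.mulLeft_apply]
  have hg : g ∈ A := hA ▸ Algebra.mem_top
  exact hg f hf

theorem iota_surjective : Function.Surjective iota := by
  rw [← LinearMap.range_eq_top, eq_top_iff, ← Finsupp.iSup_lsingle_range, iSup_le_iff]
  rintro c _ ⟨g, rfl⟩
  have h := mulLeft_preserves_range_iota ⟨_, iota_vacuum c⟩ g
  rwa [mul_one] at h

theorem iota_bijective : Function.Bijective iota := ⟨iota_injective, iota_surjective⟩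

/-! ### Partial fractions -/

/-- The variables `y` with `y_p` removed, in the order in which `Equiv.Perm.decomposeFin` lists
them. -/
def removeVar {α : Type*} {n : ℕ} (y : Fin (n + 1) → α) (p : Fin (n + 1)) (j : Fin n) : α :=
  y (Equiv.swap 0 p j.succ)

section RemoveVar

variable {α M : Type*} {n : ℕ} {y : Fin (n + 1) → α}

theorem removeVar_injective (hy : Function.Injective y) (p : Fin (n + 1)) :
    Function.Injective (removeVar y p) :=
  hy.comp ((Equiv.swap 0 p).injective.comp (Fin.succ_injective n))

theorem removeVar_ne (hy : Function.Injective y) (p : Fin (n + 1)) (j : Fin n) :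
    removeVar y p j ≠ y p := by
  intro h
  rw [removeVar, hy.eq_iff, Equiv.swap_apply_eq_iff, Equiv.swap_apply_right] at h
  exact Fin.succ_ne_zero j h

theorem exists_removeVar_eq (y : Fin (n + 1) → α) {p q : Fin (n + 1)} (h : q ≠ p) :
    ∃ j, removeVar y p j = y q := by
  have hne : Equiv.swap 0 p q ≠ 0 := by
    rwa [Ne, Equiv.swap_apply_eq_iff, Equiv.swap_apply_left]
  obtain ⟨j, hj⟩ := Fin.exists_succ_eq.2 hne
  exact ⟨j, by rw [removeVar, hj, Equiv.swap_apply_self]⟩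

@[to_additive]
theorem prod_removeVar [CommMonoid M] (y : Fin (n + 1) → α) (p : Fin (n + 1)) (g : α → M) :
    g (y p) * ∏ j, g (removeVar y p j) = ∏ i, g (y i) := by
  rw [← Equiv.prod_comp (Equiv.swap 0 p) fun i => g (y i), Fin.prod_univ_succ,
    Equiv.swap_apply_left]
  rfl

end RemoveVar

section LinearFactors

open Polynomial

variable {R : Type*} [CommRing R]

theorem natDegree_one_sub_C_mul_X_le (a : R) : (1 - C a * X).natDegree ≤ 1 :=
  (natDegree_sub_le _ _).trans
    (max_le (natDegree_one.trans_le zero_le_one) ((natDegree_C_mul_le a _).trans natDegree_X_le))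

theorem natDegree_prod_one_sub_C_mul_X_le {m : ℕ} (z : Fin m → R) :
    (∏ i, (1 - C (z i) * X)).natDegree ≤ m := by
  have hle := Finset.sum_le_card_nsmul Finset.univ (fun i => (1 - C (z i) * X).natDegree) 1
    fun i _ => natDegree_one_sub_C_mul_X_le (z i)
  rw [Finset.card_univ, Fintype.card_fin, smul_eq_mul, mul_one] at hle
  exact (natDegree_prod_le _ _).trans hle

theorem coeff_prod_one_sub_C_mul_X {m : ℕ} (z : Fin m → R) :
    (∏ i, (1 - C (z i) * X)).coeff m = ∏ i, -z i := by
  have h := coeff_prod_of_natDegree_le (s := Finset.univ) (f := fun i : Fin m => 1 - C (z i) * X)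
    1 fun i _ => natDegree_one_sub_C_mul_X_le (z i)
  rw [Finset.card_univ, Fintype.card_fin, mul_one] at h
  refine h.trans (Finset.prod_congr rfl fun i _ => ?_)
  rw [coeff_sub, coeff_C_mul_X, if_pos rfl, coeff_one, if_neg one_ne_zero, zero_sub]

theorem eval_inv_prod_one_sub_C_mul_X {F : Type*} [Field F] {a : F} (ha : a ≠ 0) {m : ℕ}
    (z : Fin m → F) :
    (∏ i, (1 - C (z i) * X)).eval a⁻¹ = ∏ i, (a - z i) * a⁻¹ := by
  rw [eval_prod]
  refine Finset.prod_congr rfl fun i _ => ?_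
  rw [eval_sub, eval_one, eval_C_mul, eval_X, sub_mul, mul_inv_cancel₀ ha]

end LinearFactors

section PartialFractions

variable {F : Type*} [Field F] {n : ℕ} {y : Fin (n + 1) → F}

/-- The product `∏_{j ≠ p} (y_p - s y_j) / (y_p - y_j)`, up to the factor `1 - s` the coefficient
of `1 / (1 - y_p x)` in the partial fraction decomposition of `∏ (1 - s y_i x) / (1 - y_i x)`. -/
def residue (s : F) (y : Fin (n + 1) → F) (p : Fin (n + 1)) : F :=
  ∏ j, (y p - s * removeVar y p j) / (y p - removeVar y p j)

theorem prod_sub_mul_inv_eq_residue (s : F) (hy : Function.Injective y) {p : Fin (n + 1)}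
    (hp : y p ≠ 0) : ∏ i, (y p - s * y i) * (y p)⁻¹ =
      (1 - s) * residue s y p * ∏ j, (y p - removeVar y p j) * (y p)⁻¹ := by
  rw [← prod_removeVar y p fun z => (y p - s * z) * (y p)⁻¹, residue, mul_assoc (1 - s),
    ← Finset.prod_mul_distrib]
  congr 1
  · rw [sub_mul, mul_assoc, mul_inv_cancel₀ hp, mul_one]
  · refine Finset.prod_congr rfl fun j _ => ?_
    rw [← mul_assoc, div_mul_cancel₀ _ (sub_ne_zero.2 (removeVar_ne hy p j).symm)]

section

open Polynomial

theorem degree_prod_sub_lt (s : F) (y : Fin n → F) :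
    (∏ i, (1 - C (s * y i) * X) - C (s ^ n) * ∏ i, (1 - C (y i) * X)).degree < n := by
  refine degree_lt_iff_coeff_zero _ _ |>.2 fun m hm => ?_
  rw [coeff_sub, coeff_C_mul]
  rcases hm.eq_or_lt with rfl | hm
  · rw [coeff_prod_one_sub_C_mul_X, coeff_prod_one_sub_C_mul_X]
    simp only [← mul_neg]
    rw [Finset.prod_mul_distrib, Finset.prod_const, Finset.card_univ, Fintype.card_fin, sub_self]
  · rw [coeff_eq_zero_of_natDegree_lt ((natDegree_prod_one_sub_C_mul_X_le _).trans_lt hm),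
      coeff_eq_zero_of_natDegree_lt ((natDegree_prod_one_sub_C_mul_X_le _).trans_lt hm), mul_zero,
      sub_zero]

theorem degree_sum_C_mul_prod_lt (c : Fin (n + 1) → F) (y : Fin (n + 1) → F) :
    (∑ p, C (c p) * ∏ j, (1 - C (removeVar y p j) * X)).degree < (n + 1 : ℕ) := by
  refine degree_lt_iff_coeff_zero _ _ |>.2 fun m hm => ?_
  rw [finsetSum_coeff]
  refine Finset.sum_eq_zero fun p _ => ?_
  rw [coeff_C_mul, coeff_eq_zero_of_natDegree_lt
    ((natDegree_prod_one_sub_C_mul_X_le _).trans_lt hm), mul_zero]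

theorem partial_fractions (s : F) (hy : Function.Injective y) (h0 : ∀ i, y i ≠ 0) :
    ∏ i, (1 - C (s * y i) * X) = C (s ^ (n + 1)) * ∏ i, (1 - C (y i) * X) +
      ∑ p, C ((1 - s) * residue s y p) * ∏ j, (1 - C (removeVar y p j) * X) := by
  rw [← sub_eq_iff_eq_add']
  refine eq_of_degrees_lt_of_eval_index_eq Finset.univ (inv_injective.comp hy).injOn ?_ ?_
    fun k _ => ?_
  · rw [Finset.card_univ, Fintype.card_fin]
    exact degree_prod_sub_lt s y
  · rw [Finset.card_univ, Fintype.card_fin]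
    exact degree_sum_C_mul_prod_lt _ y
  have hvanish : ∏ i, (y k - y i) * (y k)⁻¹ = 0 :=
    Finset.prod_eq_zero (Finset.mem_univ k) (by rw [sub_self, zero_mul])
  simp only [Function.comp_apply, eval_sub, eval_C_mul, eval_finsetSum,
    eval_inv_prod_one_sub_C_mul_X (h0 k)]
  rw [hvanish, mul_zero, sub_zero, prod_sub_mul_inv_eq_residue s hy (h0 k),
    Finset.sum_eq_single k]
  · intro p _ hp
    obtain ⟨j, hj⟩ := exists_removeVar_eq y hp.symm
    rw [Finset.prod_eq_zero (Finset.mem_univ j) (by rw [hj, sub_self, zero_mul]), mul_zero]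
  · exact fun hk => absurd (Finset.mem_univ k) hk

theorem sum_residue (s : F) (hy : Function.Injective y) (h0 : ∀ i, y i ≠ 0) :
    ∑ p, (1 - s) * residue s y p = 1 - s ^ (n + 1) := by
  have h := congrArg (eval 0) (partial_fractions s hy h0)
  simp only [eval_add, eval_C_mul, eval_prod, eval_sub, eval_one, eval_X, eval_finsetSum, mul_zero,
    sub_zero, Finset.prod_const_one, mul_one] at h
  exact eq_sub_of_add_eq' h.symm

end

section

open PowerSeries

theorem one_sub_mul_geometric {R : Type*} [CommRing R] (a : R) :
    (1 - C a * X) * mk (fun n => a ^ n) = 1 := by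
  have h := congrArg (rescale a) (mk_one_mul_one_sub_eq_one R)
  simpa only [map_mul, map_sub, map_one, rescale_X, rescale_mk, Pi.one_apply, mul_one,
    mul_comm] using h

theorem prod_one_sub_eq_mul_prod (s : F) (hy : Function.Injective y) (h0 : ∀ i, y i ≠ 0) :
    ∏ i, (1 - C (s * y i) * X) = (C (s ^ (n + 1)) +
      ∑ p, C ((1 - s) * residue s y p) * mk fun m => y p ^ m) * ∏ i, (1 - C (y i) * X) := by
  have h := congrArg (Polynomial.coeToPowerSeries.ringHom (R := F)) (partial_fractions s hy h0)
  simp only [map_add, map_mul, map_prod, map_sum, map_sub, map_one,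
    Polynomial.coeToPowerSeries.ringHom_apply, Polynomial.coe_C, Polynomial.coe_X] at h
  simp only [map_mul, map_sub, map_one]
  rw [h, add_mul, Finset.sum_mul]
  refine congrArg _ (Finset.sum_congr rfl fun p _ => ?_)
  rw [← prod_removeVar y p fun z => 1 - C z * X]
  linear_combination (-(1 - C s) * C (residue s y p) * ∏ j, (1 - C (removeVar y p j) * X)) *
    one_sub_mul_geometric (y p)

end

end PartialFractions

/-! ### Hall-Littlewood sums -/

section HallLittlewoodSum

variable {F : Type*} [Field F]

/-- The sum `∑_{w ∈ S_n} w (y ^ a ∏_{i<j} (y_i - s y_j) / (y_i - y_j))`, at `s = t` and `a = λ` the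
one in the definition of the Hall-Littlewood function. -/
def hlSum {n : ℕ} (s : F) (a : Fin n → ℕ) (y : Fin n → F) : F :=
  ∑ w : Equiv.Perm (Fin n), (∏ i, y (w i) ^ a i) *
    ∏ i, ∏ j ∈ Finset.Ioi i, (y (w i) - s * y (w j)) / (y (w i) - y (w j))

theorem hlSum_succ {n : ℕ} (s : F) (a : Fin (n + 1) → ℕ) (y : Fin (n + 1) → F) :
    hlSum s a y =
      ∑ p, y p ^ a 0 * residue s y p * hlSum s (fun i => a i.succ) (removeVar y p) := by
  rw [hlSum, ← Equiv.sum_comp Equiv.Perm.decomposeFin.symm, Fintype.sum_prod_type]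
  refine Finset.sum_congr rfl fun p _ => ?_
  rw [hlSum, Finset.mul_sum]
  refine Finset.sum_congr rfl fun e _ => ?_
  simp only [Fin.prod_univ_succ (n := n), Fin.prod_Ioi_zero, Fin.prod_Ioi_succ,
    Equiv.Perm.decomposeFin_symm_apply_zero, Equiv.Perm.decomposeFin_symm_apply_succ]
  rw [residue, ← Equiv.prod_comp e fun j => (y p - s * removeVar y p j) / (y p - removeVar y p j)]
  simp only [removeVar]
  ring

theorem hlSum_zero {n : ℕ} {s : F} (hs : s ≠ 1) {y : Fin n → F} (hy : Function.Injective y)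
    (h0 : ∀ i, y i ≠ 0) :
    hlSum s (fun _ => 0) y = ∏ i ∈ Finset.range n, (1 - s ^ (i + 1)) / (1 - s) := by
  induction n with
  | zero => simp [hlSum]
  | succ n ih =>
    rw [hlSum_succ, Finset.prod_range_succ, ← sum_residue s hy h0, ← Finset.mul_sum,
      mul_div_cancel_left₀ _ (sub_ne_zero.2 hs.symm), Finset.mul_sum]
    refine Finset.sum_congr rfl fun p _ => ?_
    rw [ih (removeVar_injective hy p) fun j => h0 _, pow_zero, one_mul, mul_comm]

end HallLittlewoodSum

/-! ### Vertex operators in finitely many variables -/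

section Evaluation

variable {F : Type*} [Field F] [Algebra K F] {n : ℕ}

/-- The evaluation `f ↦ f(y_1, …, y_n)` of symmetric functions, that is `p_r ↦ ∑ i, y_i ^ r`. -/
def evalVars (y : Fin n → F) : Lam →ₐ[K] F :=
  MvPolynomial.aeval fun r : ℕ+ => ∑ i, y i ^ (r : ℕ)

theorem evalVars_X (y : Fin n → F) (r : ℕ+) :
    evalVars y (MvPolynomial.X r) = ∑ i, y i ^ (r : ℕ) :=
  MvPolynomial.aeval_X _ r

theorem expPos_gCoeff_sum_pow_mul {R ι : Type*} [CommRing R] [Algebra K R] (s : Finset ι)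
    (y : ι → R) :
    expPos (fun r : ℕ+ => gCoeff r • ∑ i ∈ s, y i ^ (r : ℕ)) *
        ∏ i ∈ s, (1 - PowerSeries.C (y i) * PowerSeries.X) =
      ∏ i ∈ s, (1 - PowerSeries.C (t • y i) * PowerSeries.X) := by
  classical
  induction s using Finset.induction_on with
  | empty =>
    simp only [Finset.sum_empty, smul_zero, Finset.prod_empty, mul_one]
    exact expPos_zero
  | insert i s hi ih =>
    simp only [Finset.sum_insert hi, Finset.prod_insert hi, smul_add]
    rw [← ih, ← expPos_gCoeff_pow_mul]
    have hadd := expPos_add (fun r : ℕ+ => gCoeff r • y i ^ (r : ℕ))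
      fun r : ℕ+ => gCoeff r • ∑ j ∈ s, y j ^ (r : ℕ)
    linear_combination hadd * ((1 - PowerSeries.C (y i) * PowerSeries.X) *
      ∏ j ∈ s, (1 - PowerSeries.C (y j) * PowerSeries.X))

theorem map_evalVars_qSeries {y : Fin (n + 1) → F} (hy : Function.Injective y)
    (h0 : ∀ i, y i ≠ 0) :
    PowerSeries.map (evalVars y : Lam →+* F) qSeries = PowerSeries.C (algebraMap K F t ^ (n + 1)) +
      ∑ p, PowerSeries.C ((1 - algebraMap K F t) * residue (algebraMap K F t) y p) *
        PowerSeries.mk fun m => y p ^ m := by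
  have hne : ∏ i, (1 - PowerSeries.C (y i) * PowerSeries.X) ≠ 0 :=
    Finset.prod_ne_zero_iff.2 fun i _ =>
      left_ne_zero_of_mul_eq_one (one_sub_mul_geometric (y i))
  refine mul_right_cancel₀ hne ?_
  rw [← prod_one_sub_eq_mul_prod _ hy h0, qSeries, map_expPos]
  simp only [map_smul, evalVars_X, ← Algebra.smul_def]
  exact expPos_gCoeff_sum_pow_mul _ y

theorem evalVars_qSymm {y : Fin (n + 1) → F} (hy : Function.Injective y) (h0 : ∀ i, y i ≠ 0)
    {m : ℕ} (hm : 0 < m) : evalVars y (qSymm m) =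
      ∑ p, (1 - algebraMap K F t) * residue (algebraMap K F t) y p * y p ^ m := by
  have h := congrArg (PowerSeries.coeff m) (map_evalVars_qSeries hy h0)
  rw [PowerSeries.coeff_map, map_add, PowerSeries.coeff_C, if_neg hm.ne', zero_add, map_sum] at h
  rw [qSymm_natCast]
  refine h.trans (Finset.sum_congr rfl fun p _ => ?_)
  rw [PowerSeries.coeff_C_mul, PowerSeries.coeff_mk]

theorem eval₂_tau (y : Fin (n + 1) → F) (p : Fin (n + 1)) (f : Lam) :
    (tau f).eval₂ (evalVars y : Lam →+* F) (y p) = evalVars (removeVar y p) f := by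
  have h : (Polynomial.aevalTower (evalVars y) (y p)).comp tau = evalVars (removeVar y p) := by
    refine MvPolynomial.algHom_ext fun r => ?_
    rw [AlgHom.comp_apply, shift_X, map_add, map_smul, map_pow, Polynomial.aevalTower_C,
      Polynomial.aevalTower_X, evalVars_X, evalVars_X, ← sum_removeVar y p fun z => z ^ (r : ℕ),
      neg_smul, one_smul, add_neg_cancel_comm]
  exact DFunLike.congr_fun h f

theorem evalVars_vertexOp_qSymm {y : Fin (n + 1) → F} (hy : Function.Injective y)
    (h0 : ∀ i, y i ≠ 0) {m : ℕ} (hm : 0 < m) (f : Lam) :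
    evalVars y (vertexOp qSymm m f) = ∑ p, (1 - algebraMap K F t) *
      residue (algebraMap K F t) y p * y p ^ m * evalVars (removeVar y p) f := by
  simp only [← eval₂_tau]
  rw [vertexOp_apply]
  induction tau f using Polynomial.induction_on' with
  | add P Q hP hQ =>
    rw [map_add, map_add, hP, hQ, ← Finset.sum_add_distrib]
    refine Finset.sum_congr rfl fun p _ => ?_
    rw [Polynomial.eval₂_add, mul_add]
  | monomial k a =>
    rw [umbralEval_monomial, map_mul, ← Nat.cast_add, evalVars_qSymm hy h0 (by omega),
      Finset.mul_sum]
    refine Finset.sum_congr rfl fun p _ => ?_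
    rw [Polynomial.eval₂_monomial, pow_add, RingHom.coe_coe]
    ring

theorem algebraMap_vPoly (m : ℕ) : algebraMap K F (vPoly m) =
    ∏ i ∈ Finset.range m, (1 - algebraMap K F t ^ (i + 1)) / (1 - algebraMap K F t) := by
  simp only [vPoly, map_prod, map_div₀, map_sub, map_one, map_pow]

theorem one_sub_t_ne_zero : (1 : K) - t ≠ 0 := by
  simpa using one_sub_t_pow_ne_zero one_pos

theorem vPoly_ne_zero (m : ℕ) : vPoly m ≠ 0 :=
  Finset.prod_ne_zero_iff.2 fun i _ =>
    div_ne_zero (one_sub_t_pow_ne_zero i.succ_pos) one_sub_t_ne_zero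

theorem evalVars_prod_vertexOp (L : List ℕ) (hL : ∀ k ∈ L, 0 < k) (hn : L.length ≤ n)
    {y : Fin n → F} (hy : Function.Injective y) (h0 : ∀ i, y i ≠ 0) :
    evalVars y ((L.map fun k : ℕ => vertexOp qSymm (k : ℤ)).prod 1) =
      algebraMap K F ((1 - t) ^ L.length / vPoly (n - L.length)) *
        hlSum (algebraMap K F t) (fun i => L.getD i 0) y := by
  induction L generalizing n with
  | nil =>
    have ht : algebraMap K F t ≠ 1 := fun h =>
      one_sub_t_ne_zero (sub_eq_zero.2 ((algebraMap K F).injective (h.trans (map_one _).symm)).symm)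
    simp only [List.map_nil, List.prod_nil, Module.End.one_apply, map_one, List.length_nil,
      pow_zero, List.getD_nil, Nat.sub_zero]
    rw [hlSum_zero ht hy h0, ← algebraMap_vPoly, ← map_mul, one_div_mul_cancel (vPoly_ne_zero n),
      map_one]
  | cons k L ih =>
    obtain ⟨n, rfl⟩ := Nat.exists_eq_add_one.2 ((Nat.succ_pos _).trans_le hn)
    rw [List.map_cons, List.prod_cons, Module.End.mul_apply,
      evalVars_vertexOp_qSymm hy h0 (hL k List.mem_cons_self), hlSum_succ, Finset.mul_sum]
    refine Finset.sum_congr rfl fun p _ => ?_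
    rw [ih (fun l hl => hL l (List.mem_cons_of_mem _ hl)) (Nat.le_of_succ_le_succ hn)
      (removeVar_injective hy p) fun j => h0 _]
    simp only [List.length_cons, Nat.add_sub_add_right, Fin.val_zero, List.getD_cons_zero,
      Fin.val_succ, List.getD_cons_succ, pow_succ, map_div₀, map_mul, map_sub, map_one]
    ring

end Evaluation

theorem yVar_injective (n : ℕ) : Function.Injective (yVar n) :=
  (IsFractionRing.injective (MvPolynomial (Fin n) K) _).comp MvPolynomial.X_injective

theorem yVar_ne_zero (n : ℕ) (i : Fin n) : yVar n i ≠ 0 := fun h =>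
  MvPolynomial.X_ne_zero i (IsFractionRing.injective (MvPolynomial (Fin n) K)
    (FractionRing (MvPolynomial (Fin n) K)) (h.trans (map_zero _).symm))

theorem constRat_eq (n : ℕ) (a : K) : constRat n a = algebraMap K _ a :=
  (IsScalarTower.algebraMap_apply K (MvPolynomial (Fin n) K) _ a).symm

theorem algebraMap_restrictVars (n : ℕ) (q : Lam) :
    algebraMap (MvPolynomial (Fin n) K) (FractionRing (MvPolynomial (Fin n) K))
      (restrictVars n q) = evalVars (yVar n) q := by
  have h : (IsScalarTower.toAlgHom K (MvPolynomial (Fin n) K)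
      (FractionRing (MvPolynomial (Fin n) K))).comp (restrictVars n) = evalVars (yVar n) := by
    refine MvPolynomial.algHom_ext fun r => ?_
    rw [evalVars_X]
    simp [restrictVars, MvPolynomial.psum, yVar]
  exact DFunLike.congr_fun h q

theorem getD_rowLens (lam : YoungDiagram) (i : ℕ) : lam.rowLens.getD i 0 = lam.rowLen i := by
  rcases lt_or_ge i (lam.colLen 0) with h | h
  · rw [List.getD_eq_getElem _ _ (h.trans_eq lam.length_rowLens.symm), YoungDiagram.get_rowLens]
  · rw [List.getD_eq_default _ _ (lam.length_rowLens.trans_le h), maya_rowLen_zero lam h]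

theorem isHallLittlewoodQ_prod_vertexOp (lam : YoungDiagram) :
    IsHallLittlewoodQ lam ((lam.rowLens.map fun k : ℕ => vertexOp qSymm (k : ℤ)).prod 1) := by
  intro n hn
  rw [algebraMap_restrictVars, evalVars_prod_vertexOp _ (fun k hk => lam.pos_of_mem_rowLens k hk)
    (lam.length_rowLens.trans_le hn) (yVar_injective n) (yVar_ne_zero n),
    YoungDiagram.length_rowLens, hallLittlewoodQ, constRat_eq, constRat_eq, hlSum]
  simp only [getD_rowLens]

/-! ### Transport along the correspondence -/

theorem onBoson_apply (f : Module.End K Lam) (w : Boson) (c : ℤ) : onBoson f w c = f (w c) := rfl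

/-- The algebra map `f ↦ 1 ⊗ f`. -/
def onBosonHom : Module.End K Lam →ₐ[K] Module.End K Boson where
  toFun := onBoson
  map_one' := Finsupp.mapRange.linearMap_id
  map_mul' f g := Finsupp.mapRange.linearMap_comp f g
  map_zero' := LinearMap.ext fun _ => Finsupp.ext fun _ => rfl
  map_add' _ _ := LinearMap.ext fun _ => Finsupp.ext fun _ => rfl
  commutes' _ := LinearMap.ext fun _ => Finsupp.ext fun _ => rfl

/-- The correspondence as a linear equivalence. -/
def iotaEquiv : Fock ≃ₗ[K] Boson := LinearEquiv.ofBijective iota iota_bijective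

/-- The algebra map that sends `f` to the operator on `Fock` that corresponds to `1 ⊗ f`. -/
def pullback : Module.End K Lam →ₐ[K] Module.End K Fock :=
  (iotaEquiv.symm.conjAlgEquiv K : Module.End K Boson →ₐ[K] Module.End K Fock).comp onBosonHom

theorem iota_pullback (f : Module.End K Lam) (v : Fock) :
    iota (pullback f v) = onBoson f (iota v) :=
  iotaEquiv.apply_symm_apply _

theorem eq_pullback {T : Module.End K Fock} {f : Module.End K Lam}
    (h : ∀ v, iota (T v) = onBoson f (iota v)) : T = pullback f :=
  LinearMap.ext fun v => iota_injective ((h v).trans (iota_pullback f v).symm)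

theorem onBoson_comp_iota (f : Module.End K Lam) : onBoson f ∘ₗ iota = iota ∘ₗ pullback f :=
  LinearMap.ext fun v => (iota_pullback f v).symm

section Forms

open LinearMap (IsAdjointPair)

theorem bosonForm_single (c : ℤ) (f : Lam) (w : Boson) :
    bosonForm (Finsupp.single c f) w = tForm f (w c) := by
  simp [bosonForm]

theorem isAdjointPair_onBoson {f g : Module.End K Lam} (h : IsAdjointPair tForm tForm f g) :
    IsAdjointPair bosonForm bosonForm (onBoson f) (onBoson g) := by
  intro v w
  induction v using Finsupp.induction_linear with
  | zero => simp only [map_zero, LinearMap.zero_apply]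
  | add v v' hv hv' =>
    rw [map_add, map_add, map_add, LinearMap.add_apply, LinearMap.add_apply, hv, hv']
  | single c a => rw [onBoson_single, bosonForm_single, bosonForm_single, onBoson_apply, h]

theorem isAdjointPair_pullback {f g : Module.End K Lam} (h : IsAdjointPair tForm tForm f g) :
    IsAdjointPair fockForm fockForm (pullback f) (pullback g) := by
  intro v w
  simp only [fockForm, LinearMap.compl₁₂_apply, iota_pullback]
  exact isAdjointPair_onBoson h _ _

theorem fockForm_separatingRight : fockForm.SeparatingRight := by
  refine fun w h => iota_injective ?_
  rw [map_zero]
  ext1 c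
  refine tForm_separatingRight _ fun f => ?_
  obtain ⟨v, hv⟩ := iota_surjective (Finsupp.single c f)
  rw [← bosonForm_single, ← hv]
  exact h v

end Forms

section Sums

variable {I : Type*} {S : I → Module.End K Lam}

theorem PointwiseFinite.onBoson (h : PointwiseFinite S) :
    PointwiseFinite fun i => onBoson (S i) := by
  intro w
  refine (Set.Finite.biUnion w.support.finite_toSet fun c _ => h (w c)).subset fun i hi => ?_
  obtain ⟨c, hc⟩ := Finsupp.ne_iff.1 hi
  refine Set.mem_biUnion (x := c) (Finsupp.mem_support_iff.2 fun h0 => hc ?_) hc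
  rw [onBoson_apply, h0, map_zero, Finsupp.zero_apply]

theorem PointwiseFinite.pullback (h : PointwiseFinite S) :
    PointwiseFinite fun i => pullback (S i) := by
  intro v
  refine (h.onBoson (iota v)).subset fun i hi h0 => hi (iota_injective ?_)
  rw [iota_pullback, map_zero]
  exact h0

theorem sumOp_pullback (h : PointwiseFinite S) :
    sumOp (fun i => pullback (S i)) = pullback (sumOp S) := by
  refine eq_pullback fun v => Finsupp.ext fun c => ?_
  let coord : Fock →ₗ[K] Lam := Finsupp.lapply c ∘ₗ iota
  have hcoord (i : I) : coord (pullback (S i) v) = S i (iota v c) :=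
    DFunLike.congr_fun (iota_pullback (S i) v) c
  calc iota (sumOp (fun i => pullback (S i)) v) c
      = coord (∑ᶠ i, pullback (S i) v) := by rw [sumOp_apply h.pullback]; rfl
    _ = ∑ᶠ i, coord (pullback (S i) v) := coord.toAddMonoidHom.map_finsum (h.pullback v)
    _ = ∑ᶠ i, S i (iota v c) := finsum_congr hcoord
    _ = onBoson (sumOp S) (iota v) c := by rw [onBoson_apply, sumOp_apply h]

end Sums

/-! ### The transfer matrix, its inverse and the adjoints -/

/-- The operator on `Fock` that corresponds to the multiplication by a symmetric function. -/
def mulFock : Lam →ₐ[K] Module.End K Fock := pullback.comp (Algebra.lmul K Lam)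

theorem transferCoeff_eq (m : ℕ) : transferCoeff m = mulFock (PowerSeries.coeff m gSeries) := by
  rw [← gSymm_natCast]
  exact eq_pullback (iota_transferCoeff m)

theorem transfer_eq_map :
    transfer = PowerSeries.map (mulFock : Lam →+* Module.End K Fock) gSeries :=
  PowerSeries.ext fun m => by
    rw [transfer, PowerSeries.coeff_mk, PowerSeries.coeff_map, transferCoeff_eq, RingHom.coe_coe]

/-- The power series `A(x;t)` as a unit. -/
def transferUnit : (Module.End K Fock)⟦X⟧ˣ where
  val := transfer
  inv := PowerSeries.map (mulFock : Lam →+* Module.End K Fock) qSeries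
  val_inv := by rw [transfer_eq_map, ← map_mul, mul_comm, qSeries_mul_gSeries, map_one]
  inv_val := by rw [transfer_eq_map, ← map_mul, qSeries_mul_gSeries, map_one]

theorem transferInvCoeff_eq (m : ℕ) :
    transferInvCoeff m = mulFock (PowerSeries.coeff m qSeries) := by
  have h : transferInv = PowerSeries.map (mulFock : Lam →+* Module.End K Fock) qSeries :=
    Ring.inverse_unit transferUnit
  rw [transferInvCoeff, h, PowerSeries.coeff_map, RingHom.coe_coe]

theorem isAdjointPair_transferCoeff (m : ℕ) :
    LinearMap.IsAdjointPair fockForm fockForm (transferCoeff m) (pullback (shiftCoeff (-1) m)) := by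
  have h := isAdjointPair_mulLeft_expPos (-1) m
  simp only [neg_one_mul, neg_smul] at h
  rw [transferCoeff_eq]
  exact isAdjointPair_pullback h

theorem isAdjointPair_transferInvCoeff (m : ℕ) :
    LinearMap.IsAdjointPair fockForm fockForm (transferInvCoeff m) (pullback (shiftCoeff 1 m)) := by
  have h := isAdjointPair_mulLeft_expPos 1 m
  simp only [one_mul] at h
  rw [transferInvCoeff_eq]
  exact isAdjointPair_pullback h

theorem transferAdj_eq (m : ℕ) : transferAdj m = pullback (shiftCoeff (-1) m) :=
  adjointOp_eq fockForm_separatingRight (isAdjointPair_transferCoeff m)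

theorem transferInvAdj_eq (m : ℕ) : transferInvAdj m = pullback (shiftCoeff 1 m) :=
  adjointOp_eq fockForm_separatingRight (isAdjointPair_transferInvCoeff m)

/-! ### Jing's vertex operators -/

section Laurent

variable {m : ℤ}

theorem snd_injective_of_sub_eq :
    Function.Injective fun p : {p : ℕ × ℕ // (p.1 : ℤ) - (p.2 : ℤ) = m} => p.1.2 := by
  intro p q (h : p.1.2 = q.1.2)
  refine Subtype.ext (Prod.ext (Nat.cast_injective (R := ℤ) ?_) h)
  rw [sub_eq_iff_eq_add.1 p.2, sub_eq_iff_eq_add.1 q.2, h]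

theorem finsum_sub_eq {M : Type*} [AddCommMonoid M] {f : ℤ → ℕ → M}
    (hf : ∀ r < 0, ∀ s, f r s = 0) :
    ∑ᶠ p : {p : ℕ × ℕ // (p.1 : ℤ) - (p.2 : ℤ) = m}, f p.1.1 p.1.2 =
      ∑ᶠ s : ℕ, f (m + s) s := by
  have hfst (p : {p : ℕ × ℕ // (p.1 : ℤ) - (p.2 : ℤ) = m}) : (p.1.1 : ℤ) = m + p.1.2 :=
    sub_eq_iff_eq_add.1 p.2
  simp only [hfst]
  rw [← finsum_mem_range (f := fun s : ℕ => f (m + s) s) snd_injective_of_sub_eq, finsum_mem_def,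
    Set.indicator_eq_self.2]
  intro s hs
  have hms : 0 ≤ m + s := not_lt.1 fun h => hs (hf _ h s)
  exact ⟨⟨((m + s).toNat, s), by rw [Int.toNat_of_nonneg hms, add_sub_cancel_right]⟩, rfl⟩

theorem pointwiseFinite_laurentTerms_shiftCoeff (a : ℕ → Module.End K Lam) (ε : K) :
    PointwiseFinite (laurentTerms a (shiftCoeff ε) m) := by
  intro f
  refine Set.Finite.of_finite_image ((Set.finite_Iic (shift ε f).natDegree).subset ?_)
    snd_injective_of_sub_eq.injOn
  rintro _ ⟨p, hp, rfl⟩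
  refine Set.mem_Iic.2 (not_lt.1 fun hc => hp ?_)
  change a p.1.1 (shiftCoeff ε p.1.2 f) = 0
  rw [shiftCoeff_apply, Polynomial.coeff_eq_zero_of_natDegree_lt hc, map_zero]

end Laurent

theorem phiMinusTerms_eq (m : ℤ) : phiMinusTerms m = laurentTerms
    (fun r => LinearMap.mulLeft K (PowerSeries.coeff r qSeries)) (shiftCoeff (-1)) m := by
  have hmul (r : ℕ) := coeff_expSeries_pMul gCoeff r
  have hadj (s : ℕ) := coeff_expSeries_pAdj (-1) s
  simp only [neg_one_mul] at hadj
  funext p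
  exact congrArg₂ _ (hmul p.1.1) (hadj p.1.2)

theorem phiPlusTerms_eq (m : ℤ) : phiPlusTerms m = laurentTerms
    (fun r => LinearMap.mulLeft K (PowerSeries.coeff r gSeries)) (shiftCoeff 1) m := by
  have hmul (r : ℕ) := coeff_expSeries_pMul (-gCoeff) r
  have hadj (s : ℕ) := coeff_expSeries_pAdj 1 s
  simp only [Pi.neg_apply, neg_smul] at hmul
  simp only [one_mul] at hadj
  funext p
  exact congrArg₂ _ (hmul p.1.1) (hadj p.1.2)

theorem pointwiseFinite_phiMinusTerms (m : ℤ) : PointwiseFinite (phiMinusTerms m) := by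
  rw [phiMinusTerms_eq]
  exact pointwiseFinite_laurentTerms_shiftCoeff _ _

theorem pointwiseFinite_phiPlusTerms (m : ℤ) : PointwiseFinite (phiPlusTerms m) := by
  rw [phiPlusTerms_eq]
  exact pointwiseFinite_laurentTerms_shiftCoeff _ _

theorem psiModeTerms_eq (m : ℤ) : psiModeTerms m = fun p => pullback (phiMinusTerms m p) := by
  funext p
  rw [phiMinusTerms_eq, laurentTerms, map_mul, ← transferAdj_eq, psiModeTerms, laurentTerms,
    transferInvCoeff_eq]
  rfl

theorem psiPlusModeTerms_eq (m : ℤ) :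
    psiPlusModeTerms m = fun p => pullback (phiPlusTerms m p) := by
  funext p
  rw [phiPlusTerms_eq, laurentTerms, map_mul, ← transferInvAdj_eq, psiPlusModeTerms, laurentTerms,
    transferCoeff_eq]
  rfl

theorem pointwiseFinite_psiModeTerms (m : ℤ) : PointwiseFinite (psiModeTerms m) := by
  rw [psiModeTerms_eq]
  exact (pointwiseFinite_phiMinusTerms m).pullback

theorem pointwiseFinite_psiPlusModeTerms (m : ℤ) : PointwiseFinite (psiPlusModeTerms m) := by
  rw [psiPlusModeTerms_eq]
  exact (pointwiseFinite_phiPlusTerms m).pullback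

theorem psiMode_eq (m : ℤ) : psiMode m = pullback (phiMinus m) := by
  rw [psiMode, psiModeTerms_eq]
  exact sumOp_pullback (pointwiseFinite_phiMinusTerms m)

theorem psiPlusMode_eq (m : ℤ) : psiPlusMode m = pullback (phiPlus m) := by
  rw [psiPlusMode, psiPlusModeTerms_eq]
  exact sumOp_pullback (pointwiseFinite_phiPlusTerms m)

theorem phiMinus_eq (m : ℤ) : phiMinus m = vertexOp qSymm m := by
  refine LinearMap.ext fun f => ?_
  have hterm (p) : phiMinusTerms m p f = qSymm p.1.1 * (tau f).coeff p.1.2 := by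
    rw [phiMinusTerms_eq, qSymm_natCast]
    rfl
  calc phiMinus m f
      = ∑ᶠ p, phiMinusTerms m p f := sumOp_apply (pointwiseFinite_phiMinusTerms m) f
    _ = ∑ᶠ p : {p : ℕ × ℕ // (p.1 : ℤ) - (p.2 : ℤ) = m}, qSymm p.1.1 * (tau f).coeff p.1.2 :=
        finsum_congr hterm
    _ = ∑ᶠ s : ℕ, qSymm (m + s) * (tau f).coeff s :=
        finsum_sub_eq (f := fun r s => qSymm r * (tau f).coeff s) fun r hr s => by
          rw [qSymm, intCoeff_of_neg _ hr, zero_mul]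
    _ = ∑ s ∈ (tau f).support, qSymm (m + s) * (tau f).coeff s :=
        finsum_eq_sum_of_support_subset _ fun s hs =>
          Polynomial.mem_support_iff.2 (right_ne_zero_of_mul hs)
    _ = vertexOp qSymm m f := by
        simp only [vertexOp_apply, umbralEval, Polynomial.lsum_apply, Polynomial.sum_def,
          LinearMap.toSpanSingleton_apply, smul_eq_mul, mul_comm]

theorem psiMode_relation (r s : ℤ) :
    psiMode (r - 1) * psiMode s - t • (psiMode r * psiMode (s - 1)) =
      t • (psiMode s * psiMode (r - 1)) - psiMode (s - 1) * psiMode r := by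
  have h : vertexOp qSymm (r - 1) * vertexOp qSymm s -
      t • (vertexOp qSymm r * vertexOp qSymm (s - 1)) =
      t • (vertexOp qSymm s * vertexOp qSymm (r - 1)) -
        vertexOp qSymm (s - 1) * vertexOp qSymm r :=
    LinearMap.ext fun f => vertexOp_qSymm_relation r s f
  simpa only [map_sub, map_smul, map_mul, ← phiMinus_eq, ← psiMode_eq] using congrArg pullback h

theorem iota_prod_psiMode (L : List ℕ) (c : ℤ) :
    iota ((L.map fun k : ℕ => psiMode (k : ℤ)).prod
      (Finsupp.single (Maya.ofPartition ⊥ c) 1)) =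
      Finsupp.single c ((L.map fun k : ℕ => vertexOp qSymm (k : ℤ)).prod 1) := by
  have h : (L.map fun k : ℕ => psiMode (k : ℤ)).prod =
      pullback (L.map fun k : ℕ => vertexOp qSymm (k : ℤ)).prod := by
    simp only [map_list_prod, List.map_map, Function.comp_def, psiMode_eq, phiMinus_eq]
  rw [h, iota_pullback, iota_vacuum, onBoson_single]

end

end HallLittlewoodIce

theorem proposition1p3 :
    -- the correspondence is an isomorphism
    Function.Bijective iota ∧
    -- `A(x;t)` is the transfer matrix of the six-vertex model, and it is invertible
    (∀ σ σ' : Maya,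
      PowerSeries.mk (fun m => transferCoeff m (Finsupp.single σ 1) σ') = rowPartition σ σ') ∧
    IsUnit transfer ∧
    -- the adjoints for the deformed inner products exist and are unique
    (∀ r : ℕ+, ∃! g : Module.End K Lam, LinearMap.IsAdjointPair tForm tForm (pMul r) g) ∧
    (∀ m : ℕ, ∃! g : Module.End K Fock,
      LinearMap.IsAdjointPair fockForm fockForm (transferCoeff m) g) ∧
    (∀ m : ℕ, ∃! g : Module.End K Fock,
      LinearMap.IsAdjointPair fockForm fockForm (transferInvCoeff m) g) ∧
    -- the coefficients of the formal Laurent series are well defined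
    (∀ m : ℤ, PointwiseFinite (phiMinusTerms m) ∧ PointwiseFinite (phiPlusTerms m) ∧
      PointwiseFinite (psiModeTerms m) ∧ PointwiseFinite (psiPlusModeTerms m)) ∧
    -- `Φ⁻(x;t) ∘ ι_t = ι_t ∘ A⁻¹(x;t) ∘ A^*(x;t)`
    (∀ m : ℤ, onBoson (phiMinus m) ∘ₗ iota = iota ∘ₗ psiMode m) ∧
    -- `Φ⁺(x;t) ∘ ι_t = ι_t ∘ A(x;t) ∘ (A⁻¹(x;t))^*`
    (∀ m : ℤ, onBoson (phiPlus m) ∘ₗ iota = iota ∘ₗ psiPlusMode m) ∧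
    -- the commutation relations
    (∀ r s : ℤ, psiMode (r - 1) * psiMode s - t • (psiMode r * psiMode (s - 1)) =
      t • (psiMode s * psiMode (r - 1)) - psiMode (s - 1) * psiMode r) ∧
    -- the Hall-Littlewood functions
    (∀ (lam : YoungDiagram) (c : ℤ), ∃ q : Lam, IsHallLittlewoodQ lam q ∧
      iota ((lam.rowLens.map fun k : ℕ => psiMode (k : ℤ)).prod
        (Finsupp.single (Maya.ofPartition ⊥ c) 1)) = Finsupp.single c q) := by
  refine ⟨iota_bijective, transfer_eq_rowPartition, transferUnit.isUnit, fun r => ?_, fun m => ?_,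
    fun m => ?_, fun m => ⟨pointwiseFinite_phiMinusTerms m, pointwiseFinite_phiPlusTerms m,
      pointwiseFinite_psiModeTerms m, pointwiseFinite_psiPlusModeTerms m⟩,
    fun m => ?_, fun m => ?_, psiMode_relation, fun lam c =>
      ⟨_, isHallLittlewoodQ_prod_vertexOp lam, iota_prod_psiMode lam.rowLens c⟩⟩
  · exact existsUnique_adjoint tForm_separatingRight (isAdjointPair_pMul r)
  · exact existsUnique_adjoint fockForm_separatingRight (isAdjointPair_transferCoeff m)
  · exact existsUnique_adjoint fockForm_separatingRight (isAdjointPair_transferInvCoeff m)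
  · rw [psiMode_eq, onBoson_comp_iota]
  · rw [psiPlusMode_eq, onBoson_comp_iota]
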